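/- Let $d\ge 1$ be odd, $\ell=\sqrt{2\pi/d}$, $\omega=e^{2\pi i/d}$, and $\mathbb T_L^2=[0,L)\times[0,L)$ (as a torus). On $\mathcal H=L^2(\mathbb R)$ let $\hat D(x,p)=e^{ixp/2}e^{-ix\hat p}e^{ip\hat x}$, i.e. $(\hat D(x,p)f)(y)=e^{ixp/2}e^{ip(y-x)}f(y-x)$. For a trace-class operator $\hat\rho$ the Zak–Gross Wigner function is $$W^{\mathrm{ZG}}_{\hat\rho}(u,v)=\mathrm{Tr}[\hat\Delta(u,v)\hat\rho]=\frac1{2\pi}\sum_{m,n\in\mathbb Z}(-1)^{mn}\,\mathrm{Tr}\big[\hat D(u,v)\hat D(n\ell,m\ell)\hat D(u,v)^\dagger\hat\rho\big].$$ On $\mathbb C^d$ with basis $(|j\rangle)_{j\in\mathbb Z_d}$ let $\hat X|j\rangle=|j+1\rangle$, $\hat Z|j\rangle=\omega^j|j\rangle$, $\hat D_d(a,b)=\omega^{\frac{d+1}2ab}\hat X^a\hat Z^b$, $\hat\Pi_d|j\rangle=|-j\rangle$, and let the Gross Wigner function of an operator $M$ on $\mathbb C^d$ be $W^{\mathrm{DV}}_M(a,b)=\mathrm{Tr}[\hat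 D_d(a,b)\hat\Pi_d\hat D_d(a,b)^\dagger M]$. The GKP codewords are the Dirac combs $|\bar j\rangle=\ell^{-1/2}\sum_{n\in\mathbb Z}|j\ell+d\ell n\rangle_{\hat x}$, $0\le j<d$, and $\hat P_{(0,0)}=\sum_j|\bar j\rangle\langle\bar j|$. For $(s,t)\in\mathbb T^2_\ell$, let $\underline{\hat\rho}(s,t)$ be the (unnormalised) logical state of $\hat P_{(0,0)}\hat D(s,t)^\dagger\hat\rho\hat D(s,t)\hat P_{(0,0)}$, that is, the $d\times d$ matrix $M$ for which that operator equals $\sum_{j,k}M_{jk}|\bar j\rangle\langle\bar k|$. Let $\hat\rho$ be a density operator on $\mathcal H$ (positive, of trace one). For $(u,v)\in\mathbb T^2_{d\ell}$ write $u=s+a\ell$, $v=t+b\ell$ with $(s,t)\in\mathbb T_\ell^2$ and $a,b\in\{0,\dots,d-1\}\cong\mathbb Z_d$. Then $$W^{\mathrm{ZG}}_{\hat\rho}(u,v)=W^{\mathrm{DV}}_{\underline{\hat\rho}(s,t)}(a,b),$$ in the following precise sense. (1) For every density operator $\hat\rho$: the series defining $W^{\mathrm{ZG}}_{\hat\rho}$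 converges, in the sense of distributions on the torus $\mathbb T^2_{d\ell}$, to an integrable function; if it converges absolutely at every point, then this function is its pointwise sum. The matrices $\underline{\hat\rho}(s,t)$ exist for almost every $(s,t)\in\mathbb T_\ell^2$: there are an ensemble $\hat\rho=\sum_{i\in\mathbb N}|\psi_i\rangle\langle\psi_i|$ and square-integrable functions $(s,t)\mapsto\langle\bar j|\hat D(s,t)^\dagger|\psi_i\rangle$, each the mean-square limit on $\mathbb T_\ell^2$ of the series $\ell^{-1/2}\sum_n(\hat D(s,t)^\dagger\psi_i)(j\ell+d\ell n)$, with $\underline{\hat\rho}(s,t)_{jk}=\sum_i\langle\bar j|\hat D(s,t)^\dagger|\psi_i\rangle\langle\psi_i|\hat D(s,t)|\bar k\rangle$ convergent for almost every $(s,t)$. The displayed identity holds for almost every $(u,v)\in\mathbb T^2_{d\ell}$, for every such ensemble and every such choice of functions. (2) If $\hat\rho$ has an integral kernel in the Schwartz space $\mathcal S(\mathbb R^2)$, then for every $(u,v)\in\mathbb T_{d\ell}^2$ the series defining $W^{\mathrm{ZG}}_{\hat\rho}(u,v)$ converges absolutely, there is exactly one matrix $\underline{\hat\rho}(s,t)$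 as above (as an identity of operators from Schwartz functions to tempered distributions), and the displayed identity holds. Thus the Zak–Gross Wigner function is a family of Gross Wigner functions indexed by the continuous parameter $(s,t)$, one for each displaced code space. -/

import Mathlib

open MeasureTheory Filter Topology Set
open scoped ContDiff InnerProductSpace SchwartzMap ENNReal ComplexConjugate

noncomputable section

/-! ### Continuous-variable side -/

/-- The Hilbert space of one bosonic mode, in the position representation. -/
abbrev ModeSpace : Type := Lp ℂ 2 (volume : Measure ℝ)

/-- `e^{- i x p̂}`: translation in position by `x`. -/
def translateFun (x : ℝ) (f : ℝ → ℂ) : ℝ → ℂ := fun y => f (y - x)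

/-- `e^{i p x̂}`: multiplication by the plane wave of momentum `p`. -/
def modulateFun (p : ℝ) (f : ℝ → ℂ) : ℝ → ℂ := fun y => Complex.exp (Complex.I * p * y) * f y

/-- The displacement `D(x,p) = e^{i x p / 2} e^{- i x p̂} e^{i p x̂} = e^{i (p x̂ - x p̂)}`,
acting on wave functions. -/
def displacementFun (x p : ℝ) (f : ℝ → ℂ) : ℝ → ℂ :=
  fun y => Complex.exp (Complex.I * x * p / 2) * translateFun x (modulateFun p f) y

theorem displacementFun_memLp (x p : ℝ) {f : ℝ → ℂ} (hf : MemLp f 2 volume) :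
    MemLp (displacementFun x p f) 2 volume := by
  have h1 : MemLp (modulateFun p f) 2 volume := by
    refine MemLp.of_le hf ?_ (Eventually.of_forall fun y => ?_)
    · exact AEStronglyMeasurable.mul (by fun_prop) hf.1
    · have : Complex.I * p * y = ((p * y : ℝ) : ℂ) * Complex.I := by push_cast; ring
      simp only [modulateFun, norm_mul, this, Complex.norm_exp_ofReal_mul_I, one_mul, le_refl]
  exact (h1.comp_measurePreserving (measurePreserving_sub_right volume x)).const_mul _

theorem norm_displacementFun (x p : ℝ) (f : ℝ → ℂ) (y : ℝ) :
    ‖displacementFun x p f y‖ = ‖f (y - x)‖ := by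
  have h1 : Complex.I * x * p / 2 = ((x * p / 2 : ℝ) : ℂ) * Complex.I := by push_cast; ring
  have h2 : Complex.I * p * ((y - x : ℝ) : ℂ) = ((p * (y - x) : ℝ) : ℂ) * Complex.I := by
    push_cast; ring
  simp only [displacementFun, translateFun, modulateFun, norm_mul]
  rw [h1, h2, Complex.norm_exp_ofReal_mul_I, Complex.norm_exp_ofReal_mul_I, one_mul, one_mul]

theorem displacementFun_congr (x p : ℝ) {f g : ℝ → ℂ} (h : f =ᵐ[volume] g) :
    displacementFun x p f =ᵐ[volume] displacementFun x p g := by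
  have h' := (measurePreserving_sub_right (volume : Measure ℝ) x).quasiMeasurePreserving.ae_eq_comp h
  filter_upwards [h'] with y hy
  have hy' : f (y - x) = g (y - x) := hy
  simp only [displacementFun, translateFun, modulateFun, hy']

/-- The displacement operator `D(x,p)` as a (unitary) bounded operator on the mode space. -/
def displacement (x p : ℝ) : ModeSpace →L[ℂ] ModeSpace :=
  LinearIsometry.toContinuousLinearMap
    { toFun := fun f => (displacementFun_memLp x p (Lp.memLp f)).toLp _
      map_add' := fun f g => by
        rw [← MemLp.toLp_add]
        refine MemLp.toLp_congr _ _ ((displacementFun_congr x p (Lp.coeFn_add f g)).trans ?_)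
        exact Eventually.of_forall fun y => by
          simp only [displacementFun, translateFun, modulateFun, Pi.add_apply]; ring
      map_smul' := fun c f => by
        rw [RingHom.id_apply, ← MemLp.toLp_const_smul]
        refine MemLp.toLp_congr _ _ ((displacementFun_congr x p (Lp.coeFn_smul c f)).trans ?_)
        exact Eventually.of_forall fun y => by
          simp only [displacementFun, translateFun, modulateFun, Pi.smul_apply, smul_eq_mul]; ring
      norm_map' := fun f => by
        change ‖(displacementFun_memLp x p (Lp.memLp f)).toLp _‖ = ‖f‖
        rw [Lp.norm_toLp, Lp.norm_def]
        congr 1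
        rw [eLpNorm_congr_norm_ae
          (Eventually.of_forall fun y => norm_displacementFun x p (f : ℝ → ℂ) y)]
        exact eLpNorm_comp_measurePreserving (Lp.aestronglyMeasurable f)
          (measurePreserving_sub_right volume x) }

/-- The index set of a fixed orthonormal basis of the mode space. -/
def modeIndex : Set ModeSpace := (exists_hilbertBasis ℂ ModeSpace).choose

/-- A fixed orthonormal basis of the mode space. -/
def modeBasis : HilbertBasis modeIndex ℂ ModeSpace :=
  (exists_hilbertBasis ℂ ModeSpace).choose_spec.choose

/-- The trace of an operator; for trace-class operators the value does not depend on the basis. -/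
def opTrace (A : ModeSpace →L[ℂ] ModeSpace) : ℂ :=
  ∑' i, ⟪modeBasis i, A (modeBasis i)⟫_ℂ

/-- Continuous-variable states: positive operators of trace one. -/
def IsDensityOperator (ρ : ModeSpace →L[ℂ] ModeSpace) : Prop :=
  ρ.IsPositive ∧ HasSum (fun i => ⟪modeBasis i, ρ (modeBasis i)⟫_ℂ) 1

/-- The logical step size `ℓ = √(2π/d)`. -/
def step (d : ℕ) : ℝ := Real.sqrt (2 * Real.pi / d)

/-- The fundamental cell `[0,L) × [0,L)` of the torus `𝕋²_L`. -/
def torusCell (L : ℝ) : Set (ℝ × ℝ) := Ico 0 L ×ˢ Ico 0 L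

/-! ### The Zak–Gross Wigner function -/

/-- The `(m,n)` term `(2π)⁻¹ (-1)^{mn} Tr[D(u,v) D(nℓ,mℓ) D(u,v)† A]` of the series
`Tr[Δ(u,v) A]`, where `Δ(u,v) = D(u,v) Δ(0,0) D(u,v)†` and
`Δ(0,0) = (2π)⁻¹ ∑_{m,n} (-1)^{mn} D(nℓ,mℓ)`; here `z = (u,v)` and `k = (m,n)`. -/
def zakGrossTerm (d : ℕ) (A : ModeSpace →L[ℂ] ModeSpace) (z : ℝ × ℝ) (k : ℤ × ℤ) : ℂ :=
  1 / (2 * Real.pi) * (-1 : ℂ) ^ (k.1 * k.2) *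
    opTrace (displacement z.1 z.2 ∘L displacement (k.2 * step d) (k.1 * step d) ∘L
      ContinuousLinearMap.adjoint (displacement z.1 z.2) ∘L A)

/-- The Zak–Gross Wigner function at a point, where the series converges absolutely. -/
def zakGrossWigner (d : ℕ) (A : ModeSpace →L[ℂ] ModeSpace) (z : ℝ × ℝ) : ℂ :=
  ∑' k : ℤ × ℤ, zakGrossTerm d A z k

/-- `W` is the Zak–Gross Wigner function of `A` as an integrable function on the torus `𝕋²_{dℓ}`:
the defining series converges to `W` in the sense of distributions on the torus.
This determines `W` almost everywhere. -/
def IsZakGrossWigner (d : ℕ) (A : ModeSpace →L[ℂ] ModeSpace) (W : ℝ × ℝ → ℂ) : Prop :=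
  IntegrableOn W (torusCell (d * step d)) ∧
  ∀ φ : ℝ × ℝ → ℂ, ContDiff ℝ ∞ φ →
    (∀ u v, φ (u + d * step d, v) = φ (u, v)) → (∀ u v, φ (u, v + d * step d) = φ (u, v)) →
    HasSum (fun k : ℤ × ℤ => ∫ z in torusCell (d * step d), φ z * zakGrossTerm d A z k)
      (∫ z in torusCell (d * step d), φ z * W z)

/-! ### The Gross Wigner function of a qudit -/

/-- `ω = e^{2πi/d}`. -/
def omega (d : ℕ) : ℂ := Complex.exp (2 * Real.pi * Complex.I / d)

/-- The generalized Pauli operator `X |j⟩ = |j+1⟩`. -/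
def pauliX (d : ℕ) : Matrix (ZMod d) (ZMod d) ℂ :=
  Matrix.of fun i j => if i = j + 1 then 1 else 0

/-- The generalized Pauli operator `Z |j⟩ = ω^j |j⟩`. -/
def pauliZ (d : ℕ) : Matrix (ZMod d) (ZMod d) ℂ :=
  Matrix.diagonal fun j => omega d ^ j.val

/-- The discrete displacement `ω^{ab/2} X^a Z^b`, with `1/2 = (d+1)/2` modulo the odd number `d`. -/
def quditDisplacement (d : ℕ) [NeZero d] (a b : ZMod d) : Matrix (ZMod d) (ZMod d) ℂ :=
  omega d ^ ((d + 1) / 2 * a.val * b.val) • (pauliX d ^ a.val * pauliZ d ^ b.val)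

/-- The undisplaced parity operator `|j⟩ ↦ |-j⟩`. -/
def quditParity (d : ℕ) : Matrix (ZMod d) (ZMod d) ℂ :=
  Matrix.of fun i j => if i = -j then 1 else 0

/-- The Gross Wigner function `W^{DV}_M(a,b) = Tr[Π_d(a,b) M]`,
with `Π_d(a,b) = D_d(a,b) Π_d(0,0) D_d(a,b)†`. -/
def grossWigner (d : ℕ) [NeZero d] (M : Matrix (ZMod d) (ZMod d) ℂ) (a b : ZMod d) : ℂ :=
  Matrix.trace (quditDisplacement d a b * quditParity d *
    (quditDisplacement d a b).conjTranspose * M)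

/-! ### GKP codewords and error correction -/

/-- The codeword `|j̄⟩ = ℓ^{-1/2} ∑_n |jℓ + dℓn⟩`, a Dirac comb, as a functional. Being real, it
gives both `⟨j̄|f⟩` and the distribution `|j̄⟩` evaluated on a test function. -/
def codeword (d : ℕ) (j : ZMod d) (f : ℝ → ℂ) : ℂ :=
  1 / (Real.sqrt (step d) : ℂ) * ∑' n : ℤ, f (j.val * step d + d * step d * n)

/-- The projector `P_{(0,0)} = ∑_j |j̄⟩⟨j̄|`, which maps test functions to distributions. -/
def codeProjector (d : ℕ) [NeZero d] (f : ℝ → ℂ) : (ℝ → ℂ) → ℂ :=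
  fun h => ∑ j : ZMod d, codeword d j f * codeword d j h

/-- The action on a distribution `T` of the operator with integral kernel `K`. -/
def kernelApply (K : ℝ × ℝ → ℂ) (T : (ℝ → ℂ) → ℂ) : ℝ → ℂ := fun x => T fun y => K (x, y)

/-- `P_{(0,0)} A P_{(0,0)}`, where `A` is the operator with integral kernel `K`. -/
def projectKernel (d : ℕ) [NeZero d] (K : ℝ × ℝ → ℂ) (f : ℝ → ℂ) : (ℝ → ℂ) → ℂ :=
  codeProjector d (kernelApply K (codeProjector d f))

/-- The GKP encoding `∑_{j,k} M_{jk} |j̄⟩⟨k̄|` of a qudit operator `M`. -/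
def encode (d : ℕ) [NeZero d] (M : Matrix (ZMod d) (ZMod d) ℂ) (f : ℝ → ℂ) : (ℝ → ℂ) → ℂ :=
  fun h => ∑ j : ZMod d, ∑ k : ZMod d, M j k * codeword d k f * codeword d j h

/-- `K` is the integral kernel of the operator `A`. -/
def IsKernel (A : ModeSpace →L[ℂ] ModeSpace) (K : ℝ × ℝ → ℂ) : Prop :=
  ∀ f : ModeSpace, (A f : ℝ → ℂ) =ᵐ[volume] fun x => ∫ y, K (x, y) * f y

/-- `M` is the logical state of `P_{(0,0)} D(s,t)† A D(s,t) P_{(0,0)}`, for an operator `A`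
such that `D(s,t)† A D(s,t)` has a Schwartz kernel. -/
def IsLogicalState (d : ℕ) [NeZero d] (A : ModeSpace →L[ℂ] ModeSpace) (s t : ℝ)
    (M : Matrix (ZMod d) (ZMod d) ℂ) : Prop :=
  ∃ K : 𝓢(ℝ × ℝ, ℂ),
    IsKernel (ContinuousLinearMap.adjoint (displacement s t) ∘L A ∘L displacement s t) K ∧
    ∀ f h : 𝓢(ℝ, ℂ), projectKernel d K f h = encode d M f h

/-- `Φ (s,t) j = ⟨j̄| D(s,t)† |ψ⟩` for a square-integrable `ψ`: as a function of the syndrome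
`(s,t)`, the defining series `ℓ^{-1/2} ∑_n (D(s,t)† ψ)(jℓ + dℓn)`, with `D(s,t)† = D(-s,-t)`,
converges to `Φ · j` in mean square on `𝕋²_ℓ`. This determines `Φ` almost everywhere there, and
`P_{(0,0)} D(s,t)† |ψ⟩ = ∑_j Φ (s,t) j |j̄⟩`. -/
def IsSyndromeAmplitude (d : ℕ) (ψ : ModeSpace) (Φ : ℝ × ℝ → ZMod d → ℂ) : Prop :=
  ∀ j : ZMod d,
    MemLp (fun z => Φ z j) 2 (volume.restrict (torusCell (step d))) ∧
    Tendsto (fun F : Finset ℤ => eLpNorm (fun z : ℝ × ℝ =>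
        1 / (Real.sqrt (step d) : ℂ) *
          ∑ n ∈ F, displacementFun (-z.1) (-z.2) ψ (j.val * step d + d * step d * n) - Φ z j)
      2 (volume.restrict (torusCell (step d)))) atTop (𝓝 0)

/-- `R (s,t)` is, for almost every syndrome `(s,t)`, the logical state of
`P_{(0,0)} D(s,t)† ρ D(s,t) P_{(0,0)}`: for some ensemble of pure states
`ρ = ∑_i |ψ_i⟩⟨ψ_i|`, the matrix `R (s,t)` is the sum over `i` of the matrices
`⟨j̄| D(s,t)† |ψ_i⟩⟨ψ_i| D(s,t) |k̄⟩`. -/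
def IsLogicalFamily (d : ℕ) (ρ : ModeSpace →L[ℂ] ModeSpace)
    (R : ℝ × ℝ → Matrix (ZMod d) (ZMod d) ℂ) : Prop :=
  ∃ (ψ : ℕ → ModeSpace) (Φ : ℕ → ℝ × ℝ → ZMod d → ℂ),
    (∀ f : ModeSpace, HasSum (fun i => ⟪ψ i, f⟫_ℂ • ψ i) (ρ f)) ∧
    (∀ i, IsSyndromeAmplitude d (ψ i) (Φ i)) ∧
    ∀ᵐ z ∂volume.restrict (torusCell (step d)), ∀ j k : ZMod d,
      HasSum (fun i => Φ i z j * conj (Φ i z k)) (R z j k)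

end

/-!
# The Zak–Gross Wigner function is a family of Gross Wigner functions

Write `ℓ = √(2π/d)` and `2h = d + 1`, so that `h` is the inverse of `2` modulo the odd number `d`.

Displacements commute up to a phase, so the defining series of the Zak–Gross Wigner function is a
Fourier series on the torus of side `dℓ` (`zakGrossTerm_eq`), whose coefficients are
`(2π)⁻¹ (-1)^{mn} Tr[D(nℓ,mℓ) ρ]`. The sign `(-1)^{mn}` together with the phase `e^{imnℓ²/2}` of the
displacement operator is `ω^{mnh}` (`neg_one_zpow_mul_exp`), the phase of the qudit displacement
operators.

*General states.* Let `Φ (s,t) j = ⟨j̄|D(s,t)†|ψ⟩`. Cutting the line into intervals of length `ℓ`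
and using that the waves `e^{itdℓN}` are orthogonal on `[0,ℓ)`, the discrete Fourier sum over `j`
of the correlations `∫ Φ_j Φ̄_{j+n} e^{i(mℓs - nℓt)}` is `∫ e^{imℓy} ψ(y) ψ̄(y + nℓ) dy`
(`IsSyndromeAmplitude.sum_integral`). On the qudit side, the symplectic Fourier transform of the
Gross Wigner function gives the same sums with the phase `ω^{mnh}`
(`sum_stdAddChar_mul_grossWigner`). Hence the function which equals the Gross Wigner function of
the logical state on each of the `d²` small cells of the torus (`assembledWigner`) has the Fourier
coefficients of the Zak–Gross series (`torusCoeff_assembledWigner`), after a sum over an ensemble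
of `ρ`. Fourier coefficients of smooth functions are summable, so the series converges to it in
the sense of distributions, and the limit is unique almost everywhere
(`IsLogicalFamily.isZakGrossWigner`, `IsZakGrossWigner.ae_eq`).

*Schwartz kernels.* The trace of `D(nℓ,mℓ) ρ` is the integral of its kernel over the diagonal
(`opTrace_eq_integral_diagonal`); as the diagonal is a null set, this is proved by averaging over
finer and finer grids. Integration by parts along the diagonal gives absolute convergence, and
Poisson summation in `m` turns the series into the sum of the kernel, sampled on the lattice
`(u,u) + ℓℤ²` with phases, over the antidiagonals `r + q ∈ dℤ`
(`IsDensityOperator.zakGrossWigner_eq`). The entries of the logical state are sums of samples of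
the kernel as well, and the Gross Wigner function at `(a,b)` selects the pairs of residue classes
with `j + k = 2a`, which are the same antidiagonals (`grossWigner_logicalMatrix`). The logical
state is unique because a Schwartz kernel is determined by its operator
(`IsKernel.eq_of_schwartz`) and test functions separate the codewords (`encode_injective`).
-/

/-! ### Displacement operators -/

theorem step_pos (d : ℕ) [NeZero d] : 0 < step d := by
  have : (0 : ℝ) < d := Nat.cast_pos.mpr (Nat.pos_of_ne_zero (NeZero.ne d))
  exact Real.sqrt_pos.mpr (by positivity)

theorem step_mul_step (d : ℕ) [NeZero d] : step d * step d = 2 * Real.pi / d :=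
  Real.mul_self_sqrt (by positivity)

theorem nat_mul_step_mul_step (d : ℕ) [NeZero d] : d * step d * step d = 2 * Real.pi := by
  have : (d : ℝ) ≠ 0 := Nat.cast_ne_zero.mpr (NeZero.ne d)
  rw [mul_assoc, step_mul_step]
  field_simp

theorem displacementFun_apply (x p : ℝ) (f : ℝ → ℂ) (y : ℝ) :
    displacementFun x p f y =
      Complex.exp (Complex.I * (p * y - x * p / 2 : ℝ)) * f (y - x) := by
  simp only [displacementFun, translateFun, modulateFun]
  rw [← mul_assoc, ← Complex.exp_add]
  congr 2
  push_cast
  ring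

theorem coeFn_displacement (x p : ℝ) (f : ModeSpace) :
    (displacement x p f : ℝ → ℂ) =ᵐ[volume] displacementFun x p f :=
  MemLp.coeFn_toLp (displacementFun_memLp x p (Lp.memLp f))

/-- The composition law of the Weyl–Heisenberg group. -/
theorem displacement_comp (x p x' p' : ℝ) :
    displacement x p ∘L displacement x' p' =
      Complex.exp (Complex.I * ((x' * p - x * p') / 2 : ℝ)) • displacement (x + x') (p + p') := by
  ext1 f
  apply Lp.ext
  have h2 := displacementFun_congr x p (coeFn_displacement x' p' f)
  have h3 := Lp.coeFn_smul (Complex.exp (Complex.I * ((x' * p - x * p') / 2 : ℝ)))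
    (displacement (x + x') (p + p') f)
  simp only [ContinuousLinearMap.comp_apply, _root_.smul_apply]
  filter_upwards [coeFn_displacement x p (displacement x' p' f), h2, h3,
    coeFn_displacement (x + x') (p + p') f] with y e1 e2 e3 e4
  rw [e1, e2, e3, Pi.smul_apply, e4, displacementFun_apply, displacementFun_apply,
    displacementFun_apply, smul_eq_mul, ← mul_assoc, ← mul_assoc, ← Complex.exp_add,
    ← Complex.exp_add, sub_sub]
  congr 2
  push_cast
  ring

theorem displacement_zero : displacement 0 0 = ContinuousLinearMap.id ℂ ModeSpace := by
  ext1 f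
  apply Lp.ext
  filter_upwards [coeFn_displacement 0 0 f] with y e1
  rw [e1, displacementFun_apply]
  simp

theorem norm_displacement_apply (x p : ℝ) (f : ModeSpace) : ‖displacement x p f‖ = ‖f‖ := by
  rw [displacement, LinearIsometry.coe_toContinuousLinearMap, LinearIsometry.norm_map]

theorem adjoint_displacement (x p : ℝ) :
    ContinuousLinearMap.adjoint (displacement x p) = displacement (-x) (-p) := by
  have h1 : ContinuousLinearMap.adjoint (displacement x p) ∘L displacement x p = 1 :=
    (ContinuousLinearMap.norm_map_iff_adjoint_comp_self _).mp (norm_displacement_apply x p)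
  have h2 : displacement x p ∘L displacement (-x) (-p) = ContinuousLinearMap.id ℂ ModeSpace := by
    rw [displacement_comp, ← displacement_zero]
    simp [mul_comm]
  calc ContinuousLinearMap.adjoint (displacement x p)
      = ContinuousLinearMap.adjoint (displacement x p) ∘L
          (displacement x p ∘L displacement (-x) (-p)) := by rw [h2]; rfl
    _ = (ContinuousLinearMap.adjoint (displacement x p) ∘L displacement x p) ∘L
          displacement (-x) (-p) := rfl
    _ = displacement (-x) (-p) := by rw [h1]; rfl

/-- Displacements commute up to a phase, so conjugation by `D(u,v)` multiplies `D(x,p)` by a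
plane wave in `(u,v)`. -/
theorem displacement_conj (u v x p : ℝ) :
    displacement u v ∘L displacement x p ∘L ContinuousLinearMap.adjoint (displacement u v) =
      Complex.exp (Complex.I * (x * v - u * p : ℝ)) • displacement x p := by
  rw [adjoint_displacement, displacement_comp x p, ContinuousLinearMap.comp_smul,
    displacement_comp, smul_smul, ← Complex.exp_add]
  congr 2
  · push_cast; ring
  · ring
  · ring

/-! ### The Gross Wigner function as a sum of matrix entries -/

theorem omega_pow (d : ℕ) [NeZero d] (n : ℕ) :
    omega d ^ n = ZMod.stdAddChar (N := d) (n : ZMod d) := by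
  have := ZMod.stdAddChar_coe (N := d) (n : ℤ)
  rw [omega, ← Complex.exp_nat_mul]
  rw [Int.cast_natCast] at this
  rw [this]
  congr 1
  push_cast
  ring

theorem conj_stdAddChar (d : ℕ) [NeZero d] (x : ZMod d) :
    conj (ZMod.stdAddChar x : ℂ) = ZMod.stdAddChar (-x) := by
  rw [AddChar.map_neg_eq_conj]

theorem norm_stdAddChar (d : ℕ) [NeZero d] (x : ZMod d) : ‖(ZMod.stdAddChar x : ℂ)‖ = 1 :=
  AddChar.norm_apply _ _

theorem pauliX_pow_apply (d : ℕ) [NeZero d] (n : ℕ) (i j : ZMod d) :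
    (pauliX d ^ n) i j = if i = j + n then 1 else 0 := by
  induction n generalizing i j with
  | zero => simp [Matrix.one_apply]
  | succ n ih =>
    have hX : ∀ k, pauliX d k j = if k = j + 1 then 1 else 0 := fun k => by
      rw [pauliX, Matrix.of_apply]
    rw [pow_succ, Matrix.mul_apply]
    simp only [ih, hX, mul_ite, mul_one, mul_zero]
    rw [Finset.sum_ite_eq' Finset.univ (j + 1)]
    simp [add_assoc, add_comm (1 : ZMod d)]

theorem pauliX_mul_pauliZ_apply (d : ℕ) [NeZero d] (a b i j : ZMod d) :
    (pauliX d ^ a.val * pauliZ d ^ b.val) i j =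
      if i = j + a then (ZMod.stdAddChar (b * j) : ℂ) else 0 := by
  rw [pauliZ, Matrix.diagonal_pow, Matrix.mul_diagonal, pauliX_pow_apply]
  rw [Pi.pow_apply, ← pow_mul, omega_pow]
  simp only [ZMod.natCast_val, ZMod.cast_id', id_eq, Nat.cast_mul, ite_mul, one_mul, zero_mul,
    mul_comm j b]

/-- The phase of `D_d(a,b)` cancels in `D_d(a,b) Π_d D_d(a,b)†`, which is a reflection
`|j⟩ ↦ |2a - j⟩` twisted by a character. -/
theorem grossWigner_eq_sum (d : ℕ) [NeZero d] (M : Matrix (ZMod d) (ZMod d) ℂ) (a b : ZMod d) :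
    grossWigner d M a b =
      ∑ j, (ZMod.stdAddChar (2 * b * (a - j)) : ℂ) * M j (2 * a - j) := by
  have hD : quditDisplacement d a b * quditParity d * (quditDisplacement d a b).conjTranspose =
      Matrix.of fun i j => if i = 2 * a - j then (ZMod.stdAddChar (2 * b * (a - j)) : ℂ) else 0 := by
    have hw : ∀ n, omega d ^ n * star (omega d ^ n) = 1 := fun n => by
      rw [omega_pow, Complex.star_def, Complex.mul_conj, Complex.normSq_eq_norm_sq,
        norm_stdAddChar]
      norm_num
    ext i j
    have hP := pauliX_mul_pauliZ_apply d a b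
    have hQ : ∀ k l : ZMod d, quditParity d k l = if k = -l then 1 else 0 := fun k l => by
      rw [quditParity, Matrix.of_apply]
    rw [quditDisplacement, Matrix.conjTranspose_smul, Matrix.smul_mul, Matrix.smul_mul,
      Matrix.mul_smul, smul_smul, hw, one_smul, Matrix.mul_apply]
    generalize pauliX d ^ a.val * pauliZ d ^ b.val = P at hP
    simp only [Matrix.mul_apply, Matrix.conjTranspose_apply, hP, hQ, Matrix.of_apply,
      mul_ite, mul_one, mul_zero]
    rw [Finset.sum_eq_single (j - a)]
    · rw [Finset.sum_eq_single (a - j)]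
      · have e1 : i = a - j + a ↔ i = 2 * a - j := by rw [show a - j + a = 2 * a - j by ring]
        have e2 : a - j = -(j - a) := by ring
        rw [if_pos e2]
        simp only [e1, sub_add_cancel, if_true]
        split_ifs with h
        · rw [Complex.star_def, conj_stdAddChar, ← AddChar.map_add_eq_mul]
          congr 1
          ring
        · simp
      · intro k _ hk
        rw [if_neg]
        rintro rfl
        exact hk (by ring)
      · simp
    · intro k _ hk
      rw [if_neg (fun h => hk (by rw [h]; ring)), star_zero, mul_zero]
    · simp
  rw [grossWigner, hD, Matrix.trace]
  simp only [Matrix.diag_apply, Matrix.mul_apply, Matrix.of_apply, ite_mul, zero_mul]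
  rw [Finset.sum_comm]
  refine Finset.sum_congr rfl fun j _ => ?_
  rw [Finset.sum_ite_eq' Finset.univ]
  simp

/-- The symplectic Fourier transform of the Gross Wigner function gives the qudit
characteristic function. -/
theorem sum_stdAddChar_mul_grossWigner (d : ℕ) [NeZero d] (M : Matrix (ZMod d) (ZMod d) ℂ)
    (m n h : ZMod d) (hh : 2 * h = 1) :
    ∑ a, ∑ b, (ZMod.stdAddChar (m * a - n * b) : ℂ) * grossWigner d M a b =
      d * ∑ j, (ZMod.stdAddChar (m * (j + n * h)) : ℂ) * M j (j + n) := by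
  have key : ∀ a j : ZMod d, ∑ b, (ZMod.stdAddChar (m * a - n * b) : ℂ) *
      ((ZMod.stdAddChar (2 * b * (a - j)) : ℂ) * M j (2 * a - j)) =
      if a = j + n * h then (d : ℂ) * ((ZMod.stdAddChar (m * (j + n * h)) : ℂ) * M j (j + n))
        else 0 := by
    intro a j
    have e : ∀ b, (ZMod.stdAddChar (m * a - n * b) : ℂ) *
        ((ZMod.stdAddChar (2 * b * (a - j)) : ℂ) * M j (2 * a - j)) =
        ((ZMod.stdAddChar (m * a) : ℂ) * M j (2 * a - j)) *
          (ZMod.stdAddChar (b * (2 * (a - j) - n)) : ℂ) := fun b => by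
      generalize M j (2 * a - j) = x
      rw [← mul_assoc, ← AddChar.map_add_eq_mul,
        mul_right_comm (ZMod.stdAddChar (m * a) : ℂ) x, ← AddChar.map_add_eq_mul]
      congr 2
      ring
    simp only [e]
    rw [← Finset.mul_sum, AddChar.sum_mulShift _ (ZMod.isPrimitive_stdAddChar d)]
    have e2 : 2 * (a - j) - n = 0 ↔ a = j + n * h := by
      constructor
      · intro h0
        linear_combination h * h0 - (a - j) * hh
      · rintro rfl
        linear_combination n * hh
    simp only [e2]
    split_ifs with h0
    · have e3 : 2 * a - j = j + n := by rw [h0]; linear_combination n * hh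
      rw [e3, h0, ZMod.card]
      ring
    · simp
  simp only [grossWigner_eq_sum, Finset.mul_sum]
  calc _ = ∑ a, ∑ j, ∑ b, (ZMod.stdAddChar (m * a - n * b) : ℂ) *
      ((ZMod.stdAddChar (2 * b * (a - j)) : ℂ) * M j (2 * a - j)) :=
        Finset.sum_congr rfl fun a _ => Finset.sum_comm
    _ = _ := by
      simp only [key]
      rw [Finset.sum_comm]
      refine Finset.sum_congr rfl fun j _ => ?_
      rw [Finset.sum_ite_eq' Finset.univ]
      simp

/-! ### Ensembles and traces -/

theorem HasSum.congr_eq {ι α : Type*} [AddCommMonoid α] [TopologicalSpace α] {f g : ι → α} {a b : α}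
    (h : HasSum f a) (hfg : ∀ i, f i = g i) (hab : a = b) : HasSum g b := by
  obtain rfl : f = g := funext hfg
  exact hab ▸ h

section Hilbert

variable {H ι : Type*} [NormedAddCommGroup H] [InnerProductSpace ℂ H]

/-- `ρ = ∑_i |ψ_i⟩⟨ψ_i|`, the series converging strongly. -/
def IsEnsemble (ρ : H →L[ℂ] H) (ψ : ℕ → H) : Prop :=
  ∀ f : H, HasSum (fun i => ⟪ψ i, f⟫_ℂ • ψ i) (ρ f)

theorem HilbertBasis.hasSum_norm_inner_sq (b : HilbertBasis ι ℂ H) (x : H) :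
    HasSum (fun i => ‖⟪b i, x⟫_ℂ‖ ^ 2) (‖x‖ ^ 2) := by
  refine (Complex.hasSum_re (b.hasSum_inner_mul_inner x x)).congr_eq (fun i => ?_) ?_
  · rw [← inner_conj_symm x, Complex.conj_mul', ← Complex.ofReal_pow, Complex.ofReal_re]
  · rw [inner_self_eq_norm_sq_to_K, ← RCLike.ofReal_pow]; rfl

theorem IsEnsemble.summable_norm_sq {ρ : H →L[ℂ] H} {ψ : ℕ → H}
    (h : IsEnsemble ρ ψ) (b : HilbertBasis ι ℂ H)
    (hρ : Summable fun i => ⟪b i, ρ (b i)⟫_ℂ) : Summable fun i => ‖ψ i‖ ^ 2 := by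
  have h1 : ∀ j, HasSum (fun i => ‖⟪b j, ψ i⟫_ℂ‖ ^ 2) (⟪b j, ρ (b j)⟫_ℂ).re := fun j => by
    refine (Complex.hasSum_re ((h (b j)).mapL (innerSL ℂ (b j)))).congr_eq (fun i => ?_) rfl
    rw [innerSL_apply_apply, inner_smul_right, ← inner_conj_symm (ψ i), Complex.conj_mul',
      ← Complex.ofReal_pow, Complex.ofReal_re]
  have h2 : Summable fun p : ι × ℕ => ‖⟪b p.1, ψ p.2⟫_ℂ‖ ^ 2 := by
    refine (summable_prod_of_nonneg fun _ => by positivity).mpr ⟨fun j => (h1 j).summable, ?_⟩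
    simp only [(h1 _).tsum_eq]
    exact (Complex.hasSum_re hρ.hasSum).summable
  have h3 := (summable_prod_of_nonneg (f := fun p : ℕ × ι =>
    ‖⟪b p.2, ψ p.1⟫_ℂ‖ ^ 2) fun _ => by positivity).mp h2.prod_symm
  simpa only [(HilbertBasis.hasSum_norm_inner_sq b _).tsum_eq] using h3.2

theorem HilbertBasis.summable_norm_inner_sq (b : HilbertBasis ι ℂ H) {φ : ℕ → H}
    (hφ : Summable fun i => ‖φ i‖ ^ 2) :
    Summable fun p : ℕ × ι => ‖⟪b p.2, φ p.1⟫_ℂ‖ ^ 2 := by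
  refine (summable_prod_of_nonneg fun _ => by positivity).mpr
    ⟨fun i => (HilbertBasis.hasSum_norm_inner_sq b (φ i)).summable, ?_⟩
  simpa only [(HilbertBasis.hasSum_norm_inner_sq b _).tsum_eq] using hφ

theorem mul_le_sq_add_sq (x y : ℝ) : x * y ≤ x ^ 2 + y ^ 2 := by
  nlinarith [sq_nonneg (x - y), sq_nonneg x, sq_nonneg y]

/-- The trace of `Bρ` is the ensemble average of `B`. -/
theorem IsEnsemble.hasSum_trace {ρ : H →L[ℂ] H} {ψ : ℕ → H} (h : IsEnsemble ρ ψ)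
    (hψ : Summable fun i => ‖ψ i‖ ^ 2) (b : HilbertBasis ι ℂ H) (B : H →L[ℂ] H) :
    HasSum (fun i => ⟪ψ i, B (ψ i)⟫_ℂ) (∑' j, ⟪b j, B (ρ (b j))⟫_ℂ) := by
  obtain ⟨T, hT⟩ : ∃ T : ℕ × ι → ℂ, ∀ p, T p = ⟪ψ p.1, b p.2⟫_ℂ * ⟪b p.2, B (ψ p.1)⟫_ℂ :=
    ⟨_, fun _ => rfl⟩
  have hB : Summable fun i => ‖B (ψ i)‖ ^ 2 := by
    refine Summable.of_nonneg_of_le (fun _ => by positivity) (fun i => ?_)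
      (hψ.mul_left (‖B‖ ^ 2))
    rw [← mul_pow]
    exact pow_le_pow_left₀ (norm_nonneg _) (B.le_opNorm _) 2
  have hTs : Summable T := by
    refine Summable.of_norm_bounded ((b.summable_norm_inner_sq hψ).add
      (b.summable_norm_inner_sq hB)) fun p => ?_
    rw [hT, norm_mul, norm_inner_symm]
    exact mul_le_sq_add_sq _ _
  have h1 : HasSum (fun i => ⟪ψ i, B (ψ i)⟫_ℂ) (∑' p, T p) :=
    hTs.hasSum.prod_fiberwise fun i =>
      (b.hasSum_inner_mul_inner _ _).congr_eq (fun j => (hT (i, j)).symm) rfl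
  have h4 : HasSum (fun p : ι × ℕ => T p.swap) (∑' p, T p) :=
    (Equiv.prodComm ι ℕ).hasSum_iff.mpr hTs.hasSum
  have h3 : HasSum (fun j => ⟪b j, B (ρ (b j))⟫_ℂ) (∑' p, T p) := by
    refine h4.prod_fiberwise fun j => ?_
    refine ((h (b j)).mapL (innerSL ℂ (b j) ∘L B)).congr_eq (fun i => ?_) rfl
    simp only [ContinuousLinearMap.comp_apply, map_smul, innerSL_apply_apply, smul_eq_mul, hT,
      Prod.fst_swap, Prod.snd_swap]
  rw [h3.tsum_eq]
  exact h1

/-- A positive trace-class operator is the ensemble of the vectors `√ρ e_i`, of which at most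
countably many are nonzero, for an orthonormal basis `e_i`. -/
theorem ContinuousLinearMap.IsPositive.exists_isEnsemble [CompleteSpace H] {ρ : H →L[ℂ] H}
    (hρ : ρ.IsPositive) (b : HilbertBasis ι ℂ H) (hs : Summable fun i => ⟪b i, ρ (b i)⟫_ℂ) :
    ∃ ψ, IsEnsemble ρ ψ := by
  have hpos : 0 ≤ ρ := (ContinuousLinearMap.nonneg_iff_isPositive ρ).mpr hρ
  obtain ⟨B, hB, hBB⟩ : ∃ B : H →L[ℂ] H, IsSelfAdjoint B ∧ B * B = ρ :=
    ⟨CFC.sqrt ρ, (CFC.sqrt_nonneg ρ).isSelfAdjoint, CFC.sqrt_mul_sqrt_self ρ hpos⟩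
  have hsymm : ∀ x y, ⟪B x, y⟫_ℂ = ⟪x, B y⟫_ℂ := fun x y => by
    rw [← ContinuousLinearMap.adjoint_inner_right, hB.adjoint_eq]
  have hBB' : ∀ x, B (B x) = ρ x := fun x => by rw [← hBB]; rfl
  have hsum : ∀ f, HasSum (fun i => ⟪B (b i), f⟫_ℂ • B (b i)) (ρ f) := fun f => by
    refine ((b.hasSum_repr (B f)).mapL B).congr_eq (fun i => ?_) (hBB' f)
    rw [map_smul, HilbertBasis.repr_apply_apply, hsymm]
  have hcount : Countable (Function.support fun i => B (b i)) := by
    have hs : Summable fun i => ‖B (b i)‖ ^ 2 := by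
      refine (Complex.hasSum_re hs.hasSum).summable.congr fun i => ?_
      rw [← hBB', ← hsymm, inner_self_eq_norm_sq_to_K, ← RCLike.ofReal_pow]
      rfl
    refine (hs.countable_support.mono fun i hi => ?_).to_subtype
    exact pow_ne_zero 2 (norm_ne_zero_iff.mpr hi)
  obtain ⟨e, he⟩ := hcount.exists_injective_nat
  refine ⟨Function.extend e (fun i => B (b i)) 0, fun f => ?_⟩
  have h1 : HasSum (fun i : Function.support fun i => B (b i) =>
      ⟪B (b i), f⟫_ℂ • B (b i)) (ρ f) := by
    refine (hasSum_subtype_iff_of_support_subset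
      (f := fun i => ⟪B (b i), f⟫_ℂ • B (b i)) fun i hi => ?_).mpr (hsum f)
    intro h0
    simp [h0] at hi
  refine ((hasSum_extend_zero he).mpr h1).congr_eq (fun n => ?_) rfl
  by_cases hn : ∃ i, e i = n
  · obtain ⟨i, rfl⟩ := hn
    simp only [he.extend_apply]
  · simp only [Function.extend_apply' _ _ _ hn, Pi.zero_apply, smul_zero]

end Hilbert

theorem IsDensityOperator.exists_isEnsemble {ρ : ModeSpace →L[ℂ] ModeSpace}
    (hρ : IsDensityOperator ρ) : ∃ ψ, IsEnsemble ρ ψ :=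
  hρ.1.exists_isEnsemble modeBasis hρ.2.summable

theorem IsEnsemble.hasSum_opTrace {ρ : ModeSpace →L[ℂ] ModeSpace} {ψ : ℕ → ModeSpace}
    (h : IsEnsemble ρ ψ) (hψ : Summable fun i => ‖ψ i‖ ^ 2) (B : ModeSpace →L[ℂ] ModeSpace) :
    HasSum (fun i => ⟪ψ i, B (ψ i)⟫_ℂ) (opTrace (B ∘L ρ)) :=
  h.hasSum_trace hψ modeBasis B

/-- The Zak–Gross series is a Fourier series in the phase-space point. -/
theorem zakGrossTerm_eq (d : ℕ) (A : ModeSpace →L[ℂ] ModeSpace) (z : ℝ × ℝ) (k : ℤ × ℤ) :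
    zakGrossTerm d A z k = zakGrossTerm d A 0 k *
      Complex.exp (Complex.I * (step d * (k.2 * z.2 - k.1 * z.1) : ℝ)) := by
  have h0 : ∀ w : ℝ × ℝ, zakGrossTerm d A w k = 1 / (2 * Real.pi) * (-1 : ℂ) ^ (k.1 * k.2) *
      (Complex.exp (Complex.I * (step d * (k.2 * w.2 - k.1 * w.1) : ℝ)) *
        opTrace (displacement (k.2 * step d) (k.1 * step d) ∘L A)) := fun w => by
    rw [zakGrossTerm, ← ContinuousLinearMap.comp_assoc (displacement (k.2 * step d) _),
      ← ContinuousLinearMap.comp_assoc, displacement_conj, ContinuousLinearMap.smul_comp]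
    simp only [opTrace, _root_.smul_apply, inner_smul_right, tsum_mul_left]
    congr 5
    ring
  rw [h0, h0 0]
  simp
  ring

theorem zakGrossTerm_zero (d : ℕ) (A : ModeSpace →L[ℂ] ModeSpace) (k : ℤ × ℤ) :
    zakGrossTerm d A 0 k = 1 / (2 * Real.pi) * (-1 : ℂ) ^ (k.1 * k.2) *
      opTrace (displacement (k.2 * step d) (k.1 * step d) ∘L A) := by
  rw [zakGrossTerm, ← ContinuousLinearMap.comp_assoc (displacement (k.2 * step d) _),
    ← ContinuousLinearMap.comp_assoc, displacement_conj, ContinuousLinearMap.smul_comp]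
  simp

/-! ### Fourier series on the torus -/

/-- The plane wave `e^{iκ(n v - m u)}` at `z = (u,v)`, for `k = (m,n)`. -/
noncomputable def planeWave (κ : ℝ) (k : ℤ × ℤ) (z : ℝ × ℝ) : ℂ :=
  Complex.exp (Complex.I * (κ * (k.2 * z.2 - k.1 * z.1) : ℝ))

/-- Smooth functions on the torus `ℝ²/(Lℤ)²`, seen as functions on the plane. -/
structure IsSmoothPeriodic (L : ℝ) (φ : ℝ × ℝ → ℂ) : Prop where
  contDiff : ContDiff ℝ ∞ φ
  add_left : ∀ u v, φ (u + L, v) = φ (u, v)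
  add_right : ∀ u v, φ (u, v + L) = φ (u, v)

theorem norm_exp_I_mul_ofReal (x : ℝ) : ‖Complex.exp (Complex.I * x)‖ = 1 := by
  rw [mul_comm, Complex.norm_exp_ofReal_mul_I]

theorem norm_planeWave (κ : ℝ) (k : ℤ × ℤ) (z : ℝ × ℝ) : ‖planeWave κ k z‖ = 1 :=
  norm_exp_I_mul_ofReal _

theorem exp_I_mul_eq_of_int {x y : ℝ} (n : ℤ) (h : x = y + n * (2 * Real.pi)) :
    Complex.exp (Complex.I * x) = Complex.exp (Complex.I * y) := by
  rw [h, Complex.exp_eq_exp_iff_exists_int]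
  exact ⟨n, by push_cast; ring⟩

theorem isSmoothPeriodic_planeWave {κ L : ℝ} (h : κ * L = 2 * Real.pi) (k : ℤ × ℤ) :
    IsSmoothPeriodic L (planeWave κ k) where
  contDiff := by
    unfold planeWave
    have : ContDiff ℝ ∞ fun z : ℝ × ℝ => κ * (k.2 * z.2 - k.1 * z.1) := by fun_prop
    exact (contDiff_const.mul (Complex.ofRealCLM.contDiff.comp this)).cexp
  add_left u v := exp_I_mul_eq_of_int (-k.1) (by push_cast; linear_combination (-k.1 : ℝ) * h)
  add_right u v := exp_I_mul_eq_of_int k.2 (by linear_combination (k.2 : ℝ) * h)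

theorem continuous_planeWave (κ : ℝ) (k : ℤ × ℤ) : Continuous (planeWave κ k) := by
  unfold planeWave
  fun_prop

namespace IsSmoothPeriodic

variable {L : ℝ} {φ χ : ℝ × ℝ → ℂ}

theorem mul (hφ : IsSmoothPeriodic L φ) (hχ : IsSmoothPeriodic L χ) :
    IsSmoothPeriodic L fun z => φ z * χ z :=
  ⟨hφ.contDiff.mul hχ.contDiff, fun u v => by rw [hφ.add_left, hχ.add_left],
    fun u v => by rw [hφ.add_right, hχ.add_right]⟩

theorem sub (hφ : IsSmoothPeriodic L φ) (hχ : IsSmoothPeriodic L χ) :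
    IsSmoothPeriodic L fun z => φ z - χ z :=
  ⟨hφ.contDiff.sub hχ.contDiff, fun u v => by rw [hφ.add_left, hχ.add_left],
    fun u v => by rw [hφ.add_right, hχ.add_right]⟩

theorem fderiv_apply (hφ : IsSmoothPeriodic L φ) (w : ℝ × ℝ) :
    IsSmoothPeriodic L fun z => fderiv ℝ φ z w where
  contDiff := (hφ.contDiff.fderiv_right (m := ∞) (by simp)).clm_apply contDiff_const
  add_left u v := by
    have h := fderiv_comp_add_right (𝕜 := ℝ) (f := φ) (x := (u, v)) (L, 0)
    have e : (fun z : ℝ × ℝ => φ (z + (L, 0))) = φ := by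
      ext ⟨x, y⟩
      simpa using hφ.add_left x y
    rw [e] at h
    rw [h]
    simp
  add_right u v := by
    have h := fderiv_comp_add_right (𝕜 := ℝ) (f := φ) (x := (u, v)) (0, L)
    have e : (fun z : ℝ × ℝ => φ (z + (0, L))) = φ := by
      ext ⟨x, y⟩
      simpa using hφ.add_right x y
    rw [e] at h
    rw [h]
    simp

end IsSmoothPeriodic

theorem measurableSet_torusCell (L : ℝ) : MeasurableSet (torusCell L) :=
  measurableSet_Ico.prod measurableSet_Ico

theorem Continuous.integrableOn_torusCell {φ : ℝ × ℝ → ℂ} (h : Continuous φ) (L : ℝ) :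
    IntegrableOn φ (torusCell L) :=
  (h.continuousOn.integrableOn_compact (isCompact_Icc.prod isCompact_Icc)).mono_set
    (Set.prod_mono Ico_subset_Icc_self Ico_subset_Icc_self)

theorem setIntegral_torusCell {L : ℝ} {φ : ℝ × ℝ → ℂ} (h : IntegrableOn φ (torusCell L)) :
    ∫ z in torusCell L, φ z = ∫ u in Ico 0 L, ∫ v in Ico 0 L, φ (u, v) := by
  rw [torusCell, Measure.volume_eq_prod] at *
  exact setIntegral_prod _ h

theorem setIntegral_torusCell_swap {L : ℝ} {φ : ℝ × ℝ → ℂ} (h : IntegrableOn φ (torusCell L)) :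
    ∫ z in torusCell L, φ z = ∫ v in Ico 0 L, ∫ u in Ico 0 L, φ (u, v) := by
  rw [torusCell, Measure.volume_eq_prod] at *
  rw [← setIntegral_prod_swap]
  exact setIntegral_prod _ h.swap

theorem setIntegral_Ico_deriv_eq_zero {L : ℝ} (hL : 0 ≤ L) {f f' : ℝ → ℂ}
    (h : ∀ x, HasDerivAt f (f' x) x) (hc : Continuous f') (hp : f L = f 0) :
    ∫ x in Ico 0 L, f' x = 0 := by
  rw [integral_Ico_eq_integral_Ioc, ← intervalIntegral.integral_of_le hL,
    intervalIntegral.integral_eq_sub_of_hasDerivAt (fun x _ => h x) (hc.intervalIntegrable _ _),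
    hp, sub_self]

namespace IsSmoothPeriodic

variable {L κ : ℝ} {φ : ℝ × ℝ → ℂ}

theorem continuous (hφ : IsSmoothPeriodic L φ) : Continuous φ := hφ.contDiff.continuous

theorem hasFDerivAt (hφ : IsSmoothPeriodic L φ) (z : ℝ × ℝ) : HasFDerivAt φ (fderiv ℝ φ z) z :=
  (hφ.contDiff.differentiable (by simp) z).hasFDerivAt

theorem integral_fderiv_left (hφ : IsSmoothPeriodic L φ) (hL : 0 ≤ L) :
    ∫ z in torusCell L, fderiv ℝ φ z (1, 0) = 0 := by
  rw [setIntegral_torusCell_swap ((hφ.fderiv_apply _).continuous.integrableOn_torusCell L)]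
  refine integral_eq_zero_of_ae (Eventually.of_forall fun v => ?_)
  refine setIntegral_Ico_deriv_eq_zero hL (f := fun u => φ (u, v)) (fun u => ?_) ?_ ?_
  · exact (hφ.hasFDerivAt (u, v)).comp_hasDerivAt u ((hasDerivAt_id u).prodMk (hasDerivAt_const u v))
  · exact (hφ.fderiv_apply _).continuous.comp (by fun_prop)
  · simpa using hφ.add_left 0 v

theorem integral_fderiv_right (hφ : IsSmoothPeriodic L φ) (hL : 0 ≤ L) :
    ∫ z in torusCell L, fderiv ℝ φ z (0, 1) = 0 := by
  rw [setIntegral_torusCell ((hφ.fderiv_apply _).continuous.integrableOn_torusCell L)]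
  refine integral_eq_zero_of_ae (Eventually.of_forall fun u => ?_)
  refine setIntegral_Ico_deriv_eq_zero hL (f := fun v => φ (u, v)) (fun v => ?_) ?_ ?_
  · exact (hφ.hasFDerivAt (u, v)).comp_hasDerivAt v ((hasDerivAt_const v u).prodMk (hasDerivAt_id v))
  · exact (hφ.fderiv_apply _).continuous.comp (by fun_prop)
  · simpa using hφ.add_right u 0

end IsSmoothPeriodic

theorem fderiv_planeWave (κ : ℝ) (k : ℤ × ℤ) (z w : ℝ × ℝ) :
    fderiv ℝ (planeWave κ k) z w =
      Complex.I * (κ * (k.2 * w.2 - k.1 * w.1) : ℝ) * planeWave κ k z := by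
  have h1 : HasFDerivAt (fun z : ℝ × ℝ => κ * (k.2 * z.2 - k.1 * z.1))
      (κ • ((k.2 : ℝ) • ContinuousLinearMap.snd ℝ ℝ ℝ - (k.1 : ℝ) • ContinuousLinearMap.fst ℝ ℝ ℝ))
      z := by
    refine HasFDerivAt.const_mul (HasFDerivAt.sub ?_ ?_) κ
    · exact hasFDerivAt_snd.const_mul _
    · exact hasFDerivAt_fst.const_mul _
  have h2 := ((Complex.ofRealCLM.hasFDerivAt.comp z h1).const_mul Complex.I).cexp
  have h3 : HasFDerivAt (planeWave κ k) _ z := h2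
  rw [h3.fderiv]
  simp [planeWave]
  ring

theorem summable_inv_one_add_sq {κ : ℝ} (hκ : κ ≠ 0) :
    Summable fun n : ℤ => (1 + (κ * n) ^ 2)⁻¹ := by
  have h1 : Summable fun n : ℤ => (κ ^ 2)⁻¹ * (1 / (n : ℝ) ^ 2) :=
    (Real.summable_one_div_int_pow.mpr one_lt_two).mul_left _
  refine Summable.of_norm_bounded_eventually h1 ?_
  filter_upwards [eventually_cofinite_ne (0 : ℤ)] with n hn
  have hn' : (n : ℝ) ≠ 0 := Int.cast_ne_zero.mpr hn
  have hpos : 0 < (κ * n) ^ 2 := by positivity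
  rw [Real.norm_of_nonneg (by positivity), one_div, ← mul_inv, ← mul_pow]
  exact inv_anti₀ hpos (by linarith)

/-- The Fourier coefficients of a function on the torus, without normalisation. -/
noncomputable def torusCoeff (L κ : ℝ) (φ : ℝ × ℝ → ℂ) (k : ℤ × ℤ) : ℂ :=
  ∫ z in torusCell L, φ z * planeWave κ k z

namespace IsSmoothPeriodic

variable {L κ : ℝ} {φ : ℝ × ℝ → ℂ}

theorem integral_fderiv_mul (hφ : IsSmoothPeriodic L φ) (h : κ * L = 2 * Real.pi) (k : ℤ × ℤ)
    (w : ℝ × ℝ) (h0 : ∀ χ, IsSmoothPeriodic L χ → ∫ z in torusCell L, fderiv ℝ χ z w = 0) :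
    torusCoeff L κ (fun z => fderiv ℝ φ z w) k =
      -(Complex.I * (κ * (k.2 * w.2 - k.1 * w.1) : ℝ)) * torusCoeff L κ φ k := by
  have hE := isSmoothPeriodic_planeWave h k
  have h1 := h0 _ (hφ.mul hE)
  have h2 : ∀ z, fderiv ℝ (fun z => φ z * planeWave κ k z) z w =
      fderiv ℝ φ z w * planeWave κ k z +
        (Complex.I * (κ * (k.2 * w.2 - k.1 * w.1) : ℝ)) * (φ z * planeWave κ k z) := fun z => by
    have := ((hφ.hasFDerivAt z).mul (hE.hasFDerivAt z)).fderiv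
    rw [show (fun z => φ z * planeWave κ k z) = φ * planeWave κ k from rfl, this]
    simp only [_root_.add_apply, _root_.smul_apply, fderiv_planeWave, smul_eq_mul]
    ring
  simp only [h2] at h1
  rw [integral_add, integral_const_mul] at h1
  · rw [torusCoeff, torusCoeff]
    linear_combination h1
  · exact ((hφ.fderiv_apply w).mul hE).continuous.integrableOn_torusCell L
  · exact ((hφ.mul hE).continuous.integrableOn_torusCell L).const_mul _

/-- The operator `1 - ∂_w²` on smooth periodic functions multiplies the Fourier coefficients by
a positive quadratic polynomial. -/
theorem torusCoeff_sub_fderiv_fderiv (hφ : IsSmoothPeriodic L φ) (h : κ * L = 2 * Real.pi)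
    (k : ℤ × ℤ) (w : ℝ × ℝ)
    (h0 : ∀ χ, IsSmoothPeriodic L χ → ∫ z in torusCell L, fderiv ℝ χ z w = 0) :
    torusCoeff L κ (fun z => φ z - fderiv ℝ (fun z => fderiv ℝ φ z w) z w) k =
      (1 + (κ * (k.2 * w.2 - k.1 * w.1)) ^ 2 : ℝ) * torusCoeff L κ φ k := by
  have hE := isSmoothPeriodic_planeWave h k
  have h1 : torusCoeff L κ (fun z => φ z - fderiv ℝ (fun z => fderiv ℝ φ z w) z w) k =
      torusCoeff L κ φ k - torusCoeff L κ (fun z => fderiv ℝ (fun z => fderiv ℝ φ z w) z w) k := by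
    simp only [torusCoeff, sub_mul]
    exact integral_sub ((hφ.mul hE).continuous.integrableOn_torusCell L)
      ((((hφ.fderiv_apply w).fderiv_apply w).mul hE).continuous.integrableOn_torusCell L)
  rw [h1, (hφ.fderiv_apply w).integral_fderiv_mul h k w h0, hφ.integral_fderiv_mul h k w h0]
  push_cast
  linear_combination -(κ * (k.2 * w.2 - k.1 * w.1)) ^ 2 * torusCoeff L κ φ k * Complex.I_sq

/-- The Fourier coefficients of a smooth function decay like `(1 + m²)⁻¹ (1 + n²)⁻¹`, since those of
`(1 - ∂_u²)(1 - ∂_v²)φ` are bounded. -/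
theorem summable_torusCoeff (hφ : IsSmoothPeriodic L φ) (hL : 0 < L) (h : κ * L = 2 * Real.pi) :
    Summable fun k => ‖torusCoeff L κ φ k‖ := by
  have hκ : κ ≠ 0 := by
    rintro rfl
    have := Real.pi_pos
    linarith
  have h1 := hφ.sub ((hφ.fderiv_apply (1, 0)).fderiv_apply (1, 0))
  -- `χ = (1 - ∂_v²)(1 - ∂_u²)φ`
  obtain ⟨χ, h3⟩ : ∃ χ, ∀ k, torusCoeff L κ χ k =
      ((1 + (κ * k.2) ^ 2) * (1 + (κ * k.1) ^ 2) : ℝ) * torusCoeff L κ φ k := ⟨_, fun k => by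
    rw [h1.torusCoeff_sub_fderiv_fderiv h k (0, 1) fun χ hχ => hχ.integral_fderiv_right hL.le,
      hφ.torusCoeff_sub_fderiv_fderiv h k _ fun χ hχ => hχ.integral_fderiv_left hL.le]
    push_cast
    ring⟩
  have h4 : Summable fun k : ℤ × ℤ => (1 + (κ * k.1) ^ 2)⁻¹ * (1 + (κ * k.2) ^ 2)⁻¹ :=
    (summable_inv_one_add_sq hκ).mul_of_nonneg (summable_inv_one_add_sq hκ)
      (fun _ => by positivity) (fun _ => by positivity)
  refine Summable.of_nonneg_of_le (fun _ => norm_nonneg _) (fun k => ?_)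
    (h4.mul_left (∫ z in torusCell L, ‖χ z‖))
  have h5 : ‖torusCoeff L κ χ k‖ ≤ ∫ z in torusCell L, ‖χ z‖ := by
    refine (norm_integral_le_integral_norm _).trans_eq ?_
    simp only [norm_mul, norm_planeWave, mul_one]
  rw [h3, norm_mul, Complex.norm_real, Real.norm_of_nonneg (by positivity)] at h5
  rw [← mul_inv, ← div_eq_mul_inv, le_div_iff₀ (by positivity)]
  linarith

end IsSmoothPeriodic

/-- Pointwise Fourier inversion for continuous periodic functions of one variable with summable
Fourier coefficients. -/
theorem hasSum_fourier_of_periodic {L κ : ℝ} (hL : 0 < L) (h : κ * L = 2 * Real.pi) {f : ℝ → ℂ}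
    (hf : Continuous f) (hp : ∀ x, f (x + L) = f x)
    (hs : Summable fun n : ℤ => ∫ x in Ico 0 L, f x * Complex.exp (Complex.I * (-(κ * n * x) : ℝ)))
    (y : ℝ) :
    HasSum (fun n : ℤ => (L : ℂ)⁻¹ *
      (∫ x in Ico 0 L, f x * Complex.exp (Complex.I * (-(κ * n * x) : ℝ))) *
        Complex.exp (Complex.I * (κ * n * y : ℝ))) (f y) := by
  have : Fact (0 < L) := ⟨hL⟩
  have hp' : Function.Periodic f L := hp
  let F : C(AddCircle L, ℂ) := ⟨hp'.lift, continuous_coinduced_dom.mpr hf⟩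
  have hFx : ∀ x : ℝ, F x = f x := fun x => hp'.lift_coe x
  have hexp : ∀ (n : ℤ) (x : ℝ), (fourier n (x : AddCircle L) : ℂ) =
      Complex.exp (Complex.I * (κ * n * x : ℝ)) := fun n x => by
    rw [fourier_coe_apply]
    congr 1
    have hκ : κ = 2 * Real.pi / L := by field_simp; linarith
    have hL' : (L : ℂ) ≠ 0 := Complex.ofReal_ne_zero.mpr hL.ne'
    rw [hκ]
    push_cast
    field_simp
  have hc : ∀ n : ℤ, fourierCoeff F n =
      (L : ℂ)⁻¹ * ∫ x in Ico 0 L, f x * Complex.exp (Complex.I * (-(κ * n * x) : ℝ)) := fun n => by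
    rw [fourierCoeff_eq_intervalIntegral _ _ 0, zero_add, intervalIntegral.integral_of_le hL.le,
      ← integral_Ico_eq_integral_Ioc, Complex.real_smul]
    congr 1
    · push_cast; rw [one_div]
    · refine integral_congr_ae (Eventually.of_forall fun x => ?_)
      simp only
      rw [hexp, hFx, smul_eq_mul, mul_comm]
      congr 3
      push_cast
      ring
  have := has_pointwise_sum_fourier_series_of_summable (f := F)
    ((hs.mul_left _).congr fun n => (hc n).symm) y
  refine this.congr_eq (fun n => ?_) (hFx y)
  rw [hc, hexp, smul_eq_mul]

namespace IsSmoothPeriodic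

variable {L κ : ℝ} {φ : ℝ × ℝ → ℂ}

/-- Fourier inversion on the torus, one variable at a time. -/
theorem hasSum_torusCoeff_mul (hφ : IsSmoothPeriodic L φ) (hL : 0 < L)
    (h : κ * L = 2 * Real.pi) (z : ℝ × ℝ) :
    HasSum (fun k => ((L : ℂ) ^ 2)⁻¹ * torusCoeff L κ φ k * planeWave κ (-k) z) (φ z) := by
  obtain ⟨u, v⟩ := z
  have hsum : Summable (torusCoeff L κ φ) := (hφ.summable_torusCoeff hL h).of_norm
  have hE : ∀ k : ℤ × ℤ, planeWave κ (-k) (u, v) =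
      Complex.exp (Complex.I * (κ * k.1 * u : ℝ)) *
        Complex.exp (Complex.I * (κ * (-k.2 : ℤ) * v : ℝ)) := fun k => by
    rw [planeWave, ← Complex.exp_add]
    congr 1
    push_cast
    simp
    ring
  set a : ℤ → ℝ → ℂ := fun m y =>
    ∫ x in Ico 0 L, φ (x, y) * Complex.exp (Complex.I * (-(κ * m * x) : ℝ)) with ha
  have hac : ∀ m, Continuous (a m) := fun m => by
    have : a m = fun y => ∫ x in (0 : ℝ)..L,
        φ (x, y) * Complex.exp (Complex.I * (-(κ * m * x) : ℝ)) := by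
      ext y
      rw [intervalIntegral.integral_of_le hL.le, ← integral_Ico_eq_integral_Ioc]
    rw [this]
    have := hφ.continuous
    refine intervalIntegral.continuous_parametric_intervalIntegral_of_continuous' ?_ 0 L
    simp only [Function.uncurry_def]
    fun_prop
  have hap : ∀ m y, a m (y + L) = a m y := fun m y => by
    simp only [ha, hφ.add_right]
  have hcoef : ∀ m n : ℤ, ∫ y in Ico 0 L, a m y * Complex.exp (Complex.I * (-(κ * n * y) : ℝ)) =
      torusCoeff L κ φ (m, -n) := fun m n => by
    rw [torusCoeff, setIntegral_torusCell_swap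
      ((hφ.mul (isSmoothPeriodic_planeWave h _)).continuous.integrableOn_torusCell L)]
    refine integral_congr_ae (Eventually.of_forall fun y => ?_)
    simp only [ha]
    rw [← integral_mul_const]
    refine integral_congr_ae (Eventually.of_forall fun x => ?_)
    simp only [planeWave]
    rw [mul_assoc, ← Complex.exp_add]
    congr 2
    push_cast
    ring
  have hneg : ∀ m : ℤ, Summable fun n : ℤ => torusCoeff L κ φ (m, -n) := fun m =>
    (Equiv.neg ℤ).summable_iff.mpr (hsum.comp_injective (Prod.mk_right_injective m))
  have ha1 : ∀ (m : ℤ) (y : ℝ), HasSum (fun n : ℤ => (L : ℂ)⁻¹ * torusCoeff L κ φ (m, -n) *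
      Complex.exp (Complex.I * (κ * n * y : ℝ))) (a m y) := fun m y => by
    have := hasSum_fourier_of_periodic hL h (hac m) (hap m)
      ((hneg m).congr fun n => (hcoef m n).symm) y
    simpa only [hcoef] using this
  have ha2 : Summable fun m => a m v := by
    have hs := ((summable_prod_of_nonneg (fun _ => norm_nonneg _)).mp
      (hφ.summable_torusCoeff hL h)).2
    refine Summable.of_norm_bounded (hs.mul_left ‖(L : ℂ)⁻¹‖) fun m => ?_
    rw [← (ha1 m v).tsum_eq]
    have hs1 : HasSum (fun n : ℤ => ‖torusCoeff L κ φ (m, -n)‖)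
        (∑' n, ‖torusCoeff L κ φ (m, n)‖) :=
      (Equiv.neg ℤ).hasSum_iff.mpr
        (((hφ.summable_torusCoeff hL h).comp_injective (Prod.mk_right_injective m)).hasSum)
    refine tsum_of_norm_bounded (hs1.mul_left _) fun n => ?_
    rw [norm_mul, norm_mul, norm_exp_I_mul_ofReal, mul_one]
  have h1 := hasSum_fourier_of_periodic hL h (f := fun x => φ (x, v))
    (hφ.continuous.comp (by fun_prop)) (fun x => hφ.add_left x v) ha2 u
  have h2 : Summable fun k => ((L : ℂ) ^ 2)⁻¹ * torusCoeff L κ φ k * planeWave κ (-k) (u, v) := by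
    refine Summable.of_norm_bounded ((hφ.summable_torusCoeff hL h).mul_left ‖((L : ℂ) ^ 2)⁻¹‖)
      fun k => ?_
    rw [norm_mul, norm_mul, norm_planeWave, mul_one]
  have h3 := h2.hasSum.prod_fiberwise (g := fun m => (L : ℂ)⁻¹ * a m v *
      Complex.exp (Complex.I * (κ * m * u : ℝ))) fun m => by
    have := ((Equiv.neg ℤ).hasSum_iff.mpr (ha1 m v)).mul_left
      ((L : ℂ)⁻¹ * Complex.exp (Complex.I * (κ * m * u : ℝ)))
    refine this.congr_eq (fun n => ?_) (by ring)
    rw [hE]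
    simp only [Function.comp_apply, Equiv.neg_apply, neg_neg]
    ring
  rw [← h3.unique h1]
  exact h2.hasSum

/-- If the Fourier coefficients of an integrable function `W` on the torus are those of the
series `∑ c_k e_k`, then this series converges to `W` in the sense of distributions. -/
theorem hasSum_integral_mul (hφ : IsSmoothPeriodic L φ) (hL : 0 < L)
    (h : κ * L = 2 * Real.pi) {W : ℝ × ℝ → ℂ} (hW : IntegrableOn W (torusCell L))
    {c : ℤ × ℤ → ℂ} (hc : ∀ k, torusCoeff L κ W (-k) = (L : ℂ) ^ 2 * c k) :
    HasSum (fun k => ∫ z in torusCell L, φ z * (c k * planeWave κ k z))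
      (∫ z in torusCell L, φ z * W z) := by
  have hL' : (L : ℂ) ≠ 0 := Complex.ofReal_ne_zero.mpr hL.ne'
  have hint : ∀ k : ℤ × ℤ, IntegrableOn (fun z => planeWave κ k z * W z) (torusCell L) :=
    fun k => hW.bdd_mul (c := 1) (continuous_planeWave κ k).aestronglyMeasurable
      (Eventually.of_forall fun z => (norm_planeWave κ k z).le)
  have h1 := hasSum_integral_of_summable_integral_norm (μ := volume.restrict (torusCell L))
    (F := fun k z => ((L : ℂ) ^ 2)⁻¹ * torusCoeff L κ φ k * (planeWave κ (-k) z * W z))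
    (fun k => (hint (-k)).const_mul _) (by
      simp only [norm_mul, norm_planeWave, one_mul, integral_const_mul]
      exact ((hφ.summable_torusCoeff hL h).mul_left _).mul_right _)
  refine h1.congr_eq (fun k => ?_) ?_
  · rw [integral_const_mul]
    have e1 : ∫ z in torusCell L, planeWave κ (-k) z * W z = torusCoeff L κ W (-k) := by
      simp only [torusCoeff, mul_comm]
    have e2 : ∫ z in torusCell L, φ z * (c k * planeWave κ k z) = c k * torusCoeff L κ φ k := by
      rw [torusCoeff, ← integral_const_mul]
      simp only [mul_left_comm]
    rw [e1, e2, hc]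
    field_simp
  · refine integral_congr_ae (Eventually.of_forall fun z => ?_)
    simpa only [mul_assoc] using ((hφ.hasSum_torusCoeff_mul hL h z).mul_right (W z)).tsum_eq

end IsSmoothPeriodic

theorem continuous_tsum_planeWave {κ : ℝ} {c : ℤ × ℤ → ℂ} (hc : Summable fun k => ‖c k‖) :
    Continuous fun z => ∑' k, c k * planeWave κ k z :=
  continuous_tsum (fun k => continuous_const.mul (continuous_planeWave κ k)) hc fun k z => by
    rw [norm_mul, norm_planeWave, mul_one]

theorem hasSum_integral_mul_tsum_planeWave {L κ : ℝ} {c : ℤ × ℤ → ℂ}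
    (hc : Summable fun k => ‖c k‖) {φ : ℝ × ℝ → ℂ} (hφ : Continuous φ) :
    HasSum (fun k => ∫ z in torusCell L, φ z * (c k * planeWave κ k z))
      (∫ z in torusCell L, φ z * ∑' k, c k * planeWave κ k z) := by
  have h1 := hasSum_integral_of_summable_integral_norm (μ := volume.restrict (torusCell L))
    (F := fun k z => φ z * (c k * planeWave κ k z))
    (fun k => (hφ.mul (continuous_const.mul (continuous_planeWave κ k))).integrableOn_torusCell L)
    (by
      simp only [norm_mul, norm_planeWave, mul_one, integral_mul_const]
      exact hc.mul_left _)
  simpa only [tsum_mul_left] using h1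

/-- The periodic extension of a smooth function supported inside the fundamental cell. -/
theorem exists_isSmoothPeriodic_extension {L : ℝ} (hL : 0 < L) {g : ℝ × ℝ → ℂ}
    (hg : ContDiff ℝ ∞ g) (hc : HasCompactSupport g) (hs : tsupport g ⊆ Ioo 0 L ×ˢ Ioo 0 L) :
    ∃ φ, IsSmoothPeriodic L φ ∧ ∀ z ∈ torusCell L, φ z = g z := by
  let r : ℝ → ℝ := toIcoMod hL 0
  have hr : ∀ x, ∃ n : ℤ, r x = x - n * L := fun x =>
    ⟨toIcoDiv hL 0 x, by rw [← zsmul_eq_mul]; rfl⟩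
  have hrI : ∀ x, r x ∈ Ico 0 L := fun x => by simpa using toIcoMod_mem_Ico hL 0 x
  have hr_eq : ∀ {x : ℝ} (n : ℤ), x - n * L ∈ Ico 0 L → r x = x - n * L := fun {x} n hx => by
    rw [← zsmul_eq_mul] at *
    refine (toIcoMod_eq_iff hL).mpr ⟨by simpa using hx, n, by simp⟩
  refine ⟨fun z => g (r z.1, r z.2), ⟨?_, ?_, ?_⟩, ?_⟩
  · let π : ℝ × ℝ → AddCircle L × AddCircle L := fun z => ((z.1 : AddCircle L), (z.2 : AddCircle L))
    have hπ : Continuous π :=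
      ((AddCircle.continuous_mk' L).comp continuous_fst).prodMk
        ((AddCircle.continuous_mk' L).comp continuous_snd)
    have hT : IsClosed (π ⁻¹' (π '' tsupport g)) :=
      (hc.isCompact.image hπ).isClosed.preimage hπ
    rw [contDiff_iff_contDiffAt]
    intro z
    -- Near a translate of the support the extension is a translate of `g`; elsewhere it vanishes.
    by_cases hz : z ∈ π ⁻¹' (π '' tsupport g)
    · obtain ⟨w, hw, hwz⟩ := hz
      obtain ⟨h1, h2⟩ := Prod.ext_iff.mp hwz
      obtain ⟨m, hm⟩ := (QuotientAddGroup.eq_iff_sub_mem.mp h1)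
      obtain ⟨n, hn⟩ := (QuotientAddGroup.eq_iff_sub_mem.mp h2)
      simp only [zsmul_eq_mul] at hm hn
      have hmem : z + ((m : ℝ) * L, (n : ℝ) * L) ∈ Ioo 0 L ×ˢ Ioo 0 L := by
        have : z + ((m : ℝ) * L, (n : ℝ) * L) = w := by
          ext
          · simp only [Prod.fst_add]; linarith
          · simp only [Prod.snd_add]; linarith
        rw [this]
        exact hs hw
      have hev : ∀ᶠ y in 𝓝 z, y + ((m : ℝ) * L, (n : ℝ) * L) ∈ Ioo 0 L ×ˢ Ioo 0 L :=
        (continuous_add_const ((m : ℝ) * L, (n : ℝ) * L)).continuousAt.eventually_mem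
          ((isOpen_Ioo.prod isOpen_Ioo).mem_nhds hmem)
      have hcd : ContDiffAt ℝ ∞ (fun y => g (y + ((m : ℝ) * L, (n : ℝ) * L))) z :=
        (hg.comp (contDiff_id.add contDiff_const)).contDiffAt
      refine hcd.congr_of_eventuallyEq ?_
      filter_upwards [hev] with y hy
      have e1 := hr_eq (x := y.1) (-m) (by
        have := Ioo_subset_Ico_self hy.1
        simpa using this)
      have e2 := hr_eq (x := y.2) (-n) (by
        have := Ioo_subset_Ico_self hy.2
        simpa using this)
      rw [e1, e2]
      congr 1
      ext <;> simp
    · have hev : ∀ᶠ y in 𝓝 z, y ∉ π ⁻¹' (π '' tsupport g) := hT.isOpen_compl.eventually_mem hz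
      refine (contDiffAt_const (c := (0 : ℂ))).congr_of_eventuallyEq ?_
      filter_upwards [hev] with y hy
      by_contra hne
      refine hy ⟨(r y.1, r y.2), subset_tsupport g hne, ?_⟩
      obtain ⟨m, hm⟩ := hr y.1
      obtain ⟨n, hn⟩ := hr y.2
      refine Prod.ext ?_ ?_
      · refine QuotientAddGroup.eq_iff_sub_mem.mpr ⟨-m, ?_⟩
        simp [hm]
      · refine QuotientAddGroup.eq_iff_sub_mem.mpr ⟨-n, ?_⟩
        simp [hn]
  · intro u v
    simp only [r, toIcoMod_add_right]
  · intro u v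
    simp only [r, toIcoMod_add_right]
  · rintro ⟨u, v⟩ hz
    have e1 := hr_eq (x := u) 0 (by simpa using hz.1)
    have e2 := hr_eq (x := v) 0 (by simpa using hz.2)
    simp only [e1, e2, Int.cast_zero, zero_mul, sub_zero]

/-- An integrable function on the torus that integrates to zero against all smooth functions
vanishes almost everywhere. -/
theorem ae_eq_zero_of_integral_mul_isSmoothPeriodic {L : ℝ} (hL : 0 < L) {V : ℝ × ℝ → ℂ}
    (hV : IntegrableOn V (torusCell L))
    (h : ∀ φ, IsSmoothPeriodic L φ → ∫ z in torusCell L, φ z * V z = 0) :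
    ∀ᵐ z ∂volume.restrict (torusCell L), V z = 0 := by
  have hsub : Ioo 0 L ×ˢ Ioo 0 L ⊆ torusCell L :=
    Set.prod_mono Ioo_subset_Ico_self Ioo_subset_Ico_self
  have hae : (Ioo 0 L ×ˢ Ioo 0 L : Set (ℝ × ℝ)) =ᵐ[volume] torusCell L := by
    rw [Measure.volume_eq_prod]
    exact Measure.set_prod_ae_eq Ioo_ae_eq_Ico Ioo_ae_eq_Ico
  have h1 := (isOpen_Ioo.prod isOpen_Ioo).ae_eq_zero_of_integral_contDiff_smul_eq_zero
    (μ := (volume : Measure (ℝ × ℝ))) (hV.mono_set hsub).locallyIntegrableOn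
    fun g hg hc hs => by
      obtain ⟨φ, hφ, hφg⟩ := exists_isSmoothPeriodic_extension hL (g := fun z => (g z : ℂ))
        (Complex.ofRealCLM.contDiff.comp hg) (hc.comp_left (g := ((↑) : ℝ → ℂ)) rfl)
        ((tsupport_comp_subset (g := ((↑) : ℝ → ℂ)) rfl g).trans hs)
      rw [← h φ hφ, ← setIntegral_eq_integral_of_forall_compl_eq_zero (s := torusCell L)]
      · refine setIntegral_congr_fun (measurableSet_torusCell L) fun z hz => ?_
        simp only [hφg z hz, Complex.real_smul]
      · intro z hz
        rw [image_eq_zero_of_notMem_tsupport fun h => hz (hsub (hs h)), zero_smul]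
  rw [Measure.restrict_congr_set hae.symm, ae_restrict_iff' (measurableSet_Ioo.prod measurableSet_Ioo)]
  exact h1

/-! ### Syndrome amplitudes -/

/-- Division with remainder, `ℤ ≃ ℤ/d × ℤ`. -/
def residueEquiv (d : ℕ) [NeZero d] : ZMod d × ℤ ≃ ℤ where
  toFun x := x.1.val + d * x.2
  invFun p := ((p : ZMod d), p / d)
  left_inv := by
    rintro ⟨j, N⟩
    have hd : (d : ℤ) ≠ 0 := Nat.cast_ne_zero.mpr (NeZero.ne d)
    have hj : ((j.val : ℤ) / d) = 0 :=
      Int.ediv_eq_zero_of_lt (by positivity) (by exact_mod_cast ZMod.val_lt j)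
    ext
    · simp
    · change ((j.val : ℤ) + d * N) / d = N
      rw [Int.add_mul_ediv_left _ _ hd, hj, zero_add]
  right_inv p := by
    simp only [ZMod.val_intCast]
    exact Int.emod_add_mul_ediv p d

theorem residueEquiv_apply (d : ℕ) [NeZero d] (j : ZMod d) (N : ℤ) :
    residueEquiv d (j, N) = j.val + d * N := rfl

theorem exists_residue (d : ℕ) [NeZero d] {j : ZMod d} {p : ℤ} (h : (p : ZMod d) = j) :
    ∃ N : ℤ, (j.val : ℤ) + d * N = p := by
  obtain ⟨⟨j', N⟩, hN⟩ := (residueEquiv d).surjective p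
  rw [residueEquiv_apply] at hN
  refine ⟨N, ?_⟩
  rw [← hN] at h ⊢
  rw [← h]
  simp

/-- The integral over the line, cut into intervals of length `L`. -/
theorem hasSum_setIntegral_Ico_add {L : ℝ} (hL : 0 < L) {f : ℝ → ℂ} (hf : Integrable f) :
    HasSum (fun p : ℤ => ∫ s in Ico 0 L, f (s + p * L)) (∫ y, f y) := by
  have h := hasSum_integral_iUnion (μ := (volume : Measure ℝ)) (f := f)
    (s := fun p : ℤ => Ico (0 + p • L) (0 + (p + 1) • L)) (fun _ => measurableSet_Ico)
    (pairwise_disjoint_Ico_add_zsmul 0 L) hf.integrableOn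
  rw [iUnion_Ico_add_zsmul hL 0, setIntegral_univ] at h
  refine h.congr_eq (fun p => ?_) rfl
  have hmp := measurePreserving_add_right (volume : Measure ℝ) (p * L)
  rw [← hmp.setIntegral_preimage_emb (measurableEmbedding_addRight _)]
  congr 2
  ext s
  simp [add_mul]

/-- The term at position `pℓ` of the series defining the amplitudes `⟨j̄|D(s,t)†|ψ⟩`. -/
noncomputable def zakPiece (d : ℕ) (ψ : ℝ → ℂ) (p : ℤ) (z : ℝ × ℝ) : ℂ :=
  1 / (Real.sqrt (step d) : ℂ) * displacementFun (-z.1) (-z.2) ψ (p * step d)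

theorem zakPiece_eq (d : ℕ) (ψ : ℝ → ℂ) (p : ℤ) (z : ℝ × ℝ) :
    zakPiece d ψ p z = 1 / (Real.sqrt (step d) : ℂ) *
      (Complex.exp (Complex.I * (-(z.2 * (p * step d + z.1 / 2)) : ℝ)) *
        ψ (z.1 + p * step d)) := by
  rw [zakPiece, displacementFun_apply, sub_neg_eq_add, add_comm (z.1)]
  congr 4
  push_cast
  ring

theorem norm_zakPiece (d : ℕ) (ψ : ℝ → ℂ) (p : ℤ) (z : ℝ × ℝ) :
    ‖zakPiece d ψ p z‖ = ‖(1 / (Real.sqrt (step d) : ℂ)) * ψ (z.1 + p * step d)‖ := by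
  rw [zakPiece_eq, norm_mul, norm_mul, norm_exp_I_mul_ofReal, one_mul, norm_mul]

theorem volume_restrict_torusCell (L : ℝ) : (volume : Measure (ℝ × ℝ)).restrict (torusCell L) =
    (volume.restrict (Ico 0 L)).prod (volume.restrict (Ico 0 L)) := by
  rw [torusCell, Measure.prod_restrict, Measure.volume_eq_prod]

theorem memLp_zakPiece (d : ℕ) (ψ : ModeSpace) (p : ℤ) :
    MemLp (zakPiece d ψ p) 2 (volume.restrict (torusCell (step d))) := by
  have h1 : MemLp (fun s : ℝ => ψ (s + p * step d)) 2 (volume.restrict (Ico 0 (step d))) :=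
    ((Lp.memLp ψ).comp_measurePreserving (measurePreserving_add_right volume _)).restrict _
  have h2 := (h1.const_mul (1 / (Real.sqrt (step d) : ℂ))).comp_fst
    (volume.restrict (Ico 0 (step d)))
  rw [← volume_restrict_torusCell] at h2
  refine h2.of_le ?_ (Eventually.of_forall fun z => (norm_zakPiece d ψ p z).le)
  have e : zakPiece d ψ p = fun z => 1 / (Real.sqrt (step d) : ℂ) *
      (Complex.exp (Complex.I * (-(z.2 * (p * step d + z.1 / 2)) : ℝ)) *
        ψ (z.1 + p * step d)) := funext fun z => zakPiece_eq d ψ p z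
  rw [e]
  refine StronglyMeasurable.aestronglyMeasurable ?_
  refine stronglyMeasurable_const.mul (StronglyMeasurable.mul ?_ ?_)
  · exact Continuous.stronglyMeasurable (by fun_prop)
  · exact (Lp.stronglyMeasurable ψ).comp_measurable (by fun_prop)

theorem zakPiece_mul_conj (d : ℕ) [NeZero d] (ψ : ℝ → ℂ) (p q : ℤ) (k : ℤ × ℤ) (z : ℝ × ℝ) :
    zakPiece d ψ p z * conj (zakPiece d ψ q z) * planeWave (step d) (-k) z =
      (Complex.exp (Complex.I * (k.1 * step d * z.1 : ℝ)) *
        (ψ (z.1 + p * step d) * conj (ψ (z.1 + q * step d)))) *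
      ((step d : ℂ)⁻¹ * Complex.exp (Complex.I * ((q - p - k.2) * step d * z.2 : ℝ))) := by
  have hs : (1 / (Real.sqrt (step d) : ℂ)) * (1 / (Real.sqrt (step d) : ℂ)) =
      (step d : ℂ)⁻¹ := by
    rw [one_div, ← mul_inv, ← Complex.ofReal_mul, Real.mul_self_sqrt (step_pos d).le]
  have hconj : ∀ x : ℝ, conj (Complex.exp (Complex.I * x)) = Complex.exp (Complex.I * (-x : ℝ)) :=
    fun x => by
      rw [← Complex.exp_conj, map_mul, Complex.conj_I, Complex.conj_ofReal]
      congr 1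
      push_cast
      ring
  have hexp : Complex.exp (Complex.I * (-(z.2 * (p * step d + z.1 / 2)) : ℝ)) *
      Complex.exp (Complex.I * (-(-(z.2 * (q * step d + z.1 / 2))) : ℝ)) *
        planeWave (step d) (-k) z =
      Complex.exp (Complex.I * (k.1 * step d * z.1 : ℝ)) *
        Complex.exp (Complex.I * ((q - p - k.2) * step d * z.2 : ℝ)) := by
    rw [planeWave, ← Complex.exp_add, ← Complex.exp_add, ← Complex.exp_add]
    congr 1
    push_cast
    simp
    ring
  rw [zakPiece_eq, zakPiece_eq, map_mul, map_mul, hconj, ← hs]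
  simp only [map_div₀, map_one, Complex.conj_ofReal]
  linear_combination (1 / (Real.sqrt (step d) : ℂ)) * (1 / (Real.sqrt (step d) : ℂ)) *
    (ψ (z.1 + p * step d) * conj (ψ (z.1 + q * step d))) * hexp

/-- The part of `∫ e^{imℓy} ψ(y) ψ̄(y + nℓ) dy` coming from the `p`-th interval of length `ℓ`, for
`k = (m,n)`. -/
noncomputable def zakOverlap (d : ℕ) (ψ : ℝ → ℂ) (k : ℤ × ℤ) (p : ℤ) : ℂ :=
  ∫ s in Ico 0 (step d), Complex.exp (Complex.I * (k.1 * step d * s : ℝ)) *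
    (ψ (s + p * step d) * conj (ψ (s + (p + k.2 : ℤ) * step d)))

theorem setIntegral_exp_eq_zero {L : ℝ} (hL : 0 ≤ L) {a : ℝ} (n : ℤ)
    (ha : a * L = n * (2 * Real.pi))
    (h0 : a ≠ 0) : ∫ t in Ico 0 L, Complex.exp (Complex.I * (a * t : ℝ)) = 0 := by
  have ha' : (Complex.I * a) ≠ 0 := mul_ne_zero Complex.I_ne_zero (Complex.ofReal_ne_zero.mpr h0)
  refine setIntegral_Ico_deriv_eq_zero hL
    (f := fun t => Complex.exp (Complex.I * (a * t : ℝ)) / (Complex.I * a)) (fun t => ?_)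
    (by fun_prop) ?_
  · have h1 : HasDerivAt (fun t : ℝ => Complex.I * (a * t : ℝ)) (Complex.I * a) t := by
      have := ((hasDerivAt_id t).const_mul a).ofReal_comp.const_mul Complex.I
      simpa using this
    exact (h1.cexp.div_const (Complex.I * a)).congr_deriv (mul_div_cancel_right₀ _ ha')
  · rw [exp_I_mul_eq_of_int (y := a * 0) n (by rw [ha]; ring)]

/-- Integrating over the momentum `t ∈ [0,ℓ)` leaves only the pairs of positions `p`, `p + n`, for
`k = (m,n)`, among the pairs `p`, `q` with `q ≡ p + n` modulo `d`. -/
theorem integral_zakPiece_mul_conj (d : ℕ) [NeZero d] (ψ : ℝ → ℂ) (p q r : ℤ) (k : ℤ × ℤ)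
    (h : q = p + k.2 + d * r) :
    ∫ z in torusCell (step d),
        zakPiece d ψ p z * conj (zakPiece d ψ q z) * planeWave (step d) (-k) z =
      if r = 0 then zakOverlap d ψ k p else 0 := by
  simp only [zakPiece_mul_conj]
  rw [torusCell, Measure.volume_eq_prod, setIntegral_prod_mul (f := fun s : ℝ =>
    Complex.exp (Complex.I * (k.1 * step d * s : ℝ)) *
        (ψ (s + p * step d) * conj (ψ (s + q * step d)))) (g := fun t : ℝ =>
    (step d : ℂ)⁻¹ * Complex.exp (Complex.I * ((q - p - k.2) * step d * t : ℝ))),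
    integral_const_mul]
  have hpos := step_pos d
  split_ifs with hr
  · have hq : q = p + k.2 := by rw [h, hr]; ring
    have e : ((q : ℝ) - p - k.2) = 0 := by rw [hq]; push_cast; ring
    have hs : (step d : ℂ) ≠ 0 := Complex.ofReal_ne_zero.mpr hpos.ne'
    simp only [e, zero_mul, Complex.ofReal_zero, mul_zero, Complex.exp_zero]
    rw [setIntegral_const, measureReal_def, Real.volume_Ico, sub_zero,
      ENNReal.toReal_ofReal hpos.le, Complex.real_smul, mul_one, inv_mul_cancel₀ hs, mul_one, hq,
      zakOverlap]
  · have e : ((q : ℝ) - p - k.2) = d * r := by rw [h]; push_cast; ring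
    have hd : (d : ℝ) ≠ 0 := Nat.cast_ne_zero.mpr (NeZero.ne d)
    rw [e, setIntegral_exp_eq_zero hpos.le r, mul_zero, mul_zero]
    · linear_combination (r : ℝ) * nat_mul_step_mul_step d
    · have hr' : (r : ℝ) ≠ 0 := Int.cast_ne_zero.mpr hr
      have := hpos.ne'
      positivity

theorem hasSum_toLp_iff {α ι : Type*} [MeasurableSpace α] {μ : Measure α} {f : ι → α → ℂ}
    {F : α → ℂ} (hf : ∀ i, MemLp (f i) 2 μ) (hF : MemLp F 2 μ) :
    HasSum (fun i => (hf i).toLp (f i)) (hF.toLp F) ↔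
      Tendsto (fun S : Finset ι => eLpNorm (fun x => ∑ i ∈ S, f i x - F x) 2 μ) atTop (𝓝 0) := by
  rw [HasSum, SummationFilter.unconditional_filter, Lp.tendsto_Lp_iff_tendsto_eLpNorm]
  refine tendsto_congr fun S => eLpNorm_congr_ae ?_
  have h1 : ∀ᵐ x ∂μ, ∀ i ∈ S, (hf i).toLp (f i) x = f i x :=
    (ae_ball_iff S.countable_toSet).mpr fun i _ => (hf i).coeFn_toLp
  filter_upwards [h1, Lp.coeFn_fun_finsetSum S fun i => (hf i).toLp (f i)] with x e1 e2
  rw [Pi.sub_apply, e2, Finset.sum_congr rfl e1]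

theorem inner_toLp {α : Type*} [MeasurableSpace α] {μ : Measure α} {f g : α → ℂ}
    (hf : MemLp f 2 μ) (hg : MemLp g 2 μ) :
    ⟪hf.toLp f, hg.toLp g⟫_ℂ = ∫ x, g x * conj (f x) ∂μ := by
  rw [L2.inner_def]
  refine integral_congr_ae ?_
  filter_upwards [hf.coeFn_toLp, hg.coeFn_toLp] with x e1 e2
  rw [e1, e2, RCLike.inner_apply]

theorem isSyndromeAmplitude_iff (d : ℕ) (ψ : ModeSpace) (Φ : ℝ × ℝ → ZMod d → ℂ) :
    IsSyndromeAmplitude d ψ Φ ↔ ∀ j : ZMod d,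
      MemLp (fun z => Φ z j) 2 (volume.restrict (torusCell (step d))) ∧
      Tendsto (fun S : Finset ℤ => eLpNorm (fun z : ℝ × ℝ =>
        ∑ N ∈ S, zakPiece d ψ (j.val + d * N) z - Φ z j) 2
          (volume.restrict (torusCell (step d)))) atTop (𝓝 0) := by
  refine forall_congr' fun j => and_congr_right fun _ => tendsto_congr fun S => ?_
  congr 1
  ext z
  rw [Finset.mul_sum]
  congr 1
  refine Finset.sum_congr rfl fun N _ => ?_
  rw [zakPiece]
  congr 2
  push_cast
  ring

theorem MemLp.mul_planeWave {μ : Measure (ℝ × ℝ)} {f : ℝ × ℝ → ℂ} (hf : MemLp f 2 μ) (κ : ℝ)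
    (k : ℤ × ℤ) : MemLp (fun z => f z * planeWave κ k z) 2 μ :=
  hf.of_le (hf.1.mul (continuous_planeWave κ k).aestronglyMeasurable)
    (Eventually.of_forall fun z => by rw [norm_mul, norm_planeWave, mul_one])

/-- Pieces at different positions in the same residue class are orthogonal, because the waves
`e^{itdℓN}` are orthogonal on `[0,ℓ)`; hence the correlations of the amplitudes are sums of
diagonal terms. -/
theorem IsSyndromeAmplitude.hasSum_zakOverlap {d : ℕ} [NeZero d] {ψ : ModeSpace}
    {Φ : ℝ × ℝ → ZMod d → ℂ} (hΦ : IsSyndromeAmplitude d ψ Φ) (j : ZMod d) (k : ℤ × ℤ) :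
    HasSum (fun N : ℤ => zakOverlap d ψ k (j.val + d * N))
      (∫ z in torusCell (step d),
        Φ z j * conj (Φ z (j + k.2)) * planeWave (step d) (-k) z) := by
  rw [isSyndromeAmplitude_iff] at hΦ
  set μ := (volume : Measure (ℝ × ℝ)).restrict (torusCell (step d))
  set E := planeWave (step d) (-k) with hE
  have hG : ∀ p, MemLp (zakPiece d ψ p) 2 μ := memLp_zakPiece d ψ
  have hGE : ∀ p, MemLp (fun z => zakPiece d ψ p z * E z) 2 μ := fun p =>
    MemLp.mul_planeWave (hG p) _ _
  have hΦE : MemLp (fun z => Φ z j * E z) 2 μ := MemLp.mul_planeWave (hΦ j).1 _ _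
  have h1 : HasSum (fun N : ℤ => (hGE (j.val + d * N)).toLp _) (hΦE.toLp _) := by
    refine (hasSum_toLp_iff (fun N : ℤ => hGE (j.val + d * N)) hΦE).mpr ?_
    refine (hΦ j).2.congr fun S => eLpNorm_congr_norm_ae (Eventually.of_forall fun z => ?_)
    rw [← Finset.sum_mul, ← sub_mul, norm_mul, hE, norm_planeWave, mul_one]
  have h2 : HasSum (fun N : ℤ => (hG ((j + k.2 : ZMod d).val + d * N)).toLp _)
      ((hΦ (j + k.2)).1.toLp _) :=
    (hasSum_toLp_iff (fun N : ℤ => hG ((j + k.2 : ZMod d).val + d * N)) _).mpr (hΦ (j + k.2)).2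
  have h3 : ∀ N : ℤ, ⟪(hΦ (j + k.2)).1.toLp _, (hGE (j.val + d * N)).toLp _⟫_ℂ =
      zakOverlap d ψ k (j.val + d * N) := fun N => by
    obtain ⟨N₀, hN₀⟩ := exists_residue d (j := j + k.2) (p := j.val + d * N + k.2) (by simp)
    have h4 := h2.mapL (innerSL ℂ ((hGE (j.val + d * N)).toLp _))
    have h5 := Complex.hasSum_conj'.mpr h4
    simp only [innerSL_apply_apply, inner_conj_symm] at h5
    refine h5.unique ((hasSum_ite_eq N₀ (zakOverlap d ψ k (j.val + d * N))).congr_eq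
      (fun N' => ?_) rfl)
    rw [inner_toLp]
    have h6 := integral_zakPiece_mul_conj d ψ (j.val + d * N) ((j + k.2 : ZMod d).val + d * N')
      (N' - N₀) k (by linear_combination hN₀)
    simp only [sub_eq_zero] at h6
    rw [← h6]
    refine integral_congr_ae (Eventually.of_forall fun z => ?_)
    simp only [hE]
    ring
  have h7 := h1.mapL (innerSL ℂ ((hΦ (j + k.2)).1.toLp _))
  refine h7.congr_eq (fun N => ?_) ?_
  · rw [innerSL_apply_apply, h3]
  · rw [innerSL_apply_apply, inner_toLp]
    refine integral_congr_ae (Eventually.of_forall fun z => ?_)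
    simp only
    ring

/-- The correlation `∫ e^{imℓy} ψ(y) ψ̄(y + nℓ) dy` for `k = (m,n)`; up to a phase, it is the
expectation value of `D(nℓ,mℓ)`. -/
noncomputable def latticeCorrelation (d : ℕ) (ψ : ℝ → ℂ) (k : ℤ × ℤ) : ℂ :=
  ∫ y, Complex.exp (Complex.I * (k.1 * step d * y : ℝ)) *
    (ψ y * conj (ψ (y + k.2 * step d)))

theorem integrable_latticeCorrelation (d : ℕ) (ψ : ModeSpace) (k : ℤ × ℤ) :
    Integrable fun y : ℝ => Complex.exp (Complex.I * (k.1 * step d * y : ℝ)) *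
      (ψ y * conj (ψ (y + k.2 * step d))) := by
  have h1 : MemLp (fun y : ℝ => conj (ψ (y + k.2 * step d))) 2 volume :=
    ((Lp.memLp ψ).comp_measurePreserving (measurePreserving_add_right volume _)).star
  exact ((Lp.memLp ψ).integrable_mul h1).bdd_mul (c := 1)
    (Continuous.aestronglyMeasurable (by fun_prop))
    (Eventually.of_forall fun y => (norm_exp_I_mul_ofReal _).le)

/-- `ω^n = e^{inℓ²}`, because `ℓ² = 2π/d`. -/
theorem stdAddChar_intCast (d : ℕ) [NeZero d] (n : ℤ) :
    (ZMod.stdAddChar (n : ZMod d) : ℂ) = Complex.exp (Complex.I * (n * step d * step d : ℝ)) := by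
  rw [ZMod.stdAddChar_coe, mul_assoc (n : ℝ), step_mul_step]
  congr 1
  push_cast
  ring

theorem hasSum_latticeCorrelation (d : ℕ) [NeZero d] (ψ : ModeSpace) (k : ℤ × ℤ) :
    HasSum (fun p : ℤ => (ZMod.stdAddChar ((k.1 * p : ℤ) : ZMod d) : ℂ) * zakOverlap d ψ k p)
      (latticeCorrelation d ψ k) := by
  refine (hasSum_setIntegral_Ico_add (step_pos d) (integrable_latticeCorrelation d ψ k)).congr_eq
    (fun p => ?_) rfl
  rw [zakOverlap, ← integral_const_mul, stdAddChar_intCast]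
  refine integral_congr_ae (Eventually.of_forall fun s => ?_)
  simp only
  rw [← mul_assoc (Complex.exp (Complex.I * ((k.1 * p : ℤ) * step d * step d : ℝ))),
    ← Complex.exp_add]
  congr 1
  · congr 1
    push_cast
    ring
  · congr 3
    push_cast
    ring

/-- The discrete Fourier sum of the correlations of the amplitudes is a correlation of the wave
function. -/
theorem IsSyndromeAmplitude.sum_integral {d : ℕ} [NeZero d] {ψ : ModeSpace}
    {Φ : ℝ × ℝ → ZMod d → ℂ} (hΦ : IsSyndromeAmplitude d ψ Φ) (k : ℤ × ℤ) :
    ∑ j : ZMod d, (ZMod.stdAddChar (k.1 * j : ZMod d) : ℂ) *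
      ∫ z in torusCell (step d), Φ z j * conj (Φ z (j + k.2)) * planeWave (step d) (-k) z =
      latticeCorrelation d ψ k := by
  have h1 := ((residueEquiv d).hasSum_iff.mpr (hasSum_latticeCorrelation d ψ k)).prod_fiberwise
    fun j => ((hΦ.hasSum_zakOverlap j k).mul_left (ZMod.stdAddChar (k.1 * j : ZMod d) : ℂ)).congr_eq
      (g := fun N => _) (fun N => by
        simp [residueEquiv_apply]) rfl
  exact (hasSum_fintype _).unique h1

theorem zakOverlap_zero (d : ℕ) [NeZero d] (ψ : ModeSpace) (p : ℤ) :
    zakOverlap d ψ 0 p = ((‖(memLp_zakPiece d ψ p).toLp _‖ ^ 2 : ℝ) : ℂ) := by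
  have h1 := integral_zakPiece_mul_conj d ψ p p 0 0 (by simp)
  rw [if_pos rfl] at h1
  have h2 := inner_toLp (memLp_zakPiece d ψ p) (memLp_zakPiece d ψ p)
  rw [inner_self_eq_norm_sq_to_K] at h2
  rw [← h1, Complex.ofReal_pow]
  refine (h2.trans ?_).symm
  simp [planeWave]

theorem latticeCorrelation_zero (d : ℕ) (ψ : ModeSpace) :
    latticeCorrelation d ψ 0 = ((‖ψ‖ ^ 2 : ℝ) : ℂ) := by
  have h2 := L2.inner_def (𝕜 := ℂ) ψ ψ
  rw [inner_self_eq_norm_sq_to_K] at h2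
  rw [Complex.ofReal_pow]
  refine (h2.trans ?_).symm
  rw [latticeCorrelation]
  simp [Complex.mul_conj']

theorem summable_of_pairwise_inner_eq_zero {H ι : Type*} [NormedAddCommGroup H]
    [InnerProductSpace ℂ H] [CompleteSpace H] {v : ι → H}
    (hv : Pairwise fun i j => ⟪v i, v j⟫_ℂ = 0) (hs : Summable fun i => ‖v i‖ ^ 2) :
    Summable v := by
  have hfam : OrthogonalFamily ℂ (fun i => (ℂ ∙ v i)) fun i => (ℂ ∙ v i).subtypeₗᵢ := by
    intro i j hne x y
    obtain ⟨a, ha⟩ := Submodule.mem_span_singleton.mp x.2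
    obtain ⟨b, hb⟩ := Submodule.mem_span_singleton.mp y.2
    change ⟪(x : H), (y : H)⟫_ℂ = 0
    rw [← ha, ← hb, inner_smul_left, inner_smul_right, hv hne, mul_zero, mul_zero]
  exact (hfam.summable_iff_norm_sq_summable fun i =>
    ⟨v i, Submodule.mem_span_singleton_self _⟩).mpr hs

theorem summable_norm_sq_zakPiece (d : ℕ) [NeZero d] (ψ : ModeSpace) :
    Summable fun p : ℤ => ‖(memLp_zakPiece d ψ p).toLp _‖ ^ 2 := by
  have h3 := (Complex.hasSum_re (hasSum_latticeCorrelation d ψ 0)).summable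
  refine h3.congr fun p => ?_
  rw [zakOverlap_zero, Prod.fst_zero, zero_mul, Int.cast_zero, AddChar.map_zero_eq_one, one_mul,
    Complex.ofReal_re]

/-- The pieces at the positions of one residue class are orthogonal with summable squared norms, so
the series of the amplitude converges in mean square. -/
theorem exists_isSyndromeAmplitude (d : ℕ) [NeZero d] (ψ : ModeSpace) :
    ∃ Φ, IsSyndromeAmplitude d ψ Φ := by
  have hsum : ∀ j : ZMod d,
      Summable fun N : ℤ => (memLp_zakPiece d ψ (j.val + d * N)).toLp _ := fun j => by
    refine summable_of_pairwise_inner_eq_zero (fun N N' hne => ?_) ?_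
    · have h1 := integral_zakPiece_mul_conj d ψ (j.val + d * N') (j.val + d * N) (N - N') 0
        (by simp; ring)
      rw [if_neg (sub_ne_zero.mpr hne)] at h1
      refine (inner_toLp _ _).trans ?_
      simpa [planeWave] using h1
    · have hinj : Function.Injective fun N : ℤ => (j.val : ℤ) + d * N :=
        (residueEquiv d).injective.comp (Prod.mk_right_injective j)
      exact (summable_norm_sq_zakPiece d ψ).comp_injective hinj
  refine ⟨fun z j => (∑' N : ℤ, (memLp_zakPiece d ψ (j.val + d * N)).toLp _ : Lp ℂ 2 _) z,
    (isSyndromeAmplitude_iff d ψ _).mpr fun j => ⟨Lp.memLp _, ?_⟩⟩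
  refine (hasSum_toLp_iff (fun N : ℤ => memLp_zakPiece d ψ (j.val + d * N)) (Lp.memLp _)).mp ?_
  rw [Lp.toLp_coeFn]
  exact (hsum j).hasSum

/-! ### Logical families -/

theorem IsSyndromeAmplitude.integral_norm_sq_le {d : ℕ} [NeZero d] {ψ : ModeSpace}
    {Φ : ℝ × ℝ → ZMod d → ℂ} (hΦ : IsSyndromeAmplitude d ψ Φ) (j : ZMod d) :
    ∫ z in torusCell (step d), ‖Φ z j‖ ^ 2 ≤ ‖ψ‖ ^ 2 := by
  have h1 := hΦ.sum_integral 0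
  rw [latticeCorrelation_zero] at h1
  have h2 : ∀ j : ZMod d, ∫ z in torusCell (step d), Φ z j * conj (Φ z (j + (0 : ℤ × ℤ).2)) *
      planeWave (step d) (-0) z = ((∫ z in torusCell (step d), ‖Φ z j‖ ^ 2 : ℝ) : ℂ) := fun j => by
    rw [← integral_complex_ofReal]
    refine integral_congr_ae (Eventually.of_forall fun z => ?_)
    simp [planeWave, Complex.mul_conj']
  simp only [h2, Prod.fst_zero, Int.cast_zero, zero_mul, AddChar.map_zero_eq_one, one_mul] at h1
  rw [← Complex.ofReal_sum, Complex.ofReal_inj] at h1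
  rw [← h1]
  exact Finset.single_le_sum (f := fun j : ZMod d => ∫ z in torusCell (step d), ‖Φ z j‖ ^ 2)
    (fun j _ => integral_nonneg fun z => by positivity) (Finset.mem_univ j)

theorem IsSyndromeAmplitude.integrable_mul_conj {d : ℕ} {ψ : ModeSpace}
    {Φ : ℝ × ℝ → ZMod d → ℂ} (hΦ : IsSyndromeAmplitude d ψ Φ) (j k : ZMod d) :
    IntegrableOn (fun z => Φ z j * conj (Φ z k)) (torusCell (step d)) :=
  (hΦ j).1.integrable_mul (hΦ k).1.star

theorem IsSyndromeAmplitude.integral_norm_mul_conj_le {d : ℕ} [NeZero d] {ψ : ModeSpace}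
    {Φ : ℝ × ℝ → ZMod d → ℂ} (hΦ : IsSyndromeAmplitude d ψ Φ) (j k : ZMod d) :
    ∫ z in torusCell (step d), ‖Φ z j * conj (Φ z k)‖ ≤ 2 * ‖ψ‖ ^ 2 := by
  have hi : ∀ j, IntegrableOn (fun z => ‖Φ z j‖ ^ 2) (torusCell (step d)) := fun j => by
    have := (hΦ j).1.integrable_norm_pow two_ne_zero
    exact this
  calc ∫ z in torusCell (step d), ‖Φ z j * conj (Φ z k)‖
      ≤ ∫ z in torusCell (step d), (‖Φ z j‖ ^ 2 + ‖Φ z k‖ ^ 2) := by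
        refine integral_mono (hΦ.integrable_mul_conj j k).norm ((hi j).add (hi k)) fun z => ?_
        simp only [norm_mul, RCLike.norm_conj]
        exact mul_le_sq_add_sq _ _
    _ = (∫ z in torusCell (step d), ‖Φ z j‖ ^ 2) + ∫ z in torusCell (step d), ‖Φ z k‖ ^ 2 :=
        integral_add (hi j) (hi k)
    _ ≤ 2 * ‖ψ‖ ^ 2 := by
        linarith [hΦ.integral_norm_sq_le j, hΦ.integral_norm_sq_le k]

theorem ae_summable_of_summable_integral_norm {α : Type*} [MeasurableSpace α] {μ : Measure α}
    {F : ℕ → α → ℂ} (hF : ∀ i, Integrable (F i) μ)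
    (hs : Summable fun i => ∫ x, ‖F i x‖ ∂μ) : ∀ᵐ x ∂μ, Summable fun i => ‖F i x‖ := by
  refine summable_norm_of_tsum_eLpNorm_ne_top le_rfl (fun i => (hF i).1) ?_
  simp only [eLpNorm_one_eq_lintegral_enorm, ← ofReal_integral_norm_eq_lintegral_enorm (hF _)]
  exact hs.tsum_ofReal_ne_top

theorem integrable_of_ae_hasSum {α : Type*} [MeasurableSpace α] {μ : Measure α}
    {F : ℕ → α → ℂ} {f : α → ℂ} (hF : ∀ i, Integrable (F i) μ)
    (hs : Summable fun i => ∫ x, ‖F i x‖ ∂μ) (hf : ∀ᵐ x ∂μ, HasSum (fun i => F i x) (f x)) :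
    Integrable f μ := by
  refine ⟨aestronglyMeasurable_of_tendsto_ae atTop
    (f := fun n x => ∑ i ∈ Finset.range n, F i x)
    (fun n => (integrable_finsetSum _ fun i _ => hF i).1)
    (hf.mono fun x hx => hx.tendsto_sum_nat), ?_⟩
  have h1 : ∫⁻ x, ‖f x‖ₑ ∂μ ≤ ∫⁻ x, ∑' i, ‖F i x‖ₑ ∂μ := by
    refine lintegral_mono_ae (hf.mono fun x hx => ?_)
    rw [← hx.tsum_eq]
    exact enorm_tsum_le_tsum_enorm
  refine h1.trans_lt ?_
  rw [lintegral_tsum fun i => (hF i).1.enorm]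
  simp only [← ofReal_integral_norm_eq_lintegral_enorm (hF _)]
  exact hs.tsum_ofReal_lt_top

theorem hasSum_integral_of_ae_hasSum {α : Type*} [MeasurableSpace α] {μ : Measure α}
    {F : ℕ → α → ℂ} {f : α → ℂ} (hF : ∀ i, Integrable (F i) μ)
    (hs : Summable fun i => ∫ x, ‖F i x‖ ∂μ) (hf : ∀ᵐ x ∂μ, HasSum (fun i => F i x) (f x)) :
    HasSum (fun i => ∫ x, F i x ∂μ) (∫ x, f x ∂μ) :=
  (hasSum_integral_of_summable_integral_norm hF hs).congr_eq (fun _ => rfl)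
    (integral_congr_ae (hf.mono fun _ hx => hx.tsum_eq))

/-- The matrix entries converge almost everywhere, because the `L¹` norms of their terms are bounded
by the summable weights `‖ψ_i‖²` of the ensemble. -/
theorem IsDensityOperator.exists_isLogicalFamily {ρ : ModeSpace →L[ℂ] ModeSpace}
    (hρ : IsDensityOperator ρ) (d : ℕ) [NeZero d] : ∃ R, IsLogicalFamily d ρ R := by
  obtain ⟨ψ, hψ⟩ := hρ.exists_isEnsemble
  choose Φ hΦ using fun i => exists_isSyndromeAmplitude d (ψ i)
  refine ⟨fun z j k => ∑' i, Φ i z j * conj (Φ i z k), ψ, Φ, hψ, hΦ, ?_⟩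
  refine ae_all_iff.mpr fun j => ae_all_iff.mpr fun k => ?_
  have hs : Summable fun i => ∫ z in torusCell (step d), ‖Φ i z j * conj (Φ i z k)‖ :=
    Summable.of_nonneg_of_le (fun i => integral_nonneg fun z => norm_nonneg _)
      (fun i => (hΦ i).integral_norm_mul_conj_le j k)
      ((hψ.summable_norm_sq modeBasis hρ.2.summable).mul_left 2)
  filter_upwards [ae_summable_of_summable_integral_norm
    (fun i => (hΦ i).integrable_mul_conj j k) hs] with z hz
  exact hz.of_norm.hasSum

/-! ### Cutting the large cell into small ones -/

theorem floor_cell {d : ℕ} [NeZero d] {s : ℝ} (hs : s ∈ Ico 0 (step d)) (n : ℕ) :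
    ⌊(s + n * step d) / step d⌋ = n := by
  have hpos := step_pos d
  rw [Int.floor_eq_iff, add_div, mul_div_cancel_right₀ _ hpos.ne', Int.cast_natCast]
  have h1 : 0 ≤ s / step d := div_nonneg hs.1 hpos.le
  have h2 : s / step d < 1 := (div_lt_one hpos).mpr hs.2
  constructor <;> linarith

theorem exists_mem_cell {d : ℕ} [NeZero d] {x : ℝ} (hx : x ∈ Ico 0 (d * step d)) :
    ∃ a : ZMod d, x - a.val * step d ∈ Ico 0 (step d) := by
  have hpos := step_pos d
  have h0 : 0 ≤ x / step d := div_nonneg hx.1 hpos.le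
  have h1 : ⌊x / step d⌋₊ < d := by
    rw [Nat.floor_lt h0, div_lt_iff₀ hpos]
    exact hx.2
  refine ⟨(⌊x / step d⌋₊ : ℕ), ?_⟩
  rw [ZMod.val_natCast_of_lt h1]
  have h2 := Nat.floor_le h0
  have h3 := Nat.lt_floor_add_one (x / step d)
  rw [le_div_iff₀ hpos] at h2
  rw [div_lt_iff₀ hpos] at h3
  constructor <;> linarith

/-- The lower left corner of the `(a,b)`-th small cell of the large cell. -/
noncomputable def cellCorner (d : ℕ) (w : ZMod d × ZMod d) : ℝ × ℝ :=
  (w.1.val * step d, w.2.val * step d)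

theorem iUnion_cell (d : ℕ) [NeZero d] :
    ⋃ w, (fun z => z - cellCorner d w) ⁻¹' torusCell (step d) = torusCell (d * step d) := by
  have hpos := step_pos d
  ext ⟨x, y⟩
  simp only [mem_iUnion, mem_preimage]
  constructor
  · rintro ⟨⟨a, b⟩, h1, h2⟩
    have hv : ∀ (a : ZMod d) (x : ℝ), x - a.val * step d ∈ Ico 0 (step d) →
        x ∈ Ico 0 (d * step d) := fun a x hx => by
      have ha : (a.val : ℝ) + 1 ≤ d := by exact_mod_cast ZMod.val_lt a
      have ha0 : (0 : ℝ) ≤ a.val * step d := by positivity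
      have := mul_le_mul_of_nonneg_right ha hpos.le
      constructor
      · linarith [hx.1]
      · linarith [hx.2]
    exact ⟨hv a x h1, hv b y h2⟩
  · rintro ⟨h1, h2⟩
    obtain ⟨a, ha⟩ := exists_mem_cell h1
    obtain ⟨b, hb⟩ := exists_mem_cell h2
    exact ⟨(a, b), ha, hb⟩

theorem pairwise_disjoint_cell (d : ℕ) [NeZero d] :
    Pairwise (Function.onFun Disjoint fun w =>
      (fun z => z - cellCorner d w) ⁻¹' torusCell (step d)) := by
  intro w w' hne
  refine Set.disjoint_left.mpr fun z hz hz' => hne ?_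
  have key : ∀ (a a' : ZMod d) (x : ℝ), x - a.val * step d ∈ Ico 0 (step d) →
      x - a'.val * step d ∈ Ico 0 (step d) → a = a' := fun a a' x h h' => by
    have h1 := floor_cell h a.val
    have h2 := floor_cell h' a'.val
    rw [sub_add_cancel] at h1 h2
    exact ZMod.val_injective d (by exact_mod_cast h1.symm.trans h2)
  exact Prod.ext (key _ _ _ hz.1 hz'.1) (key _ _ _ hz.2 hz'.2)

theorem measurableSet_cell (d : ℕ) (w : ZMod d × ZMod d) :
    MeasurableSet ((fun z => z - cellCorner d w) ⁻¹' torusCell (step d)) :=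
  (measurableSet_torusCell _).preimage (measurable_sub_const _)

theorem integrableOn_torusCell_of_shift {d : ℕ} [NeZero d] {f : ℝ × ℝ → ℂ}
    (h : ∀ w, IntegrableOn (fun z => f (z + cellCorner d w)) (torusCell (step d))) :
    IntegrableOn f (torusCell (d * step d)) := by
  rw [← iUnion_cell, integrableOn_finite_iUnion]
  intro w
  have h1 := ((measurePreserving_sub_right (volume : Measure (ℝ × ℝ))
    (cellCorner d w)).integrableOn_comp_preimage (measurableEmbedding_subRight _)).mpr (h w)
  refine h1.congr_fun (fun z _ => ?_) (measurableSet_cell d w)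
  simp

theorem setIntegral_torusCell_eq_sum {d : ℕ} [NeZero d] {f : ℝ × ℝ → ℂ}
    (h : IntegrableOn f (torusCell (d * step d))) :
    ∫ z in torusCell (d * step d), f z =
      ∑ w, ∫ z in torusCell (step d), f (z + cellCorner d w) := by
  have hsub : ∀ w, (fun z => z - cellCorner d w) ⁻¹' torusCell (step d) ⊆
      torusCell (d * step d) := fun w =>
    (subset_iUnion (fun w => (fun z => z - cellCorner d w) ⁻¹' torusCell (step d)) w).trans
      (iUnion_cell d).subset
  rw [← iUnion_cell, integral_iUnion_fintype (measurableSet_cell d) (pairwise_disjoint_cell d)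
    fun w => h.mono_set (hsub w)]
  refine Finset.sum_congr rfl fun w _ => ?_
  have h1 := (measurePreserving_sub_right (volume : Measure (ℝ × ℝ))
    (cellCorner d w)).setIntegral_preimage_emb (measurableEmbedding_subRight _)
    (fun z => f (z + cellCorner d w)) (torusCell (step d))
  simpa only [sub_add_cancel] using h1

/-- The function on the large cell assembled from the Gross Wigner functions of a family of
matrices. -/
noncomputable def assembledWigner (d : ℕ) [NeZero d] (R : ℝ × ℝ → Matrix (ZMod d) (ZMod d) ℂ)
    (z : ℝ × ℝ) : ℂ :=
  grossWigner d (R (z.1 - ⌊z.1 / step d⌋ * step d, z.2 - ⌊z.2 / step d⌋ * step d))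
    ⌊z.1 / step d⌋ ⌊z.2 / step d⌋

theorem assembledWigner_add (d : ℕ) [NeZero d] (R : ℝ × ℝ → Matrix (ZMod d) (ZMod d) ℂ)
    {z : ℝ × ℝ} (hz : z ∈ torusCell (step d)) (w : ZMod d × ZMod d) :
    assembledWigner d R (z + cellCorner d w) = grossWigner d (R z) w.1 w.2 := by
  simp only [assembledWigner, cellCorner, Prod.fst_add, Prod.snd_add, floor_cell hz.1,
    floor_cell hz.2]
  simp

/-- Since `ℓ² = 2π/d`, a plane wave restricted to the corners of the small cells is a character of
`(ℤ/d)²`. -/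
theorem planeWave_add_cellCorner (d : ℕ) [NeZero d] (k : ℤ × ℤ) (z : ℝ × ℝ)
    (w : ZMod d × ZMod d) : planeWave (step d) (-k) (z + cellCorner d w) =
      (ZMod.stdAddChar (k.1 * w.1 - k.2 * w.2 : ZMod d) : ℂ) * planeWave (step d) (-k) z := by
  have : (k.1 * w.1 - k.2 * w.2 : ZMod d) = ((k.1 * w.1.val - k.2 * w.2.val : ℤ) : ZMod d) := by
    simp
  rw [this, stdAddChar_intCast, planeWave, planeWave, ← Complex.exp_add]
  congr 1
  simp [cellCorner]
  ring

/-! ### The Zak–Gross Wigner function of a state -/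

theorem step_mul_cell (d : ℕ) [NeZero d] : step d * (d * step d) = 2 * Real.pi := by
  rw [← nat_mul_step_mul_step d]
  ring

/-- The sign `(-1)^{mn}` turns the phase of `D(nℓ,mℓ)` into that of the qudit displacement. -/
theorem neg_one_zpow_mul_exp (d : ℕ) [NeZero d] {h : ℤ} (hh : 2 * h = d + 1) (k : ℤ × ℤ) :
    (-1 : ℂ) ^ (k.1 * k.2) *
        Complex.exp (Complex.I * (k.1 * k.2 * step d * step d / 2 : ℝ)) =
      ZMod.stdAddChar ((k.1 * k.2 * h : ℤ) : ZMod d) := by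
  have h1 : (-1 : ℂ) ^ (k.1 * k.2) =
      Complex.exp (Complex.I * (k.1 * k.2 * d * step d * step d / 2 : ℝ)) := by
    rw [← Complex.exp_pi_mul_I, ← Complex.exp_int_mul]
    congr 1
    have : ((d * step d * step d : ℝ) : ℂ) = (2 * Real.pi : ℝ) := by rw [nat_mul_step_mul_step]
    push_cast at this ⊢
    linear_combination (-Complex.I * k.1 * k.2 / 2) * this
  rw [stdAddChar_intCast, h1, ← Complex.exp_add]
  congr 1
  have : (2 * h : ℂ) = d + 1 := by exact_mod_cast hh
  push_cast
  linear_combination (-Complex.I * k.1 * k.2 * step d * step d / 2) * this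

theorem neg_one_zpow_mul_inner_displacement (d : ℕ) [NeZero d] {h : ℤ} (hh : 2 * h = d + 1)
    (k : ℤ × ℤ) (ψ : ModeSpace) :
    (-1 : ℂ) ^ (k.1 * k.2) * ⟪ψ, displacement (k.2 * step d) (k.1 * step d) ψ⟫_ℂ =
      ZMod.stdAddChar ((k.1 * k.2 * h : ℤ) : ZMod d) * latticeCorrelation d ψ k := by
  rw [← neg_one_zpow_mul_exp d hh, mul_assoc]
  congr 1
  rw [L2.inner_def, latticeCorrelation, ← integral_const_mul,
    ← integral_sub_right_eq_self (fun y : ℝ =>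
      Complex.exp (Complex.I * (k.1 * k.2 * step d * step d / 2 : ℝ)) *
        (Complex.exp (Complex.I * (k.1 * step d * y : ℝ)) *
          (ψ y * conj (ψ (y + k.2 * step d))))) (k.2 * step d)]
  refine integral_congr_ae ?_
  filter_upwards [coeFn_displacement (k.2 * step d) (k.1 * step d) ψ] with y hy
  rw [hy, displacementFun_apply, RCLike.inner_apply, sub_add_cancel,
    ← mul_assoc (Complex.exp (Complex.I * (k.1 * k.2 * step d * step d / 2 : ℝ))),
    ← Complex.exp_add, mul_assoc]
  congr 2
  push_cast
  ring

theorem IsEnsemble.hasSum_zakGrossTerm {ρ : ModeSpace →L[ℂ] ModeSpace} {ψ : ℕ → ModeSpace}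
    (hψ : IsEnsemble ρ ψ) (hs : Summable fun i => ‖ψ i‖ ^ 2) (d : ℕ) [NeZero d] {h : ℤ}
    (hh : 2 * h = d + 1) (k : ℤ × ℤ) :
    HasSum (fun i => d * ((ZMod.stdAddChar ((k.1 * k.2 * h : ℤ) : ZMod d) : ℂ) *
        latticeCorrelation d (ψ i) k))
      (((d * step d : ℝ) : ℂ) ^ 2 * zakGrossTerm d ρ 0 k) := by
  refine ((hψ.hasSum_opTrace hs (displacement (k.2 * step d) (k.1 * step d))).mul_left
    ((d : ℂ) * (-1) ^ (k.1 * k.2))).congr_eq (fun i => ?_) ?_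
  · rw [← neg_one_zpow_mul_inner_displacement d hh, mul_assoc]
  · rw [zakGrossTerm_zero]
    have h1 : ((d * step d * step d : ℝ) : ℂ) = (2 * Real.pi : ℝ) := by
      rw [nat_mul_step_mul_step]
    have hpi : (Real.pi : ℂ) ≠ 0 := Complex.ofReal_ne_zero.mpr Real.pi_ne_zero
    generalize opTrace (displacement (k.2 * step d) (k.1 * step d) ∘L ρ) = τ
    generalize (-1 : ℂ) ^ (k.1 * k.2) = σ
    push_cast at h1 ⊢
    field_simp
    linear_combination (-(d : ℂ) * τ * σ) * h1

theorem integrableOn_grossWigner {d : ℕ} [NeZero d] {R : ℝ × ℝ → Matrix (ZMod d) (ZMod d) ℂ}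
    {S : Set (ℝ × ℝ)} (hR : ∀ j k, IntegrableOn (fun z => R z j k) S) (a b : ZMod d) :
    IntegrableOn (fun z => grossWigner d (R z) a b) S := by
  simp only [grossWigner_eq_sum]
  exact integrable_finsetSum _ fun j _ => (hR j _).const_mul _

theorem integrable_mul_planeWave {μ : Measure (ℝ × ℝ)} {f : ℝ × ℝ → ℂ} (hf : Integrable f μ)
    (κ : ℝ) (k : ℤ × ℤ) : Integrable (fun z => f z * planeWave κ k z) μ :=
  hf.mul_bdd (c := 1) (continuous_planeWave κ k).aestronglyMeasurable
    (Eventually.of_forall fun z => (norm_planeWave κ k z).le)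

/-- The Fourier coefficients of the assembled Wigner function. -/
theorem torusCoeff_assembledWigner {d : ℕ} [NeZero d]
    {R : ℝ × ℝ → Matrix (ZMod d) (ZMod d) ℂ}
    (hR : ∀ j k, IntegrableOn (fun z => R z j k) (torusCell (step d)))
    (hW : IntegrableOn (assembledWigner d R) (torusCell (d * step d))) {h : ℤ}
    (hh : 2 * h = d + 1) (k : ℤ × ℤ) :
    torusCoeff (d * step d) (step d) (assembledWigner d R) (-k) =
      d * ((ZMod.stdAddChar ((k.1 * k.2 * h : ℤ) : ZMod d) : ℂ) *
        ∑ j, (ZMod.stdAddChar (k.1 * j : ZMod d) : ℂ) *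
          ∫ z in torusCell (step d), R z j (j + k.2) * planeWave (step d) (-k) z) := by
  have hh' : 2 * (h : ZMod d) = 1 := by
    have : ((2 * h : ℤ) : ZMod d) = ((d + 1 : ℤ) : ZMod d) := by rw [hh]
    simpa using this
  have hRE : ∀ j k', IntegrableOn (fun z => R z j k' * planeWave (step d) (-k) z)
      (torusCell (step d)) := fun j k' => integrable_mul_planeWave (hR j k') _ _
  rw [torusCoeff, setIntegral_torusCell_eq_sum (integrable_mul_planeWave hW _ _)]
  have h1 : ∀ w, ∫ z in torusCell (step d), assembledWigner d R (z + cellCorner d w) *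
      planeWave (step d) (-k) (z + cellCorner d w) = ∫ z in torusCell (step d),
        (ZMod.stdAddChar (k.1 * w.1 - k.2 * w.2 : ZMod d) : ℂ) *
          (grossWigner d (R z) w.1 w.2 * planeWave (step d) (-k) z) := fun w => by
    refine setIntegral_congr_fun (measurableSet_torusCell _) fun z hz => ?_
    simp only [assembledWigner_add d R hz, planeWave_add_cellCorner]
    ring
  simp only [h1]
  rw [← integral_finsetSum]
  · have h2 : ∀ z, ∑ w : ZMod d × ZMod d, (ZMod.stdAddChar (k.1 * w.1 - k.2 * w.2 : ZMod d) : ℂ) *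
        (grossWigner d (R z) w.1 w.2 * planeWave (step d) (-k) z) =
        d * ((ZMod.stdAddChar ((k.1 * k.2 * h : ℤ) : ZMod d) : ℂ) *
          ∑ j, (ZMod.stdAddChar (k.1 * j : ZMod d) : ℂ) *
            (R z j (j + k.2) * planeWave (step d) (-k) z)) := fun z => by
      simp only [← mul_assoc]
      rw [← Finset.sum_mul, Fintype.sum_prod_type,
        sum_stdAddChar_mul_grossWigner d (R z) k.1 k.2 h hh', ← Finset.sum_mul, ← mul_assoc,
        mul_assoc (d : ℂ) (ZMod.stdAddChar _), Finset.mul_sum (a := (ZMod.stdAddChar _ : ℂ))]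
      congr 2
      refine Finset.sum_congr rfl fun j _ => ?_
      rw [← mul_assoc, ← AddChar.map_add_eq_mul]
      congr 2
      push_cast
      ring
    simp only [h2]
    rw [integral_const_mul, integral_const_mul, integral_finsetSum]
    · simp only [integral_const_mul]
    · exact fun j _ => (hRE _ _).const_mul _
  · exact fun w _ => (integrable_mul_planeWave (integrableOn_grossWigner hR _ _) _ _).const_mul _

/-- The Gross Wigner functions of the logical states assemble to the Zak–Gross Wigner function. -/
theorem IsLogicalFamily.isZakGrossWigner {d : ℕ} [NeZero d] (hd : Odd d)
    {ρ : ModeSpace →L[ℂ] ModeSpace} (hρ : IsDensityOperator ρ)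
    {R : ℝ × ℝ → Matrix (ZMod d) (ZMod d) ℂ} (hR : IsLogicalFamily d ρ R) :
    IsZakGrossWigner d ρ (assembledWigner d R) := by
  obtain ⟨ψ, Φ, hψ, hΦ, hae⟩ := hR
  have hψ' : IsEnsemble ρ ψ := hψ
  have hpos := step_pos d
  have hL : 0 < d * step d := by
    have : (0 : ℝ) < d := Nat.cast_pos.mpr (Nat.pos_of_ne_zero (NeZero.ne d))
    positivity
  have hs := hψ'.summable_norm_sq modeBasis hρ.2.summable
  obtain ⟨h, hh⟩ : ∃ h : ℤ, 2 * h = d + 1 := by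
    obtain ⟨m, hm⟩ := hd
    exact ⟨m + 1, by rw [hm]; push_cast; ring⟩
  have hae' : ∀ j k, ∀ᵐ z ∂volume.restrict (torusCell (step d)),
      HasSum (fun i => Φ i z j * conj (Φ i z k)) (R z j k) := fun j k =>
    hae.mono fun z hz => hz j k
  have hFs : ∀ j k, Summable fun i => ∫ z in torusCell (step d), ‖Φ i z j * conj (Φ i z k)‖ :=
    fun j k => Summable.of_nonneg_of_le (fun i => integral_nonneg fun z => norm_nonneg _)
      (fun i => (hΦ i).integral_norm_mul_conj_le j k) (hs.mul_left 2)
  have hRi : ∀ j k, IntegrableOn (fun z => R z j k) (torusCell (step d)) := fun j k =>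
    integrable_of_ae_hasSum (fun i => (hΦ i).integrable_mul_conj j k) (hFs j k) (hae' j k)
  have hRE : ∀ j k', ∀ k : ℤ × ℤ, HasSum (fun i => ∫ z in torusCell (step d),
      Φ i z j * conj (Φ i z k') * planeWave (step d) k z)
      (∫ z in torusCell (step d), R z j k' * planeWave (step d) k z) := fun j k' k => by
    refine hasSum_integral_of_ae_hasSum
      (fun i => integrable_mul_planeWave ((hΦ i).integrable_mul_conj j k') _ _) ?_ ?_
    · simpa only [norm_mul, norm_planeWave, mul_one] using hFs j k'
    · filter_upwards [hae' j k'] with z hz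
      exact hz.mul_right _
  have hW : IntegrableOn (assembledWigner d R) (torusCell (d * step d)) := by
    refine integrableOn_torusCell_of_shift fun w => ?_
    exact (integrableOn_grossWigner hRi w.1 w.2).congr_fun
      (fun z hz => (assembledWigner_add d R hz w).symm) (measurableSet_torusCell _)
  refine ⟨hW, fun φ hφ h1 h2 => ?_⟩
  have hc : ∀ k, torusCoeff (d * step d) (step d) (assembledWigner d R) (-k) =
      ((d * step d : ℝ) : ℂ) ^ 2 * zakGrossTerm d ρ 0 k := fun k => by
    rw [torusCoeff_assembledWigner hRi hW hh]
    refine HasSum.unique ?_ (hψ'.hasSum_zakGrossTerm hs d hh k)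
    refine HasSum.mul_left _ (HasSum.mul_left _ ?_)
    refine (hasSum_sum fun (j : ZMod d) _ => (hRE j (j + k.2) (-k)).mul_left
      (ZMod.stdAddChar (k.1 * j : ZMod d) : ℂ)).congr_eq (fun i => ?_) rfl
    exact (hΦ i).sum_integral k
  -- Equal Fourier coefficients give convergence in the sense of distributions.
  have hmain := IsSmoothPeriodic.hasSum_integral_mul ⟨hφ, h1, h2⟩ hL (step_mul_cell d) hW hc
  refine hmain.congr_eq (fun k => ?_) rfl
  refine integral_congr_ae (Eventually.of_forall fun z => ?_)
  simp only
  rw [zakGrossTerm_eq d ρ z k, planeWave]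

theorem IsZakGrossWigner.ae_eq {d : ℕ} [NeZero d] {A : ModeSpace →L[ℂ] ModeSpace}
    {W W' : ℝ × ℝ → ℂ} (h : IsZakGrossWigner d A W) (h' : IsZakGrossWigner d A W') :
    ∀ᵐ z ∂volume.restrict (torusCell (d * step d)), W z = W' z := by
  have hL : 0 < d * step d := by
    have : (0 : ℝ) < d := Nat.cast_pos.mpr (Nat.pos_of_ne_zero (NeZero.ne d))
    have := step_pos d
    positivity
  have hint : ∀ {φ V : ℝ × ℝ → ℂ}, IsSmoothPeriodic (d * step d) φ →
      IntegrableOn V (torusCell (d * step d)) →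
      IntegrableOn (fun z => φ z * V z) (torusCell (d * step d)) := fun {φ V} hφ hV => by
    obtain ⟨C, hC⟩ := (isCompact_Icc.prod isCompact_Icc).exists_bound_of_continuousOn
      (s := Icc 0 (d * step d) ×ˢ Icc 0 (d * step d)) hφ.continuous.continuousOn
    refine hV.bdd_mul (c := C) hφ.continuous.aestronglyMeasurable ?_
    refine (ae_restrict_iff' (measurableSet_torusCell _)).mpr (Eventually.of_forall fun z hz => ?_)
    exact hC z ⟨Ico_subset_Icc_self hz.1, Ico_subset_Icc_self hz.2⟩
  have h0 := ae_eq_zero_of_integral_mul_isSmoothPeriodic hL (h.1.sub h'.1) fun φ hφ => by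
    have e := (h.2 φ hφ.contDiff hφ.add_left hφ.add_right).unique
      (h'.2 φ hφ.contDiff hφ.add_left hφ.add_right)
    simp only [Pi.sub_apply, mul_sub]
    rw [integral_sub (hint hφ h.1) (hint hφ h'.1), e, sub_self]
  filter_upwards [h0] with z hz
  exact sub_eq_zero.mp hz

theorem isZakGrossWigner_of_summable {d : ℕ} {A : ModeSpace →L[ℂ] ModeSpace}
    (h : ∀ z, Summable (zakGrossTerm d A z)) : IsZakGrossWigner d A (zakGrossWigner d A) := by
  have hc : Summable fun k => ‖zakGrossTerm d A 0 k‖ := (h 0).norm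
  have e1 : ∀ z k, zakGrossTerm d A z k = zakGrossTerm d A 0 k * planeWave (step d) k z :=
    fun z k => zakGrossTerm_eq d A z k
  have e2 : zakGrossWigner d A = fun z => ∑' k, zakGrossTerm d A 0 k * planeWave (step d) k z := by
    ext z
    simp only [zakGrossWigner, e1 z]
  refine ⟨?_, fun φ hφ _ _ => ?_⟩
  · rw [e2]
    exact (continuous_tsum_planeWave hc).integrableOn_torusCell _
  · rw [e2]
    refine (hasSum_integral_mul_tsum_planeWave hc hφ.continuous).congr_eq (fun k => ?_) rfl
    exact integral_congr_ae (Eventually.of_forall fun z => by simp only; rw [e1 z k])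

/-! ### The trace as the integral of the kernel over the diagonal -/

/-- The cell of index `k` of the grid of mesh `1/(n+1)`. -/
noncomputable def gridCell (n : ℕ) (k : ℤ) : Set ℝ := {x | ⌊((n + 1 : ℕ) : ℝ) * x⌋ = k}

/-- The indices of the grid cells meeting `[-(n+1), n+1)`. -/
noncomputable def gridIndex (n : ℕ) : Finset ℤ :=
  Finset.Ico (-((n + 1 : ℕ) ^ 2 : ℤ)) ((n + 1 : ℕ) ^ 2)

theorem measurableSet_gridCell (n : ℕ) (k : ℤ) : MeasurableSet (gridCell n k) :=
  (Int.measurable_floor.comp (measurable_const_mul _)) (measurableSet_singleton k)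

theorem gridCell_eq_Ico (n : ℕ) (k : ℤ) :
    gridCell n k = Ico ((k : ℝ) / (n + 1 : ℕ)) ((k + 1) / (n + 1 : ℕ)) := by
  have hpos : (0 : ℝ) < (n + 1 : ℕ) := by positivity
  ext x
  rw [gridCell, mem_ofPred_eq, Int.floor_eq_iff, mem_Ico, div_le_iff₀ hpos, lt_div_iff₀ hpos,
    mul_comm x]

theorem volume_gridCell (n : ℕ) (k : ℤ) :
    volume (gridCell n k) = ENNReal.ofReal (1 / (n + 1 : ℕ)) := by
  rw [gridCell_eq_Ico, Real.volume_Ico]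
  congr 1
  ring

theorem volume_gridCell_ne_top (n : ℕ) (k : ℤ) : volume (gridCell n k) ≠ ⊤ := by
  rw [volume_gridCell]
  exact ENNReal.ofReal_ne_top

theorem setIntegral_gridCell (n : ℕ) (k : ℤ) (f : ℝ → ℂ) :
    ((n + 1 : ℕ) : ℂ) * ∫ y in gridCell n k, f y =
      ∫ t in (0 : ℝ)..1, f ((k + t) / (n + 1 : ℕ)) := by
  have hpos : (0 : ℝ) < (n + 1 : ℕ) := by positivity
  have h1 := intervalIntegral.integral_comp_add_div (a := 0) (b := 1) f hpos.ne'
    ((k : ℝ) / (n + 1 : ℕ))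
  simp only [← add_div, add_zero, zero_div, Complex.real_smul] at h1
  rw [h1, gridCell_eq_Ico, integral_Ico_eq_integral_Ioc, intervalIntegral.integral_of_le]
  · push_cast
    rfl
  · gcongr
    linarith

theorem tendsto_floor_add_div (x t : ℝ) :
    Tendsto (fun n : ℕ => ((⌊((n + 1 : ℕ) : ℝ) * x⌋ : ℝ) + t) / (n + 1 : ℕ)) atTop (𝓝 x) := by
  have h0 : Tendsto (fun n : ℕ => (1 + |t|) / ((n + 1 : ℕ) : ℝ)) atTop (𝓝 0) :=
    (tendsto_const_div_atTop_nhds_zero_nat (1 + |t|)).comp (tendsto_add_atTop_nat 1)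
  rw [tendsto_iff_dist_tendsto_zero]
  refine squeeze_zero (fun _ => dist_nonneg) (fun n => ?_) h0
  have hpos : (0 : ℝ) < (n + 1 : ℕ) := by positivity
  rw [Real.dist_eq, le_div_iff₀ hpos, ← abs_of_pos hpos, ← abs_mul, abs_of_pos hpos, sub_mul,
    div_mul_cancel₀ _ hpos.ne']
  have h1 := Int.floor_le (((n + 1 : ℕ) : ℝ) * x)
  have h2 := Int.lt_floor_add_one (((n + 1 : ℕ) : ℝ) * x)
  rw [abs_le]
  constructor <;> linarith [neg_abs_le t, le_abs_self t]

theorem eventually_floor_mem_gridIndex (x : ℝ) :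
    ∀ᶠ n : ℕ in atTop, ⌊((n + 1 : ℕ) : ℝ) * x⌋ ∈ gridIndex n := by
  obtain ⟨N, hN⟩ := exists_nat_gt |x|
  filter_upwards [eventually_ge_atTop N] with n hn
  have h1 : |x| < (n + 1 : ℕ) := by
    have : (N : ℝ) ≤ n := by exact_mod_cast hn
    push_cast
    linarith
  obtain ⟨h2, h3⟩ := abs_lt.mp h1
  have hpos : (0 : ℝ) < (n + 1 : ℕ) := by positivity
  rw [gridIndex, Finset.mem_Ico, Int.le_floor, Int.floor_lt]
  push_cast at *
  constructor <;> nlinarith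

/-- Averages over the squares of a grid along the diagonal converge to the integral over the
diagonal. -/
theorem tendsto_sum_gridCell {G : ℝ × ℝ → ℂ} (hG : Continuous G) {g : ℝ → ℝ} (hg : Integrable g)
    (hGg : ∀ x y, ‖G (x, y)‖ ≤ g x) :
    Tendsto (fun n : ℕ => ∑ k ∈ gridIndex n,
      ∫ x in gridCell n k, ((n + 1 : ℕ) : ℂ) * ∫ y in gridCell n k, G (x, y)) atTop
      (𝓝 (∫ x, G (x, x))) := by
  set F : ℕ → ℝ → ℂ := fun n x =>
    ∫ t in (0 : ℝ)..1, G (x, (⌊((n + 1 : ℕ) : ℝ) * x⌋ + t) / (n + 1 : ℕ)) with hF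
  have hFm : ∀ n, StronglyMeasurable (F n) := fun n => by
    simp only [hF, intervalIntegral.integral_of_le zero_le_one]
    refine StronglyMeasurable.integral_prod_right' (f := fun p : ℝ × ℝ =>
      G (p.1, (⌊((n + 1 : ℕ) : ℝ) * p.1⌋ + p.2) / (n + 1 : ℕ))) ?_
    refine hG.stronglyMeasurable.comp_measurable (measurable_fst.prodMk ?_)
    have h1 : Measurable fun p : ℝ × ℝ => ((⌊((n + 1 : ℕ) : ℝ) * p.1⌋ : ℤ) : ℝ) :=
      (measurable_from_top (f := ((↑) : ℤ → ℝ))).comp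
        (Int.measurable_floor.comp (measurable_fst.const_mul _))
    exact (h1.add measurable_snd).div_const _
  have hFb : ∀ n x, ‖F n x‖ ≤ g x := fun n x => by
    refine (intervalIntegral.norm_integral_le_of_norm_le_const (C := g x)
      fun t _ => hGg _ _).trans_eq ?_
    simp
  have hFlim : ∀ x, Tendsto (fun n => F n x) atTop (𝓝 (G (x, x))) := fun x => by
    have h1 : G (x, x) = ∫ t in (0 : ℝ)..1, G (x, x) := by simp
    rw [h1]
    refine intervalIntegral.tendsto_integral_filter_of_dominated_convergence (fun _ => g x)
      (Eventually.of_forall fun n => ?_) (Eventually.of_forall fun n =>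
        Eventually.of_forall fun t _ => hGg _ _) intervalIntegrable_const
      (Eventually.of_forall fun t _ => ?_)
    · exact Continuous.aestronglyMeasurable (hG.comp (by fun_prop))
    · exact (hG.tendsto (x, x)).comp (tendsto_const_nhds.prodMk_nhds (tendsto_floor_add_div x t))
  have hsum : ∀ n : ℕ, ∑ k ∈ gridIndex n,
      ∫ x in gridCell n k, ((n + 1 : ℕ) : ℂ) * ∫ y in gridCell n k, G (x, y) =
      ∫ x, if ⌊((n + 1 : ℕ) : ℝ) * x⌋ ∈ gridIndex n then F n x else 0 := fun n => by
    have h1 : ∀ k, ∫ x in gridCell n k, ((n + 1 : ℕ) : ℂ) * ∫ y in gridCell n k, G (x, y) =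
        ∫ x, (gridCell n k).indicator (F n) x := fun k => by
      rw [integral_indicator (measurableSet_gridCell n k)]
      refine setIntegral_congr_fun (measurableSet_gridCell n k) fun x hx => ?_
      simp only [hF]
      rw [setIntegral_gridCell n k fun y => G (x, y), show ⌊((n + 1 : ℕ) : ℝ) * x⌋ = k from hx]
    simp only [h1]
    rw [← integral_finsetSum]
    · refine integral_congr_ae (Eventually.of_forall fun x => ?_)
      simp only [indicator_apply, gridCell, mem_ofPred_eq]
      rw [Finset.sum_ite_eq]
    · intro k _
      exact (hg.mono' (hFm n).aestronglyMeasurable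
        (Eventually.of_forall (hFb n))).indicator (measurableSet_gridCell n k)
  simp only [hsum]
  refine tendsto_integral_of_dominated_convergence g (fun n => ?_) hg (fun n => ?_) ?_
  · refine StronglyMeasurable.aestronglyMeasurable (StronglyMeasurable.ite ?_ (hFm n)
      stronglyMeasurable_const)
    exact (Int.measurable_floor.comp (measurable_const_mul _))
      (Finset.measurableSet (gridIndex n))
  · refine Eventually.of_forall fun x => ?_
    split_ifs
    · exact hFb n x
    · rw [norm_zero]
      exact (norm_nonneg _).trans (hGg x x)
  · refine Eventually.of_forall fun x => (hFlim x).congr' ?_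
    filter_upwards [eventually_floor_mem_gridIndex x] with n hn
    rw [if_pos hn]

/-- The normalised indicator function of a grid cell. -/
noncomputable def gridVec (n : ℕ) (k : ℤ) : ModeSpace :=
  indicatorConstLp 2 (measurableSet_gridCell n k) (volume_gridCell_ne_top n k)
    (Real.sqrt (n + 1 : ℕ) : ℂ)

theorem sqrt_natCast_mul_self (n : ℕ) : (Real.sqrt n : ℂ) * Real.sqrt n = n := by
  rw [← Complex.ofReal_mul, Real.mul_self_sqrt (Nat.cast_nonneg n), Complex.ofReal_natCast]

theorem inner_gridVec (n : ℕ) (k : ℤ) (f : ModeSpace) :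
    ⟪gridVec n k, f⟫_ℂ = (Real.sqrt (n + 1 : ℕ) : ℂ) * ∫ x in gridCell n k, f x := by
  rw [gridVec, L2.inner_indicatorConstLp_eq_inner_setIntegral, RCLike.inner_apply,
    Complex.conj_ofReal, mul_comm]

theorem coeFn_gridVec (n : ℕ) (k : ℤ) : (gridVec n k : ℝ → ℂ) =ᵐ[volume]
    (gridCell n k).indicator fun _ => (Real.sqrt (n + 1 : ℕ) : ℂ) :=
  indicatorConstLp_coeFn

theorem orthonormal_gridVec (n : ℕ) : Orthonormal ℂ (gridVec n) := by
  rw [orthonormal_iff_ite]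
  intro i j
  rw [inner_gridVec, setIntegral_congr_ae (g := (gridCell n j).indicator fun _ =>
    (Real.sqrt (n + 1 : ℕ) : ℂ)) (measurableSet_gridCell n i)
    ((coeFn_gridVec n j).mono fun x hx _ => hx),
    setIntegral_indicator (measurableSet_gridCell n j), setIntegral_const]
  split_ifs with h
  · subst h
    have hpos : (0 : ℝ) < (n + 1 : ℕ) := by positivity
    rw [inter_self, measureReal_def, volume_gridCell, ENNReal.toReal_ofReal (by positivity),
      Complex.real_smul, mul_left_comm, sqrt_natCast_mul_self]
    push_cast
    have : (n : ℂ) + 1 ≠ 0 := Nat.cast_add_one_ne_zero n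
    field_simp
  · have : gridCell n i ∩ gridCell n j = ∅ := by
      ext x
      simp only [gridCell, mem_inter_iff, mem_ofPred_eq, mem_empty_iff_false, iff_false, not_and]
      rintro h1 h2
      exact h (h1.symm.trans h2)
    simp [this]

/-- The orthogonal projection onto the step functions on the `n`-th grid. -/
noncomputable def gridProj (n : ℕ) : ModeSpace →L[ℂ] ModeSpace :=
  ∑ k ∈ gridIndex n, (innerSL ℂ (gridVec n k)).smulRight (gridVec n k)

theorem gridProj_apply (n : ℕ) (f : ModeSpace) :
    gridProj n f = ∑ k ∈ gridIndex n, ⟪gridVec n k, f⟫_ℂ • gridVec n k := by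
  simp [gridProj]

theorem inner_gridProj (n : ℕ) (f g : ModeSpace) :
    ⟪f, gridProj n g⟫_ℂ = ∑ k ∈ gridIndex n, ⟪f, gridVec n k⟫_ℂ * ⟪gridVec n k, g⟫_ℂ := by
  rw [gridProj_apply, inner_sum]
  refine Finset.sum_congr rfl fun k _ => ?_
  rw [inner_smul_right, mul_comm]

theorem norm_gridProj_sq (n : ℕ) (f : ModeSpace) :
    ((‖gridProj n f‖ ^ 2 : ℝ) : ℂ) = ⟪f, gridProj n f⟫_ℂ := by
  rw [inner_gridProj]
  have h1 := (orthonormal_gridVec n).inner_sum (fun k => ⟪gridVec n k, f⟫_ℂ)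
    (fun k => ⟪gridVec n k, f⟫_ℂ) (gridIndex n)
  rw [← gridProj_apply, inner_self_eq_norm_sq_to_K] at h1
  rw [Complex.ofReal_pow]
  refine h1.trans (Finset.sum_congr rfl fun k _ => ?_)
  rw [inner_conj_symm]

theorem norm_gridProj_le (n : ℕ) (f : ModeSpace) : ‖gridProj n f‖ ≤ ‖f‖ := by
  have h1 : ‖gridProj n f‖ ^ 2 ≤ ‖f‖ * ‖gridProj n f‖ := by
    have h2 := norm_inner_le_norm (𝕜 := ℂ) f (gridProj n f)
    rwa [← norm_gridProj_sq, Complex.norm_real, Real.norm_of_nonneg (by positivity)] at h2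
  by_contra! hlt
  have := norm_nonneg f
  nlinarith

theorem norm_sub_gridProj_sq (n : ℕ) (f : ModeSpace) :
    ‖f - gridProj n f‖ ^ 2 = ‖f‖ ^ 2 - (⟪f, gridProj n f⟫_ℂ).re := by
  rw [@norm_sub_sq ℂ]
  have h := congrArg Complex.re (norm_gridProj_sq n f)
  rw [Complex.ofReal_re] at h
  rw [h]
  simp only [RCLike.re_to_complex]
  ring

theorem tendsto_gridProj_of_hasCompactSupport {f : ℝ → ℂ} (hf : MemLp f 2 volume)
    (hc : Continuous f) (hs : HasCompactSupport f) :
    Tendsto (fun n => gridProj n (hf.toLp f)) atTop (𝓝 (hf.toLp f)) := by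
  obtain ⟨C, hC⟩ := hc.bounded_above_of_compact_support hs
  have h1 := tendsto_sum_gridCell (G := fun p => conj (f p.1) * f p.2) (by fun_prop)
    (g := fun x => ‖f x‖ * C) ((hc.integrable_of_hasCompactSupport hs).norm.mul_const C)
    fun x y => by
      rw [norm_mul, RCLike.norm_conj]
      exact mul_le_mul_of_nonneg_left (hC y) (norm_nonneg _)
  have h2 : ∀ n : ℕ, ∑ k ∈ gridIndex n, ∫ x in gridCell n k, ((n + 1 : ℕ) : ℂ) *
      ∫ y in gridCell n k, conj (f x) * f y = ⟪hf.toLp f, gridProj n (hf.toLp f)⟫_ℂ := fun n => by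
    rw [inner_gridProj]
    refine Finset.sum_congr rfl fun k _ => ?_
    rw [← inner_conj_symm, inner_gridVec, setIntegral_congr_ae (g := f)
      (measurableSet_gridCell n k) (hf.coeFn_toLp.mono fun x hx _ => hx), map_mul,
      Complex.conj_ofReal, ← integral_conj, mul_mul_mul_comm, sqrt_natCast_mul_self]
    simp only [integral_const_mul, integral_mul_const]
  have h3 : ∫ x, conj (f x) * f x = ((‖hf.toLp f‖ ^ 2 : ℝ) : ℂ) := by
    have h4 := inner_toLp hf hf
    rw [inner_self_eq_norm_sq_to_K] at h4
    rw [Complex.ofReal_pow]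
    refine (h4.trans ?_).symm
    simp only [mul_comm]
  simp only [h2, h3] at h1
  have h5 := (Complex.continuous_re.tendsto _).comp h1
  rw [Complex.ofReal_re] at h5
  have h6 : Tendsto (fun n => ‖hf.toLp f - gridProj n (hf.toLp f)‖ ^ 2) atTop (𝓝 0) := by
    simp only [norm_sub_gridProj_sq]
    rw [← sub_self (‖hf.toLp f‖ ^ 2)]
    exact tendsto_const_nhds.sub h5
  rw [tendsto_iff_norm_sub_tendsto_zero]
  have h7 := h6.sqrt
  simp only [Real.sqrt_sq (norm_nonneg _), Real.sqrt_zero] at h7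
  simpa only [norm_sub_rev] using h7

/-- The grid projections converge strongly to the identity. -/
theorem tendsto_gridProj (f : ModeSpace) : Tendsto (fun n => gridProj n f) atTop (𝓝 f) := by
  rw [Metric.tendsto_atTop]
  intro ε hε
  obtain ⟨g, hgs, hfg, hgc, hg⟩ := (Lp.memLp f).exists_hasCompactSupport_eLpNorm_sub_le
    ENNReal.ofNat_ne_top (ε := ENNReal.ofReal (ε / 4)) (by simpa using hε)
  have hfg' : ‖f - hg.toLp g‖ ≤ ε / 4 := by
    have e : f - hg.toLp g = ((Lp.memLp f).sub hg).toLp _ := by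
      rw [MemLp.toLp_sub (Lp.memLp f) hg, Lp.toLp_coeFn]
    rw [e, Lp.norm_toLp]
    exact ENNReal.toReal_le_of_le_ofReal (by positivity) hfg
  obtain ⟨N, hN⟩ := Metric.tendsto_atTop.mp (tendsto_gridProj_of_hasCompactSupport hg hgc hgs)
    (ε / 4) (by positivity)
  refine ⟨N, fun n hn => ?_⟩
  have h1 : gridProj n f - f = gridProj n (f - hg.toLp g) +
      (gridProj n (hg.toLp g) - hg.toLp g) - (f - hg.toLp g) := by
    rw [map_sub]
    abel
  have h2 := norm_gridProj_le n (f - hg.toLp g)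
  have h3 := hN n hn
  rw [dist_eq_norm] at h3 ⊢
  rw [h1]
  have h4 := norm_sub_le (gridProj n (f - hg.toLp g) + (gridProj n (hg.toLp g) - hg.toLp g))
    (f - hg.toLp g)
  have h5 := norm_add_le (gridProj n (f - hg.toLp g)) (gridProj n (hg.toLp g) - hg.toLp g)
  linarith

theorem inner_gridVec_of_isKernel {A : ModeSpace →L[ℂ] ModeSpace} {K : ℝ × ℝ → ℂ}
    (hA : IsKernel A K) (n : ℕ) (k : ℤ) :
    ⟪gridVec n k, A (gridVec n k)⟫_ℂ =
      ∫ x in gridCell n k, ((n + 1 : ℕ) : ℂ) * ∫ y in gridCell n k, K (x, y) := by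
  have h1 : ∀ x, ∫ y, K (x, y) * gridVec n k y =
      (Real.sqrt (n + 1 : ℕ) : ℂ) * ∫ y in gridCell n k, K (x, y) := fun x => by
    rw [← integral_indicator (measurableSet_gridCell n k), ← integral_const_mul]
    refine integral_congr_ae ((coeFn_gridVec n k).mono fun y hy => ?_)
    simp only
    rw [hy]
    by_cases hyk : y ∈ gridCell n k
    · simp only [indicator_of_mem hyk]
      ring
    · simp only [indicator_of_notMem hyk, mul_zero]
  rw [inner_gridVec, setIntegral_congr_ae (measurableSet_gridCell n k)
    ((hA (gridVec n k)).mono fun x hx _ => hx), ← integral_const_mul]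
  simp only [h1, ← mul_assoc, sqrt_natCast_mul_self]

/-- The trace of a trace-class operator with a continuous, suitably bounded kernel is the integral
of the kernel over the diagonal. The diagonal is a null set, so the kernel has to be averaged over
the squares of a finer and finer grid. -/
theorem opTrace_eq_integral_diagonal {ρ B : ModeSpace →L[ℂ] ModeSpace} {ψ : ℕ → ModeSpace}
    (hψ : IsEnsemble ρ ψ) (hs : Summable fun i => ‖ψ i‖ ^ 2) {K : ℝ × ℝ → ℂ}
    (hA : IsKernel (B ∘L ρ) K) (hK : Continuous K) {g : ℝ → ℝ} (hg : Integrable g)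
    (hKg : ∀ x y, ‖K (x, y)‖ ≤ g x) : opTrace (B ∘L ρ) = ∫ x, K (x, x) := by
  have h1 := tendsto_sum_gridCell hK hg hKg
  -- The trace of the operator compressed to a grid is a sum of averages of the kernel.
  have h2 : ∀ n : ℕ, ∑' i, ⟪ψ i, gridProj n (B (ψ i))⟫_ℂ = ∑ k ∈ gridIndex n,
      ∫ x in gridCell n k, ((n + 1 : ℕ) : ℂ) * ∫ y in gridCell n k, K (x, y) := fun n => by
    refine HasSum.tsum_eq ?_
    simp only [inner_gridProj]
    refine hasSum_sum fun k _ => ?_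
    refine ((hψ (gridVec n k)).mapL (innerSL ℂ (gridVec n k) ∘L B)).congr_eq (fun i => ?_) ?_
    · simp only [ContinuousLinearMap.comp_apply, map_smul, innerSL_apply_apply, smul_eq_mul]
    · rw [← inner_gridVec_of_isKernel hA]
      rfl
  -- The ensemble makes the traces of the compressions converge, by dominated convergence.
  have h3 : Tendsto (fun n => ∑' i, ⟪ψ i, gridProj n (B (ψ i))⟫_ℂ) atTop
      (𝓝 (∑' i, ⟪ψ i, B (ψ i)⟫_ℂ)) := by
    refine tendsto_tsum_of_dominated_convergence (bound := fun i => ‖B‖ * ‖ψ i‖ ^ 2)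
      (hs.mul_left _) (fun i => ?_) (Eventually.of_forall fun n i => ?_)
    · exact tendsto_const_nhds.inner (tendsto_gridProj _)
    · refine (norm_inner_le_norm _ _).trans ?_
      have h4 := (norm_gridProj_le n (B (ψ i))).trans (B.le_opNorm (ψ i))
      have h5 := mul_le_mul_of_nonneg_left h4 (norm_nonneg (ψ i))
      linarith
  simp only [h2] at h3
  rw [← (hψ.hasSum_opTrace hs B).tsum_eq]
  exact tendsto_nhds_unique h3 h1

/-! ### Schwartz kernels: traces and decay -/

namespace SchwartzMap

/-- Decay along the diagonal and away from it. -/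
theorem exists_norm_le_inv_mul_inv (K : 𝓢(ℝ × ℝ, ℂ)) : ∃ C : ℝ, ∀ x y : ℝ,
    ‖K (x, y)‖ ≤ C * (1 + x ^ 2)⁻¹ * (1 + (y - x) ^ 2)⁻¹ := by
  refine ⟨4 * (2 ^ 4 * (Finset.Iic (4, 0)).sup (fun m => SchwartzMap.seminorm ℝ m.1 m.2) K),
    fun x y => ?_⟩
  have h1 : (1 + ‖(x, y)‖) ^ 4 * _ ≤ 2 ^ 4 * _ :=
    one_add_le_sup_seminorm_apply (𝕜 := ℝ) (m := (4, 0)) le_rfl le_rfl K (x, y)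
  rw [norm_iteratedFDeriv_zero] at h1
  set n := ‖(x, y)‖
  have hx : |x| ≤ n := norm_fst_le (x, y)
  have hy : |y| ≤ n := norm_snd_le (x, y)
  have hn : 0 ≤ n := norm_nonneg _
  have h2 : 1 + x ^ 2 ≤ (1 + n) ^ 2 := by
    have : x ^ 2 ≤ n ^ 2 := sq_le_sq.mpr (by rwa [abs_of_nonneg hn])
    nlinarith
  have h3 : 1 + (y - x) ^ 2 ≤ 4 * (1 + n) ^ 2 := by
    have : (y - x) ^ 2 ≤ (2 * n) ^ 2 := by
      refine sq_le_sq.mpr ?_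
      rw [abs_of_nonneg (a := 2 * n) (by positivity)]
      have := abs_sub y x
      linarith
    nlinarith
  have h4 : (1 + x ^ 2) * (1 + (y - x) ^ 2) ≤ 4 * (1 + n) ^ 4 := by
    refine (mul_le_mul h2 h3 (by positivity) (by positivity)).trans_eq ?_
    ring
  rw [mul_assoc, ← mul_inv, ← div_eq_mul_inv, le_div_iff₀ (by positivity)]
  have h5 := mul_le_mul_of_nonneg_left h4 (norm_nonneg (K (x, y)))
  have h6 := mul_le_mul_of_nonneg_left h1 (zero_le_four (α := ℝ))
  linarith

theorem integrable_shear (K : 𝓢(ℝ × ℝ, ℂ)) (c : ℝ) : Integrable fun y => K (y, y + c) := by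
  obtain ⟨C, hC⟩ := K.exists_norm_le_inv_mul_inv
  refine ((integrable_inv_one_add_sq.const_mul C).mul_const (1 + c ^ 2)⁻¹).mono'
    (by have := K.continuous; fun_prop) (Eventually.of_forall fun y => ?_)
  simpa using hC y (y + c)

theorem hasDerivAt_shear (K : 𝓢(ℝ × ℝ, ℂ)) (c y : ℝ) :
    HasDerivAt (fun y => K (y, y + c)) (LineDeriv.lineDerivOp ((1, 1) : ℝ × ℝ) K (y, y + c)) y := by
  rw [lineDerivOp_apply_eq_fderiv]
  exact (K.hasFDerivAt (y, y + c)).comp_hasDerivAt y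
    ((hasDerivAt_id y).prodMk ((hasDerivAt_id y).add_const c))

end SchwartzMap

/-- The Fourier transform of a kernel along the line `y ↦ (y, y + c)`. -/
noncomputable def shearFourier (K : ℝ × ℝ → ℂ) (ξ c : ℝ) : ℂ :=
  ∫ y : ℝ, Complex.exp (Complex.I * (ξ * y : ℝ)) * K (y, y + c)

theorem SchwartzMap.integrable_exp_mul_shear (K : 𝓢(ℝ × ℝ, ℂ)) (ξ c : ℝ) :
    Integrable fun y : ℝ => Complex.exp (Complex.I * (ξ * y : ℝ)) * K (y, y + c) :=
  (K.integrable_shear c).bdd_mul (c := 1) (by fun_prop)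
    (Eventually.of_forall fun y => (norm_exp_I_mul_ofReal _).le)

/-- Integration by parts along the line. -/
theorem shearFourier_lineDerivOp (K : 𝓢(ℝ × ℝ, ℂ)) (ξ c : ℝ) :
    shearFourier (LineDeriv.lineDerivOp ((1, 1) : ℝ × ℝ) K) ξ c =
      -(Complex.I * ξ) * shearFourier K ξ c := by
  have hu : ∀ y : ℝ, HasDerivAt (fun y : ℝ => Complex.exp (Complex.I * (ξ * y : ℝ)))
      (Complex.I * ξ * Complex.exp (Complex.I * (ξ * y : ℝ))) y := fun y => by
    have h1 : HasDerivAt (fun y : ℝ => Complex.I * ((ξ * y : ℝ) : ℂ)) (Complex.I * ξ) y := by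
      have := ((hasDerivAt_id y).const_mul ξ).ofReal_comp.const_mul Complex.I
      simpa using this
    simpa only [mul_comm] using h1.cexp
  have h := integral_mul_deriv_eq_deriv_mul_of_integrable
    (u := fun y : ℝ => Complex.exp (Complex.I * (ξ * y : ℝ))) (v := fun y => K (y, y + c))
    (fun y _ => hu y) (fun y _ => K.hasDerivAt_shear c y)
    ((LineDeriv.lineDerivOp ((1, 1) : ℝ × ℝ) K).integrable_exp_mul_shear ξ c)
    (((K.integrable_exp_mul_shear ξ c).const_mul (Complex.I * ξ)).congr
      (Eventually.of_forall fun y => (mul_assoc _ _ _).symm))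
    (K.integrable_exp_mul_shear ξ c)
  rw [shearFourier, h, shearFourier, neg_mul, ← integral_const_mul]
  simp only [mul_assoc]

/-- The decay in `c` is that of the kernel away from the diagonal, and the decay in `ξ` comes from
two derivatives along the line. -/
theorem exists_norm_shearFourier_le (K : 𝓢(ℝ × ℝ, ℂ)) : ∃ C : ℝ, ∀ ξ c : ℝ,
    ‖shearFourier K ξ c‖ ≤ C * ((1 + ξ ^ 2)⁻¹ * (1 + c ^ 2)⁻¹) := by
  have h1 : ∀ K : 𝓢(ℝ × ℝ, ℂ), ∃ C : ℝ, ∀ ξ c : ℝ,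
      ‖shearFourier K ξ c‖ ≤ C * (1 + c ^ 2)⁻¹ := fun K => by
    obtain ⟨C, hC⟩ := K.exists_norm_le_inv_mul_inv
    refine ⟨C * Real.pi, fun ξ c => ?_⟩
    have hi : Integrable fun y : ℝ => C * (1 + y ^ 2)⁻¹ * (1 + c ^ 2)⁻¹ :=
      (integrable_inv_one_add_sq.const_mul C).mul_const _
    refine (norm_integral_le_of_norm_le hi (Eventually.of_forall fun y => ?_)).trans_eq ?_
    · rw [norm_mul, norm_exp_I_mul_ofReal, one_mul]
      simpa using hC y (y + c)
    · rw [integral_mul_const, integral_const_mul, integral_univ_inv_one_add_sq]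
  obtain ⟨C, hC⟩ := h1 K
  obtain ⟨C', hC'⟩ :=
    h1 (LineDeriv.lineDerivOp ((1, 1) : ℝ × ℝ) (LineDeriv.lineDerivOp ((1, 1) : ℝ × ℝ) K))
  refine ⟨C + C', fun ξ c => ?_⟩
  have h2 := hC ξ c
  have h3 := hC' ξ c
  have h4 : ‖shearFourier (LineDeriv.lineDerivOp ((1, 1) : ℝ × ℝ)
      (LineDeriv.lineDerivOp ((1, 1) : ℝ × ℝ) K)) ξ c‖ = ξ ^ 2 * ‖shearFourier K ξ c‖ := by
    rw [shearFourier_lineDerivOp, shearFourier_lineDerivOp, ← mul_assoc, norm_mul]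
    congr 1
    rw [norm_mul, norm_neg, norm_mul, Complex.norm_I, one_mul, Complex.norm_real,
      Real.norm_eq_abs, ← sq, sq_abs]
  rw [h4] at h3
  rw [mul_left_comm, mul_comm, ← div_eq_mul_inv, le_div_iff₀ (by positivity)]
  linarith

theorem isKernel_displacement_comp {ρ : ModeSpace →L[ℂ] ModeSpace} {K : ℝ × ℝ → ℂ}
    (hρ : IsKernel ρ K) (x₀ p : ℝ) : IsKernel (displacement x₀ p ∘L ρ) fun z =>
      Complex.exp (Complex.I * (p * z.1 - x₀ * p / 2 : ℝ)) * K (z.1 - x₀, z.2) := by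
  intro f
  refine ((coeFn_displacement x₀ p (ρ f)).trans (displacementFun_congr x₀ p (hρ f))).trans
    (Eventually.of_forall fun x => ?_)
  rw [displacementFun_apply, ← integral_const_mul]
  simp only [mul_assoc]

theorem IsDensityOperator.opTrace_displacement_comp {ρ : ModeSpace →L[ℂ] ModeSpace}
    (hρ : IsDensityOperator ρ) {K : 𝓢(ℝ × ℝ, ℂ)} (hK : IsKernel ρ K) (x₀ p : ℝ) :
    opTrace (displacement x₀ p ∘L ρ) =
      Complex.exp (Complex.I * (x₀ * p / 2 : ℝ)) * shearFourier K p x₀ := by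
  obtain ⟨ψ, hψ⟩ := hρ.exists_isEnsemble
  obtain ⟨C, hC⟩ := K.exists_norm_le_inv_mul_inv
  have hC0 : 0 ≤ C := by
    have := (norm_nonneg _).trans (hC 0 0)
    simpa using this
  rw [opTrace_eq_integral_diagonal hψ (hψ.summable_norm_sq modeBasis hρ.2.summable)
    (isKernel_displacement_comp hK x₀ p) (g := fun x => C * (1 + (x - x₀) ^ 2)⁻¹)
    (by have := K.continuous; fun_prop)
    ((integrable_inv_one_add_sq.comp_sub_right x₀).const_mul C)]
  · rw [← integral_add_right_eq_self _ x₀, shearFourier, ← integral_const_mul]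
    refine integral_congr_ae (Eventually.of_forall fun y => ?_)
    simp only [add_sub_cancel_right]
    rw [← mul_assoc, ← Complex.exp_add]
    congr 2
    push_cast
    ring
  · intro x y
    rw [norm_mul, norm_exp_I_mul_ofReal, one_mul]
    refine (hC _ _).trans (mul_le_of_le_one_right (by positivity) ?_)
    exact inv_le_one_of_one_le₀ (by nlinarith [sq_nonneg (y - (x - x₀))])

/-- The coefficients of the Zak–Gross series of a state with a Schwartz kernel. -/
theorem IsDensityOperator.zakGrossTerm_zero_eq {ρ : ModeSpace →L[ℂ] ModeSpace}
    (hρ : IsDensityOperator ρ) {K : 𝓢(ℝ × ℝ, ℂ)} (hK : IsKernel ρ K) (d : ℕ) [NeZero d] {h : ℤ}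
    (hh : 2 * h = d + 1) (k : ℤ × ℤ) :
    zakGrossTerm d ρ 0 k = 1 / (2 * Real.pi) *
      ((ZMod.stdAddChar ((k.1 * k.2 * h : ℤ) : ZMod d) : ℂ) *
        shearFourier K (k.1 * step d) (k.2 * step d)) := by
  rw [zakGrossTerm_zero, hρ.opTrace_displacement_comp hK, ← neg_one_zpow_mul_exp d hh,
    show (k.2 * step d * (k.1 * step d) / 2 : ℝ) = k.1 * k.2 * step d * step d / 2 by ring]
  simp only [mul_assoc]

theorem IsDensityOperator.summable_zakGrossTerm {ρ : ModeSpace →L[ℂ] ModeSpace}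
    (hρ : IsDensityOperator ρ) {K : 𝓢(ℝ × ℝ, ℂ)} (hK : IsKernel ρ K) (d : ℕ) [NeZero d] {h : ℤ}
    (hh : 2 * h = d + 1) (z : ℝ × ℝ) : Summable (zakGrossTerm d ρ z) := by
  obtain ⟨C, hC⟩ := exists_norm_shearFourier_le K
  have h1 := summable_inv_one_add_sq (step_pos d).ne'
  have h2 := (h1.mul_of_nonneg h1 (fun n => by positivity) fun n => by positivity).mul_left
    (‖(1 / (2 * Real.pi) : ℂ)‖ * C)
  refine Summable.of_norm_bounded h2 fun k => ?_
  rw [zakGrossTerm_eq, norm_mul, norm_exp_I_mul_ofReal, mul_one,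
    hρ.zakGrossTerm_zero_eq hK d hh, norm_mul, norm_mul, norm_stdAddChar, one_mul, mul_assoc]
  refine mul_le_mul_of_nonneg_left ?_ (norm_nonneg _)
  have := hC (k.1 * step d) (k.2 * step d)
  simpa only [mul_comm (step d)] using this

/-! ### Poisson summation -/

/-- The restriction of a kernel to the line `x ↦ (c - L x, c - L x + e)`. The sign of `x` makes the
Fourier mode `m` carry the phase `e^{-imκc}` of the Zak–Gross series. -/
noncomputable def SchwartzMap.lineRestrict (K : 𝓢(ℝ × ℝ, ℂ)) {L : ℝ} (hL : L ≠ 0) (c e : ℝ) :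
    𝓢(ℝ, ℂ) :=
  SchwartzMap.compCLM ℝ (g := fun x : ℝ => (c - L * x, c - L * x + e))
    (by
      have h : (fun x : ℝ => (c - L * x, c - L * x + e)) =
          fun x : ℝ => (c, c + e) + x • (-L, -L) := by
        ext x <;> simp <;> ring
      rw [h]
      fun_prop)
    ⟨1, |L|⁻¹ * (1 + |c|), fun x => by
      set n := ‖(c - L * x, c - L * x + e)‖
      have hn : 0 ≤ n := norm_nonneg _
      have h1 : |c - L * x| ≤ n := norm_fst_le (c - L * x, c - L * x + e)
      have h2 : |L| * |x| ≤ |c| + |c - L * x| := by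
        rw [← abs_mul]
        calc |L * x| = |c - (c - L * x)| := by rw [sub_sub_cancel]
          _ ≤ _ := abs_sub _ _
      have h3 := abs_nonneg c
      rw [Real.norm_eq_abs, mul_assoc, ← div_eq_inv_mul, le_div_iff₀ (abs_pos.mpr hL), pow_one]
      nlinarith⟩ K

theorem SchwartzMap.lineRestrict_apply (K : 𝓢(ℝ × ℝ, ℂ)) {L : ℝ} (hL : L ≠ 0) (c e x : ℝ) :
    K.lineRestrict hL c e x = K (c - L * x, c - L * x + e) := rfl

theorem fourier_lineRestrict (K : 𝓢(ℝ × ℝ, ℂ)) {L κ : ℝ} (hL : 0 < L) (hκ : κ * L = 2 * Real.pi)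
    (c e : ℝ) (m : ℤ) :
    FourierTransform.fourier (K.lineRestrict hL.ne' c e) (m : ℝ) =
      (L : ℂ)⁻¹ * (Complex.exp (Complex.I * (-(m * κ * c) : ℝ)) *
        shearFourier K (m * κ) e) := by
  rw [SchwartzMap.fourier_coe, Real.fourier_real_eq_integral_exp_smul]
  obtain ⟨F, hF⟩ : ∃ F : ℝ → ℂ, ∀ y, F y = Complex.exp (Complex.I * (-(m * κ * c) : ℝ)) *
      (Complex.exp (Complex.I * (m * κ * y : ℝ)) * K (y, y + e)) := ⟨_, fun _ => rfl⟩
  have h1 := Measure.integral_comp_mul_left (fun y => F (c - y)) L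
  rw [integral_sub_left_eq_self F volume c, abs_of_pos (inv_pos.mpr hL)] at h1
  rw [shearFourier, ← integral_const_mul]
  simp only [← hF]
  rw [← Complex.ofReal_inv, ← Complex.real_smul, ← h1]
  refine integral_congr_ae (Eventually.of_forall fun x => ?_)
  simp only [hF, SchwartzMap.lineRestrict_apply, smul_eq_mul]
  rw [← mul_assoc, ← Complex.exp_add]
  congr 2
  have h2 : (κ * L : ℂ) = 2 * Real.pi := by exact_mod_cast hκ
  push_cast
  linear_combination (Complex.I * m * x) * h2

/-- Poisson summation along a diagonal line. -/
theorem tsum_exp_mul_shearFourier (K : 𝓢(ℝ × ℝ, ℂ)) {L κ : ℝ} (hL : 0 < L)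
    (hκ : κ * L = 2 * Real.pi) (c e : ℝ) :
    ∑' m : ℤ, Complex.exp (Complex.I * (-(m * κ * c) : ℝ)) * shearFourier K (m * κ) e =
      L * ∑' k : ℤ, K (c - L * k, c - L * k + e) := by
  have h := (K.lineRestrict hL.ne' c e).tsum_eq_tsum_fourier 0
  simp only [fourier_lineRestrict K hL hκ, SchwartzMap.lineRestrict_apply, zero_add] at h
  rw [h, ← tsum_mul_left]
  refine tsum_congr fun m => ?_
  have hL' : (L : ℂ) ≠ 0 := Complex.ofReal_ne_zero.mpr hL.ne'
  simp only [QuotientAddGroup.mk_zero, fourier_eval_zero, mul_one]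
  rw [mul_inv_cancel_left₀ hL']

theorem summable_inv_one_add_sq_add {κ : ℝ} (hκ : κ ≠ 0) (u : ℝ) :
    Summable fun n : ℤ => (1 + (u + n * κ) ^ 2)⁻¹ := by
  refine Summable.of_nonneg_of_le (fun n => by positivity) (fun n => ?_)
    ((summable_inv_one_add_sq hκ).mul_left (2 * (1 + u ^ 2)))
  rw [← div_eq_mul_inv, le_div_iff₀ (by positivity), ← div_eq_inv_mul,
    div_le_iff₀ (by positivity)]
  nlinarith [sq_nonneg (2 * u + n * κ), mul_nonneg (sq_nonneg u) (sq_nonneg (u + n * κ))]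

/-- The samples of `K` on the lattice `(u,u) + ℓℤ²`, with the phase of a shift by `v` in
momentum. -/
noncomputable def latticeSample (d : ℕ) (K : ℝ × ℝ → ℂ) (z : ℝ × ℝ) (p : ℤ × ℤ) : ℂ :=
  Complex.exp (Complex.I * (step d * (p.2 - p.1) * z.2 : ℝ)) *
    K (z.1 + p.1 * step d, z.1 + p.2 * step d)

theorem summable_latticeSample (d : ℕ) [NeZero d] (K : 𝓢(ℝ × ℝ, ℂ)) (z : ℝ × ℝ) :
    Summable (latticeSample d K z) := by
  obtain ⟨C, hC⟩ := K.exists_norm_le_inv_mul_inv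
  have h1 := (summable_inv_one_add_sq_add (step_pos d).ne' z.1).mul_of_nonneg
    (summable_inv_one_add_sq_add (step_pos d).ne' 0) (fun n => by positivity)
    fun n => by positivity
  let e : ℤ × ℤ ≃ ℤ × ℤ :=
    { toFun := fun p => (p.1, p.2 - p.1)
      invFun := fun p => (p.1, p.2 + p.1)
      left_inv := fun p => by simp
      right_inv := fun p => by simp }
  refine Summable.of_norm_bounded ((e.summable_iff.mpr h1).mul_left C) fun p => ?_
  rw [latticeSample, norm_mul, norm_exp_I_mul_ofReal, one_mul]
  refine (hC _ _).trans_eq ?_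
  have e1 : z.1 + p.2 * step d - (z.1 + p.1 * step d) = 0 + ((p.2 - p.1 : ℤ) : ℝ) * step d := by
    push_cast
    ring
  rw [e1, mul_assoc]
  rfl

/-- The change of summation variables from a shift `n` and a period `k` to the row
`r = -kd - nh` and the antidiagonal `r + q = d k'` on which the sample `(r, q) = (r, r + n)` lies.
It is a bijection because `h` inverts `2` modulo `d`, which is where `d` has to be odd. -/
def antidiagonalEquiv (d : ℕ) [NeZero d] (h : ℤ) (hh : 2 * h = d + 1) : ℤ × ℤ ≃ ℤ × ℤ where
  toFun p := (-(p.2 * d) - p.1 * h, -(2 * p.2) - p.1)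
  invFun p := (d * p.2 - 2 * p.1, p.1 - p.2 * h)
  left_inv p := by
    ext
    · simp only
      linear_combination p.1 * hh
    · simp only
      linear_combination (p.2) * hh
  right_inv p := by
    ext
    · simp only
      linear_combination p.1 * hh
    · simp only
      linear_combination p.2 * hh

theorem summable_latticeSample_antidiagonal (d : ℕ) [NeZero d] (K : 𝓢(ℝ × ℝ, ℂ)) (z : ℝ × ℝ) :
    Summable fun p : ℤ × ℤ => latticeSample d K z (p.1, d * p.2 - p.1) :=
  (summable_latticeSample d K z).comp_injective
    (i := fun p : ℤ × ℤ => (p.1, d * p.2 - p.1)) fun p q hpq => by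
      have hd : (d : ℤ) ≠ 0 := Nat.cast_ne_zero.mpr (NeZero.ne d)
      simp only [Prod.mk.injEq] at hpq
      obtain ⟨h1, h2⟩ := hpq
      rw [h1, sub_left_inj] at h2
      exact Prod.ext h1 (mul_left_cancel₀ hd h2)

/-- The Zak–Gross Wigner function as a sum of the kernel over antidiagonals of a lattice. -/
theorem IsDensityOperator.zakGrossWigner_eq {ρ : ModeSpace →L[ℂ] ModeSpace}
    (hρ : IsDensityOperator ρ) {K : 𝓢(ℝ × ℝ, ℂ)} (hK : IsKernel ρ K) (d : ℕ) [NeZero d] {h : ℤ}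
    (hh : 2 * h = d + 1) (z : ℝ × ℝ) :
    zakGrossWigner d ρ z =
      (step d : ℂ)⁻¹ * ∑' p : ℤ × ℤ, latticeSample d K z (p.1, d * p.2 - p.1) := by
  have hpos := step_pos d
  have hL : 0 < d * step d := by
    have : (0 : ℝ) < d := Nat.cast_pos.mpr (Nat.pos_of_ne_zero (NeZero.ne d))
    positivity
  have hterm : ∀ m n : ℤ, zakGrossTerm d ρ z (m, n) =
      1 / (2 * Real.pi) * Complex.exp (Complex.I * (step d * n * z.2 : ℝ)) *
        (Complex.exp (Complex.I * (-(m * step d * (z.1 - n * h * step d)) : ℝ)) *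
          shearFourier K (m * step d) (n * step d)) := fun m n => by
    rw [zakGrossTerm_eq, hρ.zakGrossTerm_zero_eq hK d hh, stdAddChar_intCast]
    have h1 : Complex.exp (Complex.I * ((m * n * h : ℤ) * step d * step d : ℝ)) *
        Complex.exp (Complex.I * (step d * (n * z.2 - m * z.1) : ℝ)) =
        Complex.exp (Complex.I * (step d * n * z.2 : ℝ)) *
          Complex.exp (Complex.I * (-(m * step d * (z.1 - n * h * step d)) : ℝ)) := by
      rw [← Complex.exp_add, ← Complex.exp_add]
      congr 1
      push_cast
      ring
    linear_combination (1 / (2 * Real.pi) * shearFourier K (m * step d) (n * step d)) * h1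
  have hsum := (hρ.summable_zakGrossTerm hK d hh z).prod_symm
  have hS := summable_latticeSample_antidiagonal d K z
  have hS' := (antidiagonalEquiv d h hh).summable_iff.mpr hS
  -- For fixed `n`, the sum over `m` is a Poisson sum on the line through `(c, c + nℓ)`, where
  -- `c = u - nhℓ`.
  have hrow : ∀ n : ℤ, ∑' m : ℤ, zakGrossTerm d ρ z (m, n) = (step d : ℂ)⁻¹ *
      ∑' k : ℤ, latticeSample d K z ((antidiagonalEquiv d h hh (n, k)).1,
        d * (antidiagonalEquiv d h hh (n, k)).2 - (antidiagonalEquiv d h hh (n, k)).1) := fun n => by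
    simp only [hterm]
    rw [tsum_mul_left, tsum_exp_mul_shearFourier K hL (step_mul_cell d), ← tsum_mul_left,
      ← tsum_mul_left, ← tsum_mul_left]
    refine tsum_congr fun k => ?_
    have e1 : (d * (antidiagonalEquiv d h hh (n, k)).2 - (antidiagonalEquiv d h hh (n, k)).1 : ℤ) =
        (antidiagonalEquiv d h hh (n, k)).1 + n := by
      simp only [antidiagonalEquiv, Equiv.coe_fn_mk]
      linear_combination n * hh
    have e2 : z.1 + ((antidiagonalEquiv d h hh (n, k)).1 : ℝ) * step d =
        z.1 - n * h * step d - d * step d * k := by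
      simp only [antidiagonalEquiv, Equiv.coe_fn_mk]
      push_cast
      ring
    rw [e1, latticeSample]
    push_cast
    rw [add_sub_cancel_left, add_mul, ← add_assoc, e2]
    have h3 : (1 / (2 * Real.pi) : ℂ) * (d * step d) = (step d : ℂ)⁻¹ := by
      have h4 : ((step d * (d * step d) : ℝ) : ℂ) = (2 * Real.pi : ℝ) := by
        rw [step_mul_cell]
      have h5 : (step d : ℂ) ≠ 0 := Complex.ofReal_ne_zero.mpr hpos.ne'
      have h6 : (Real.pi : ℂ) ≠ 0 := Complex.ofReal_ne_zero.mpr Real.pi_ne_zero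
      push_cast at h4
      field_simp
      linear_combination h4
    rw [← h3]
    ring
  have h1 : zakGrossWigner d ρ z = ∑' p : ℤ × ℤ, zakGrossTerm d ρ z p.swap :=
    ((Equiv.prodComm ℤ ℤ).tsum_eq _).symm
  rw [h1, hsum.tsum_prod, ← (antidiagonalEquiv d h hh).tsum_eq]
  refine Eq.trans ?_ (congrArg _ hS'.tsum_prod.symm)
  rw [← tsum_mul_left]
  exact tsum_congr hrow

/-! ### Displaced kernels -/

theorem hasTemperateGrowth_exp_I_mul :
    Function.HasTemperateGrowth fun x : ℝ => Complex.exp (Complex.I * x) := by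
  have h1 : ∀ x : ℝ, HasDerivAt (fun x : ℝ => Complex.exp (Complex.I * x))
      (Complex.I * Complex.exp (Complex.I * x)) x := fun x => by
    have h := ((hasDerivAt_id x).ofReal_comp.const_mul Complex.I).cexp
    simpa [mul_comm] using h
  have h2 : ∀ n : ℕ, iteratedDeriv n (fun x : ℝ => Complex.exp (Complex.I * x)) =
      fun x : ℝ => Complex.I ^ n * Complex.exp (Complex.I * x) := fun n => by
    induction n with
    | zero => simp
    | succ n ih =>
      rw [iteratedDeriv_succ, ih]
      ext x
      rw [((h1 x).const_mul (Complex.I ^ n)).deriv]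
      ring
  refine ⟨(contDiff_const.mul Complex.ofRealCLM.contDiff).cexp, fun n => ⟨0, 1, fun x => ?_⟩⟩
  rw [norm_iteratedFDeriv_eq_norm_iteratedDeriv, h2, norm_mul, norm_pow, Complex.norm_I,
    norm_exp_I_mul_ofReal]
  simp

/-- The integral kernel of `D(s,t)† A D(s,t)`, when `K` is the kernel of `A`. -/
noncomputable def displacedKernel (K : 𝓢(ℝ × ℝ, ℂ)) (s t : ℝ) : 𝓢(ℝ × ℝ, ℂ) :=
  SchwartzMap.smulLeftCLM ℂ (fun p : ℝ × ℝ => Complex.exp (Complex.I * (t * (p.2 - p.1) : ℝ)))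
    (K.compSubConstCLM ℂ (-s, -s))

theorem displacedKernel_apply (K : 𝓢(ℝ × ℝ, ℂ)) (s t x y : ℝ) :
    displacedKernel K s t (x, y) =
      Complex.exp (Complex.I * (t * (y - x) : ℝ)) * K (x + s, y + s) := by
  have h : Function.HasTemperateGrowth fun p : ℝ × ℝ =>
      Complex.exp (Complex.I * (t * (p.2 - p.1) : ℝ)) :=
    hasTemperateGrowth_exp_I_mul.comp
      (t • (ContinuousLinearMap.snd ℝ ℝ ℝ - ContinuousLinearMap.fst ℝ ℝ ℝ)).hasTemperateGrowth
  rw [displacedKernel, SchwartzMap.smulLeftCLM_apply_apply h, SchwartzMap.compSubConstCLM_apply,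
    smul_eq_mul]
  simp

theorem IsKernel.displacedKernel {A : ModeSpace →L[ℂ] ModeSpace} {K : 𝓢(ℝ × ℝ, ℂ)}
    (hA : IsKernel A K) (s t : ℝ) :
    IsKernel (ContinuousLinearMap.adjoint (displacement s t) ∘L A ∘L displacement s t)
      (displacedKernel K s t) := by
  intro f
  rw [adjoint_displacement]
  refine (isKernel_displacement_comp hA (-s) (-t) (displacement s t f)).trans
    (Eventually.of_forall fun x => ?_)
  simp only
  rw [← integral_add_right_eq_self _ s]
  have hae : ∀ᵐ y : ℝ, displacement s t f (y + s) =
      Complex.exp (Complex.I * (t * (y + s) - s * t / 2 : ℝ)) * f y := by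
    have h := (measurePreserving_add_right volume s).quasiMeasurePreserving.ae_eq_comp
      (coeFn_displacement s t f)
    filter_upwards [h] with y hy
    have hy' : displacement s t f (y + s) = displacementFun s t f (y + s) := hy
    rw [hy', displacementFun_apply, add_sub_cancel_right]
  refine integral_congr_ae (hae.mono fun y hy => ?_)
  simp only
  rw [hy, displacedKernel_apply, sub_neg_eq_add, mul_mul_mul_comm, ← Complex.exp_add,
    ← mul_assoc]
  have h1 : Complex.exp (Complex.I * (-t * x - -s * -t / 2 : ℝ) +
      Complex.I * (t * (y + s) - s * t / 2 : ℝ)) =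
      Complex.exp (Complex.I * (t * (y - x) : ℝ)) := by
    congr 1
    push_cast
    ring
  rw [← h1]

theorem SchwartzMap.exists_norm_le_inv_snd (K : 𝓢(ℝ × ℝ, ℂ)) : ∃ C : ℝ, ∀ x y : ℝ,
    ‖K (x, y)‖ ≤ C * (1 + y ^ 2)⁻¹ := by
  obtain ⟨C, hC⟩ := K.exists_norm_le_inv_mul_inv
  have hC0 : 0 ≤ C := by
    have := (norm_nonneg _).trans (hC 0 0)
    simpa using this
  refine ⟨C * 2, fun x y => (hC x y).trans ?_⟩
  rw [mul_assoc, mul_assoc]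
  refine mul_le_mul_of_nonneg_left ?_ hC0
  rw [← mul_inv, ← div_eq_mul_inv, le_div_iff₀ (by positivity), ← div_eq_inv_mul,
    div_le_iff₀ (by positivity)]
  nlinarith [sq_nonneg (2 * x - y), mul_nonneg (sq_nonneg x) (sq_nonneg (y - x))]

theorem SchwartzMap.integrable_row_mul (K : 𝓢(ℝ × ℝ, ℂ)) (x : ℝ) {g : ℝ → ℂ} (hg : Continuous g)
    {B : ℝ} (hB : ∀ y, ‖g y‖ ≤ B) : Integrable fun y => K (x, y) * g y := by
  obtain ⟨C, hC⟩ := K.exists_norm_le_inv_snd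
  refine ((integrable_inv_one_add_sq.const_mul C).mul_const B).mono'
    (by have := K.continuous; fun_prop) (Eventually.of_forall fun y => ?_)
  rw [norm_mul]
  exact mul_le_mul (hC x y) (hB y) (norm_nonneg _) ((norm_nonneg _).trans (hC x y))

theorem SchwartzMap.continuous_integral_row_mul (K : 𝓢(ℝ × ℝ, ℂ)) {g : ℝ → ℂ} (hg : Continuous g)
    {B : ℝ} (hB : ∀ y, ‖g y‖ ≤ B) : Continuous fun x => ∫ y, K (x, y) * g y := by
  obtain ⟨C, hC⟩ := K.exists_norm_le_inv_snd
  have hK := K.continuous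
  refine continuous_of_dominated (bound := fun y => C * (1 + y ^ 2)⁻¹ * B)
    (fun x => by fun_prop) (fun x => Eventually.of_forall fun y => ?_)
    ((integrable_inv_one_add_sq.const_mul C).mul_const B)
    (Eventually.of_forall fun y => by fun_prop)
  rw [norm_mul]
  exact mul_le_mul (hC x y) (hB y) (norm_nonneg _) ((norm_nonneg _).trans (hC x y))

/-- A Schwartz kernel is determined by its operator. -/
theorem IsKernel.eq_of_schwartz {A : ModeSpace →L[ℂ] ModeSpace} {K K' : 𝓢(ℝ × ℝ, ℂ)}
    (h : IsKernel A K) (h' : IsKernel A K') : K = K' := by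
  rw [← sub_eq_zero]
  obtain ⟨H, hH⟩ : ∃ H, H = K - K' := ⟨_, rfl⟩
  rw [← hH]
  obtain ⟨C, hC⟩ := H.exists_norm_le_inv_snd
  have hHc := H.continuous
  ext ⟨x₀, y₀⟩
  -- Test against the complex conjugate of the row at `x₀`.
  have hg : Continuous fun y => conj (H (x₀, y)) := by fun_prop
  have hC0 : 0 ≤ C := by
    have := (norm_nonneg _).trans (hC 0 0)
    simpa using this
  have hB : ∀ y, ‖conj (H (x₀, y))‖ ≤ C := fun y => by
    rw [RCLike.norm_conj]
    refine (hC x₀ y).trans (mul_le_of_le_one_right hC0 ?_)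
    exact inv_le_one_of_one_le₀ (by nlinarith [sq_nonneg y])
  have hL : MemLp (fun y => conj (H (x₀, y))) 2 volume := by
    rw [memLp_two_iff_integrable_sq_norm hg.aestronglyMeasurable]
    refine (H.integrable_row_mul x₀ hg hB).norm.congr (Eventually.of_forall fun y => ?_)
    simp only [norm_mul, RCLike.norm_conj, sq]
  have h1 : ∀ G : 𝓢(ℝ × ℝ, ℂ), IsKernel A G →
      A (hL.toLp _) =ᵐ[volume] fun x => ∫ y, G (x, y) * conj (H (x₀, y)) := fun G hG => by
    refine (hG (hL.toLp _)).trans (Eventually.of_forall fun x => ?_)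
    refine integral_congr_ae (hL.coeFn_toLp.mono fun y hy => ?_)
    simp only [hy]
  have h2 : (fun x => ∫ y, H (x, y) * conj (H (x₀, y))) =ᵐ[volume] fun _ => 0 := by
    filter_upwards [h1 K h, h1 K' h'] with x hx hx'
    rw [hx] at hx'
    have hsub : ∀ y, H (x, y) = K (x, y) - K' (x, y) := fun y => by
      rw [hH]
      rfl
    simp only [hsub, sub_mul]
    exact (integral_sub (K.integrable_row_mul x hg hB) (K'.integrable_row_mul x hg hB)).trans
      (sub_eq_zero.mpr hx')
  have h3 := congrFun ((Continuous.ae_eq_iff_eq volume (H.continuous_integral_row_mul hg hB)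
    continuous_const).mp h2) x₀
  have h4 : ∫ y, ‖H (x₀, y)‖ ^ 2 = 0 := by
    simp only [Complex.mul_conj', ← Complex.ofReal_pow] at h3
    rw [integral_complex_ofReal] at h3
    exact_mod_cast h3
  have hint : Integrable fun y => ‖H (x₀, y)‖ ^ 2 := by
    have := (memLp_two_iff_integrable_sq_norm hg.aestronglyMeasurable).mp hL
    simpa only [RCLike.norm_conj] using this
  rw [integral_eq_zero_iff_of_nonneg (fun y => by positivity) hint] at h4
  have h5 := congrFun ((Continuous.ae_eq_iff_eq volume (by fun_prop) continuous_const).mp h4) y₀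
  exact norm_eq_zero.mp (pow_eq_zero_iff two_ne_zero |>.mp h5)

/-! ### Logical states of Schwartz kernels -/

/-- The matrix `⟨j̄| K |k̄⟩`. -/
noncomputable def logicalMatrix (d : ℕ) (K : ℝ × ℝ → ℂ) : Matrix (ZMod d) (ZMod d) ℂ :=
  Matrix.of fun j k => codeword d j fun x => codeword d k fun y => K (x, y)

theorem injective_residue (d : ℕ) [NeZero d] (j : ZMod d) :
    Function.Injective fun N : ℤ => (j.val + d * N : ℤ) := fun N N' h => by
  have hd : (d : ℤ) ≠ 0 := Nat.cast_ne_zero.mpr (NeZero.ne d)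
  exact mul_left_cancel₀ hd (add_left_cancel h)

theorem codeword_eq (d : ℕ) (j : ZMod d) (f : ℝ → ℂ) :
    codeword d j f = 1 / (Real.sqrt (step d) : ℂ) *
      ∑' N : ℤ, f ((j.val + d * N : ℤ) * step d) := by
  rw [codeword]
  congr 2
  ext N
  congr 1
  push_cast
  ring

theorem one_div_sqrt_step_sq (d : ℕ) [NeZero d] :
    (1 / (Real.sqrt (step d) : ℂ)) * (1 / (Real.sqrt (step d) : ℂ)) = (step d : ℂ)⁻¹ := by
  rw [one_div_mul_one_div, ← Complex.ofReal_mul, Real.mul_self_sqrt (step_pos d).le, one_div]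

theorem summable_sample (d : ℕ) [NeZero d] (K : 𝓢(ℝ × ℝ, ℂ)) :
    Summable fun p : ℤ × ℤ => K (p.1 * step d, p.2 * step d) := by
  refine (summable_latticeSample d K 0).congr fun p => ?_
  simp [latticeSample]

theorem summable_sample_residue (d : ℕ) [NeZero d] (K : 𝓢(ℝ × ℝ, ℂ)) (j k : ZMod d) :
    Summable fun p : ℤ × ℤ =>
      K ((j.val + d * p.1 : ℤ) * step d, (k.val + d * p.2 : ℤ) * step d) :=
  (summable_sample d K).comp_injective
    (i := fun p : ℤ × ℤ => ((j.val + d * p.1 : ℤ), (k.val + d * p.2 : ℤ)))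
    fun p q h => by
      rw [Prod.mk.injEq] at h
      exact Prod.ext (injective_residue d j h.1) (injective_residue d k h.2)

theorem logicalMatrix_apply (d : ℕ) [NeZero d] (K : ℝ × ℝ → ℂ) (j k : ZMod d) :
    logicalMatrix d K j k = (step d : ℂ)⁻¹ * ∑' N : ℤ, ∑' N' : ℤ,
      K ((j.val + d * N : ℤ) * step d, (k.val + d * N' : ℤ) * step d) := by
  rw [logicalMatrix, Matrix.of_apply]
  simp only [codeword_eq]
  rw [tsum_mul_left, ← mul_assoc, one_div_sqrt_step_sq]

theorem projectKernel_eq_encode (d : ℕ) [NeZero d] (K : 𝓢(ℝ × ℝ, ℂ)) (f h : ℝ → ℂ) :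
    projectKernel d K f h = encode d (logicalMatrix d K) f h := by
  simp only [projectKernel, encode, codeProjector]
  refine Finset.sum_congr rfl fun j _ => ?_
  rw [← Finset.sum_mul]
  congr 1
  have hs : ∀ k : ZMod d, Summable fun N : ℤ =>
      codeword d k f * codeword d k fun y => K ((j.val + d * N : ℤ) * step d, y) := fun k => by
    simp only [codeword_eq d k fun y => K _]
    exact ((summable_sample_residue d K j k).prod.mul_left _).mul_left _
  have hsum : ∑' N : ℤ, kernelApply K (codeProjector d f) ((j.val + d * N : ℤ) * step d) =
      ∑ k : ZMod d, ∑' N : ℤ,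
        codeword d k f * codeword d k fun y => K ((j.val + d * N : ℤ) * step d, y) :=
    Summable.tsum_finsetSum fun k _ => hs k
  rw [codeword_eq, hsum, Finset.mul_sum]
  refine Finset.sum_congr rfl fun k _ => ?_
  rw [tsum_mul_left, logicalMatrix, Matrix.of_apply, codeword_eq d j]
  ring

/-- A test function on which only the codeword `|k̄⟩` does not vanish. -/
theorem exists_schwartz_codeword (d : ℕ) [NeZero d] (k : ZMod d) :
    ∃ f : 𝓢(ℝ, ℂ), ∀ j, codeword d j f = if j = k then 1 / (Real.sqrt (step d) : ℂ) else 0 := by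
  have hpos := step_pos d
  let b : ContDiffBump (k.val * step d : ℝ) := ⟨step d / 4, step d / 2, by linarith, by linarith⟩
  have hcs : HasCompactSupport fun x : ℝ => (b x : ℂ) :=
    b.hasCompactSupport.comp_left (g := ((↑) : ℝ → ℂ)) Complex.ofReal_zero
  have hcd : ContDiff ℝ ∞ fun x : ℝ => (b x : ℂ) :=
    Complex.ofRealCLM.contDiff.comp b.contDiff
  have hb : ∀ p : ℤ, b (p * step d) = if p = k.val then 1 else 0 := fun p => by
    by_cases hp : p = k.val
    · rw [if_pos hp, hp]
      exact b.one_of_mem_closedBall (by simp [b.rIn_pos.le])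
    · rw [if_neg hp]
      refine b.zero_of_le_dist ?_
      have h1 : (1 : ℝ) ≤ |(p : ℝ) - k.val| := by
        have : 1 ≤ |p - (k.val : ℤ)| := Int.one_le_abs (sub_ne_zero.mpr hp)
        exact_mod_cast this
      rw [Real.dist_eq, ← sub_mul, abs_mul, abs_of_pos hpos]
      change step d / 2 ≤ _
      nlinarith
  refine ⟨hcs.toSchwartzMap hcd, fun j => ?_⟩
  rw [codeword_eq]
  have h2 : ∀ N : ℤ, hcs.toSchwartzMap hcd ((j.val + d * N : ℤ) * step d) =
      if (j.val + d * N : ℤ) = k.val then 1 else 0 := fun N => by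
    change ((b ((j.val + d * N : ℤ) * step d) : ℝ) : ℂ) = _
    rw [hb]
    split_ifs <;> simp
  simp only [h2]
  have h3 : ∀ N : ℤ, (j.val + d * N : ℤ) = k.val ↔ j = k ∧ N = 0 := fun N => by
    have h4 := (residueEquiv d).injective.eq_iff (a := (j, N)) (b := (k, 0))
    simpa only [residueEquiv_apply, mul_zero, add_zero, Prod.mk.injEq] using h4
  simp only [h3]
  by_cases hjk : j = k
  · simp [hjk]
  · simp [hjk]

/-- The encoded operator determines the qudit operator. -/
theorem encode_injective {d : ℕ} [NeZero d] {M M' : Matrix (ZMod d) (ZMod d) ℂ}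
    (h : ∀ f g : 𝓢(ℝ, ℂ), encode d M f g = encode d M' f g) : M = M' := by
  have h0 : (1 / (Real.sqrt (step d) : ℂ)) ≠ 0 :=
    one_div_ne_zero (Complex.ofReal_ne_zero.mpr (Real.sqrt_pos.mpr (step_pos d)).ne')
  ext j k
  obtain ⟨f, hf⟩ := exists_schwartz_codeword d k
  obtain ⟨g, hg⟩ := exists_schwartz_codeword d j
  have h1 : ∀ M : Matrix (ZMod d) (ZMod d) ℂ, encode d M f g =
      M j k * (1 / (Real.sqrt (step d) : ℂ)) * (1 / (Real.sqrt (step d) : ℂ)) := fun M => by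
    rw [encode, Finset.sum_eq_single j, Finset.sum_eq_single k, hf, hg, if_pos rfl, if_pos rfl]
    · intro i _ hi
      rw [hf, if_neg hi, mul_zero, zero_mul]
    · simp
    · intro i _ hi
      simp only [hg, if_neg hi, mul_zero, Finset.sum_const_zero]
    · simp
  have h2 := h f g
  rw [h1, h1] at h2
  exact mul_right_cancel₀ h0 (mul_right_cancel₀ h0 h2)

theorem isLogicalState_iff {d : ℕ} [NeZero d] {A : ModeSpace →L[ℂ] ModeSpace}
    {K : 𝓢(ℝ × ℝ, ℂ)} (hA : IsKernel A K) (s t : ℝ) (M : Matrix (ZMod d) (ZMod d) ℂ) :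
    IsLogicalState d A s t M ↔ M = logicalMatrix d (displacedKernel K s t) := by
  constructor
  · rintro ⟨K', hK', h⟩
    rw [hK'.eq_of_schwartz (hA.displacedKernel s t)] at h
    refine encode_injective fun f g => ?_
    rw [← h, projectKernel_eq_encode]
  · rintro rfl
    exact ⟨_, hA.displacedKernel s t, fun f g => projectKernel_eq_encode d _ f g⟩

/-- The Gross Wigner function of a displaced logical state as a sum of the kernel over
antidiagonals of a lattice. The phase of the momentum displacement by `bℓ` is the character in the
Gross Wigner function. -/
theorem grossWigner_logicalMatrix (d : ℕ) [NeZero d] (K : 𝓢(ℝ × ℝ, ℂ)) (s t : ℝ) (a b : ZMod d) :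
    grossWigner d (logicalMatrix d (displacedKernel K s t)) a b =
      (step d : ℂ)⁻¹ * ∑' p : ℤ × ℤ,
        latticeSample d K (s + a.val * step d, t + b.val * step d) (p.1, d * p.2 - p.1) := by
  obtain ⟨P, hP⟩ : ∃ P : ℤ × ℤ → ℂ, ∀ p, P p =
      latticeSample d K (s + a.val * step d, t + b.val * step d) p := ⟨_, fun _ => rfl⟩
  have hS : Summable fun p : ℤ × ℤ => P (p.1, d * p.2 - p.1) := by
    simp only [hP]
    exact summable_latticeSample_antidiagonal d K _
  simp only [← hP]
  have hentry : ∀ p q : ℤ, (ZMod.stdAddChar (b * (q - p) : ZMod d) : ℂ) *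
      displacedKernel K s t (p * step d, q * step d) = P (p - a.val, q - a.val) := fun p q => by
    have h1 : (b * (q - p) : ZMod d) = ((b.val * (q - p) : ℤ) : ZMod d) := by simp
    rw [h1, stdAddChar_intCast, displacedKernel_apply, hP, latticeSample, ← mul_assoc,
      ← Complex.exp_add]
    congr 2
    · push_cast
      ring
    · ext <;> push_cast <;> ring
  -- For fixed `p = j + dN`, the position `q` runs through the residue class of `2a - j`, so
  -- `(p - a) + (q - a)` runs through the multiples of `d`.
  have hrow : ∀ (j : ZMod d) (N : ℤ), (ZMod.stdAddChar (2 * b * (a - j) : ZMod d) : ℂ) *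
      ∑' N' : ℤ, displacedKernel K s t
        ((j.val + d * N : ℤ) * step d, ((2 * a - j : ZMod d).val + d * N' : ℤ) * step d) =
      ∑' k : ℤ, P (residueEquiv d (j, N) - a.val, d * k - (residueEquiv d (j, N) - a.val)) :=
    fun j N => by
      obtain ⟨c, hc⟩ := exists_residue d (j := 2 * a - j) (p := 2 * a.val - j.val) (by simp)
      rw [← tsum_mul_left, ← (Equiv.addRight (c - N)).tsum_eq]
      refine tsum_congr fun N' => ?_
      rw [Equiv.coe_addRight]
      have h1 : (2 * b * (a - j) : ZMod d) =
          b * ((((2 * a - j : ZMod d).val + d * (N' + (c - N)) : ℤ) : ZMod d)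
            - ((j.val + d * N : ℤ) : ZMod d)) := by
        simp
        ring
      rw [h1, hentry, residueEquiv_apply]
      congr 2
      linear_combination hc
  have hS1 := ((Equiv.subRight (a.val : ℤ)).summable_iff.mpr hS.prod)
  have hS2 := (residueEquiv d).summable_iff.mpr hS1
  rw [grossWigner_eq_sum, hS.tsum_prod, ← (Equiv.subRight (a.val : ℤ)).tsum_eq,
    ← (residueEquiv d).tsum_eq]
  refine Eq.trans ?_ (congrArg _ hS2.tsum_prod.symm)
  rw [tsum_fintype, Finset.mul_sum]
  refine Finset.sum_congr rfl fun j _ => ?_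
  rw [logicalMatrix_apply, mul_left_comm, ← tsum_mul_left]
  congr 1
  exact tsum_congr fun N => hrow j N

theorem theorem2 (d : ℕ) [NeZero d] (hd : Odd d) (ρ : ModeSpace →L[ℂ] ModeSpace)
    (hρ : IsDensityOperator ρ) :
    -- every state, almost every point of the torus
    ((∃ W : ℝ × ℝ → ℂ, IsZakGrossWigner d ρ W) ∧
      (∃ R : ℝ × ℝ → Matrix (ZMod d) (ZMod d) ℂ, IsLogicalFamily d ρ R) ∧
      (∀ (W : ℝ × ℝ → ℂ) (R : ℝ × ℝ → Matrix (ZMod d) (ZMod d) ℂ),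
        IsZakGrossWigner d ρ W → IsLogicalFamily d ρ R →
        ∀ᵐ z ∂volume.restrict (torusCell (d * step d)),
          ∀ s ∈ Set.Ico 0 (step d), ∀ t ∈ Set.Ico 0 (step d), ∀ a b : ZMod d,
            z.1 = s + a.val * step d → z.2 = t + b.val * step d →
            W z = grossWigner d (R (s, t)) a b) ∧
      ((∀ z, Summable (zakGrossTerm d ρ z)) → IsZakGrossWigner d ρ (zakGrossWigner d ρ))) ∧
    -- states with a Schwartz kernel, every point of the torus
    ((∃ K : 𝓢(ℝ × ℝ, ℂ), IsKernel ρ K) →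
      ∀ z ∈ torusCell (d * step d),
        ∀ s ∈ Set.Ico 0 (step d), ∀ t ∈ Set.Ico 0 (step d), ∀ a b : ZMod d,
          z.1 = s + a.val * step d → z.2 = t + b.val * step d →
          Summable (zakGrossTerm d ρ z) ∧
          (∃! M : Matrix (ZMod d) (ZMod d) ℂ, IsLogicalState d ρ s t M) ∧
          ∀ M : Matrix (ZMod d) (ZMod d) ℂ, IsLogicalState d ρ s t M →
            zakGrossWigner d ρ z = grossWigner d M a b) := by
  refine ⟨⟨?_, hρ.exists_isLogicalFamily d, ?_, isZakGrossWigner_of_summable⟩, ?_⟩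
  · obtain ⟨R, hR⟩ := hρ.exists_isLogicalFamily d
    exact ⟨_, hR.isZakGrossWigner hd hρ⟩
  · intro W R hW hR
    filter_upwards [hW.ae_eq (hR.isZakGrossWigner hd hρ)] with z hz s hs t ht a b h1 h2
    have e : z = (s, t) + cellCorner d (a, b) := Prod.ext h1 h2
    rw [hz, e]
    exact assembledWigner_add d R (z := (s, t)) ⟨hs, ht⟩ (a, b)
  · rintro ⟨K, hK⟩ z - s - t - a b h1 h2
    obtain ⟨h, hh⟩ : ∃ h : ℤ, 2 * h = d + 1 := by
      obtain ⟨m, hm⟩ := hd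
      exact ⟨m + 1, by rw [hm]; push_cast; ring⟩
    refine ⟨hρ.summable_zakGrossTerm hK d hh z,
      ⟨_, (isLogicalState_iff hK s t _).mpr rfl, fun M hM => (isLogicalState_iff hK s t M).mp hM⟩,
      fun M hM => ?_⟩
    rw [(isLogicalState_iff hK s t M).mp hM, grossWigner_logicalMatrix,
      hρ.zakGrossWigner_eq hK d hh, show z = (s + a.val * step d, t + b.val * step d) from
        Prod.ext h1 h2]
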